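/- Let $k$ be a field and let $\mathcal C$ be a $k$-linear triangulated category with suspension $S$, split idempotents and finite-dimensional $\operatorname{Hom}$-spaces; write $D=\operatorname{Hom}_k(-,k)$ and $\operatorname{Ext}^1_{\mathcal C}(X,Y)=\mathcal C(X,SY)$. A $k$-linear triangulated category is called *Calabi-Yau of CY-dimension $d$* if it admits a Serre functor $\Sigma$ (an autoequivalence with natural $k$-linear isomorphisms $\operatorname{Hom}(Y,\Sigma X)\cong D\operatorname{Hom}(X,Y)$, regarded as a triangle functor with its canonical commutation with the suspension) together with an isomorphism of triangle functors $S^d\cong\Sigma$; composing $\operatorname{Hom}(X,S^dX)\cong\operatorname{Hom}(X,\Sigma X)\cong D\operatorname{Hom}(X,X)$ with evaluation at $1_X$ gives its trace forms $t_X:\operatorname{Hom}(X,S^dX)\to k$. Assume that $\mathcal C$ is Calabi-Yau of CY-dimension $2$, and let $\mathcal T\subseteq\mathcal C$ be a cluster tilting subcategory, i.e. a full $k$-linear subcategory such that (i) every $X\in\mathcal C$ has a right $\mathcal T$-approximation (a morphism $T\to X$ with $T\in\mathcal T$ through which every morphism $T'\to X$ with $T'\in\mathcal T$ factors), (ii)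 $\operatorname{Ext}^1_{\mathcal C}(T,T')=0$ for all $T,T'\in\mathcal T$, and (iii) every $X\in\mathcal C$ with $\operatorname{Ext}^1_{\mathcal C}(T,X)=0$ for all $T\in\mathcal T$ belongs to $\mathcal T$. Let $\operatorname{mod}\mathcal T$ be the (abelian) category of finitely presented contravariant $k$-linear functors from $\mathcal T$ to $k$-vector spaces, and let $\mathcal D^b_f(\operatorname{mod}\mathcal T)$ be the full triangulated subcategory of $\mathcal D^b(\operatorname{mod}\mathcal T)$ generated by the projectives. **Theorem.** The category $\operatorname{mod}\mathcal T$ has enough injectives, and the stable Cohen-Macaulay category $$\mathcal S=\mathcal D^b(\operatorname{mod}\mathcal T)/\mathcal D^b_f(\operatorname{mod}\mathcal T)$$ has finite-dimensional $\operatorname{Hom}$-spaces and is Calabi-Yau of CY-dimension $3$. Moreover, the Serre functor and the isomorphism of triangle functors $S^3\cong\Sigma$ on $\mathcal S$ can be chosen such that, for all $X,Y\in\operatorname{mod}\mathcal T$ and every monomorphism $X\to I$ into an injective object $I$ of $\operatorname{mod}\mathcal T$, there is an isomorphism $$D\operatorname{Ext}^2_{\operatorname{mod}\mathcal T}(Y,X)\;\cong\;\operatorname{cok}\bigl(\operatorname{Ext}^1_{\operatorname{mod}\mathcal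 T}(I,Y)\to\operatorname{Ext}^1_{\operatorname{mod}\mathcal T}(X,Y)\bigr)$$ which is canonical in the following sense: its inverse sends the class of $e\in\operatorname{Ext}^1(X,Y)$ to the linear form $f\mapsto t_X\bigl([f\circ e]\bigr)$, where $[f\circ e]\in\mathcal S(X,S^3X)$ is the image of the Yoneda product $f\circ e\in\operatorname{Ext}^3(X,X)$ and $t_X$ is the trace form of $\mathcal S$. -/

import Mathlib

open CategoryTheory Limits Pretriangulated ZeroObject

universe w v u w₁ w₂

namespace ClusterTilting

section Modules
variable (k : Type w) [Field k] {A : Type u} [Category.{v} A] [Preadditive A] [Linear k A]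

/-- A contravariant functor `M` from a `k`-linear category `A` to `k`-vector spaces is finitely
presented if it is the cokernel of a map between representable functors. (Used for additive `A`
only, where a finite direct sum of representable functors is representable. Such a cokernel is
automatically a `k`-linear functor.) -/
def IsFinitelyPresented : ObjectProperty (Aᵒᵖ ⥤ ModuleCat.{v} k) := fun M =>
  ∃ (T₁ T₀ : A) (f : T₁ ⟶ T₀) (p : (linearYoneda k A).obj T₀ ⟶ M)
    (w : (linearYoneda k A).map f ≫ p = 0), Nonempty (IsColimit (CokernelCofork.ofπ p w))

variable {k}

lemma isFinitelyPresented_iff (M : Aᵒᵖ ⥤ ModuleCat.{v} k) :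
    IsFinitelyPresented k M ↔
      ∃ (T₁ T₀ : A) (f : T₁ ⟶ T₀) (p : (linearYoneda k A).obj T₀ ⟶ M),
        (∀ U (y : M.obj U), ∃ x : U.unop ⟶ T₀, (p.app U).hom x = y) ∧
        (∀ U (x : U.unop ⟶ T₀), (p.app U).hom x = 0 ↔ ∃ z : U.unop ⟶ T₁, z ≫ f = x) := by
  constructor
  · rintro ⟨T₁, T₀, f, p, w, ⟨h⟩⟩
    have he : Epi p := epi_of_isColimit_cofork h
    let S := ShortComplex.mk _ _ w
    have hS : S.Exact := S.exact_of_g_is_cokernel h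
    refine ⟨T₁, T₀, f, p, ?_, ?_⟩
    · intro U y
      rw [NatTrans.epi_iff_epi_app] at he
      exact (ModuleCat.epi_iff_surjective _).1 (he U) y
    · intro U x
      have h' := hS.map ((evaluation _ _).obj U)
      rw [ShortComplex.moduleCat_exact_iff] at h'
      constructor
      · intro hx
        obtain ⟨z, hz⟩ := h' x hx
        exact ⟨z, hz⟩
      · rintro ⟨z, rfl⟩
        have := congr($(NatTrans.congr_app w U).hom z)
        exact this
  · rintro ⟨T₁, T₀, f, p, h₁, h₂⟩
    have w : (linearYoneda k A).map f ≫ p = 0 := by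
      ext U z
      exact (h₂ U _).2 ⟨z, rfl⟩
    let S := ShortComplex.mk _ _ w
    have he : Epi p := by
      rw [NatTrans.epi_iff_epi_app]
      intro U
      exact (ModuleCat.epi_iff_surjective _).2 (h₁ U)
    have : Epi S.g := he
    have hS : S.Exact := by
      rw [ShortComplex.exact_iff_isZero_homology, IsZero.iff_id_eq_zero]
      ext1
      ext1 U
      have : IsZero (S.homology.obj U) := by
        refine IsZero.of_iso ?_ (S.mapHomologyIso ((evaluation _ _).obj U)).symm
        rw [← ShortComplex.exact_iff_isZero_homology, ShortComplex.moduleCat_exact_iff]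
        intro x hx
        obtain ⟨z, hz⟩ := (h₂ U x).1 hx
        exact ⟨z, hz⟩
      exact this.eq_of_src _ _
    exact ⟨T₁, T₀, f, p, w, ⟨hS.gIsCokernel⟩⟩


instance : (IsFinitelyPresented k (A := A)).IsClosedUnderIsomorphisms where
  of_iso := by
    intro M N e hM
    rw [isFinitelyPresented_iff] at hM ⊢
    obtain ⟨T₁, T₀, f, p, h₁, h₂⟩ := hM
    have inj (U) (y : M.obj U) : (e.hom.app U).hom y = 0 ↔ y = 0 := by
      constructor
      · intro hy
        have h : (e.inv.app U).hom ((e.hom.app U).hom y) = y :=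
          congr($(NatTrans.congr_app e.hom_inv_id U).hom y)
        rw [← h, hy, map_zero]
      · rintro rfl
        simp
    refine ⟨T₁, T₀, f, p ≫ e.hom, fun U y => ?_, fun U x => ?_⟩
    · obtain ⟨x, hx⟩ := h₁ U ((e.inv.app U).hom y)
      refine ⟨x, ?_⟩
      have h : (e.hom.app U).hom ((e.inv.app U).hom y) = y :=
        congr($(NatTrans.congr_app e.inv_hom_id U).hom y)
      refine Eq.trans ?_ h
      exact congr((e.hom.app U).hom $hx)
    · rw [← h₂ U x]
      exact inj U _

/-- The (property-only) existence of weak pullbacks. -/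
def HasWeakPullbacks (A : Type u) [Category.{v} A] : Prop :=
  ∀ ⦃X Y Z : A⦄ (a : X ⟶ Z) (b : Y ⟶ Z), ∃ (W : A) (r : W ⟶ X) (s : W ⟶ Y), r ≫ a = s ≫ b ∧
    ∀ ⦃U : A⦄ (x : U ⟶ X) (y : U ⟶ Y), x ≫ a = y ≫ b → ∃ h : U ⟶ W, h ≫ r = x

lemma app_comp {M : Aᵒᵖ ⥤ ModuleCat.{v} k} {T₀ : A} (p : (linearYoneda k A).obj T₀ ⟶ M)
    {U V : A} (x : U ⟶ T₀) (h : V ⟶ U) :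
    (p.app (.op V)).hom (h ≫ x) = (M.map h.op).hom ((p.app (.op U)).hom x) :=
  congr($(p.naturality h.op).hom x)

lemma exists_lift {M N : Aᵒᵖ ⥤ ModuleCat.{v} k} {S₀ T₀ : A}
    (p : (linearYoneda k A).obj S₀ ⟶ M) (q : (linearYoneda k A).obj T₀ ⟶ N) (φ : M ⟶ N)
    (hq : ∀ U (y : N.obj U), ∃ x : U.unop ⟶ T₀, (q.app U).hom x = y) :
    ∃ a : S₀ ⟶ T₀, ∀ (U) (x : U.unop ⟶ S₀),
      (φ.app U).hom ((p.app U).hom x) = (q.app U).hom (x ≫ a) := by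
  obtain ⟨a, ha⟩ := hq (.op S₀) ((φ.app _).hom ((p.app (.op S₀)).hom (𝟙 S₀)))
  refine ⟨a, fun U x => ?_⟩
  have h₁ := app_comp (p ≫ φ) (𝟙 S₀) x
  have h₂ := app_comp q a x
  rw [Category.comp_id] at h₁
  refine h₁.trans (Eq.trans ?_ h₂.symm)
  exact congr((N.map x.op).hom $ha.symm)

lemma isClosedUnderKernels (hA : HasWeakPullbacks A) :
    ObjectProperty.IsClosedUnderKernels (IsFinitelyPresented k (A := A)) where
  kernels_le := by
    rintro _ ⟨φ, K, hK, ⟨hM, hN⟩⟩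
    rename_i M N
    rw [isFinitelyPresented_iff] at hM hN ⊢
    obtain ⟨S₁, S₀, s, p, p₁, p₂⟩ := hM
    obtain ⟨T₁, T₀, t, q, q₁, q₂⟩ := hN
    obtain ⟨a, ha⟩ := exists_lift p q φ q₁
    obtain ⟨W, r, r', hr, hW⟩ := hA a t
    obtain ⟨W', s₁, s₂, hs, hW'⟩ := hA r s
    have h (U : Aᵒᵖ) (x : U.unop ⟶ W) : (x ≫ r') ≫ t = (x ≫ r) ≫ a := by simp [hr]
    obtain ⟨l, hl⟩ := KernelFork.IsLimit.lift' hK ((linearYoneda k A).map r ≫ p) (by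
      ext U x
      exact (ha U (x ≫ r)).trans ((q₂ U _).2 ⟨x ≫ r', h U x⟩))
    have hl' (U) (x : U.unop ⟶ W) :
        (K.ι.app U).hom ((l.app U).hom x) = (p.app U).hom (x ≫ r) :=
      congr($(NatTrans.congr_app hl U).hom x)
    have hmono : Mono K.ι := mono_of_isLimit_fork hK
    have inj (U) : Function.Injective (K.ι.app U).hom := by
      rw [NatTrans.mono_iff_mono_app] at hmono
      exact (ModuleCat.mono_iff_injective _).1 (hmono U)
    refine ⟨W', W, s₁, l, fun U y => ?_, fun U x => ?_⟩
    · obtain ⟨x, hx⟩ := p₁ U ((K.ι.app U).hom y)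
      have h0 : (q.app U).hom (x ≫ a) = 0 := by
        rw [← ha, hx]
        exact congr($(NatTrans.congr_app K.condition U).hom y)
      obtain ⟨z, hz⟩ := (q₂ U _).1 h0
      obtain ⟨h, hh⟩ := hW x z hz.symm
      refine ⟨h, inj U ?_⟩
      rw [hl', hh, hx]
    · rw [← map_eq_zero_iff _ (inj U), hl', p₂]
      constructor
      · rintro ⟨z, hz⟩
        exact hW' x z hz.symm
      · rintro ⟨z, rfl⟩
        exact ⟨z ≫ s₂, by simp [hs]⟩

lemma isClosedUnderCokernels [HasBinaryBiproducts A] :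
    ObjectProperty.IsClosedUnderCokernels (IsFinitelyPresented k (A := A)) where
  cokernels_le := by
    rintro _ ⟨φ, K, hK, ⟨hM, hN⟩⟩
    rename_i M N
    rw [isFinitelyPresented_iff] at hM hN ⊢
    obtain ⟨S₁, S₀, s, p, p₁, p₂⟩ := hM
    obtain ⟨T₁, T₀, t, q, q₁, q₂⟩ := hN
    obtain ⟨a, ha⟩ := exists_lift p q φ q₁
    have hepi : Epi K.π := epi_of_isColimit_cofork hK
    have surj (U) : Function.Surjective (K.π.app U).hom := by
      rw [NatTrans.epi_iff_epi_app] at hepi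
      exact (ModuleCat.epi_iff_surjective _).1 (hepi U)
    let S := ShortComplex.mk φ K.π K.condition
    have hS : S.Exact := S.exact_of_g_is_cokernel
      (IsColimit.ofIsoColimit hK (Cofork.ext (Iso.refl _)))
    have ex (U) (y : N.obj U) (hy : (K.π.app U).hom y = 0) : ∃ x, (φ.app U).hom x = y := by
      have h' := hS.map ((evaluation _ _).obj U)
      rw [ShortComplex.moduleCat_exact_iff] at h'
      exact h' y hy
    refine ⟨S₀ ⊞ T₁, T₀, biprod.desc a t, q ≫ K.π, fun U y => ?_, fun U x => ?_⟩
    · obtain ⟨y', rfl⟩ := surj U y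
      obtain ⟨x, rfl⟩ := q₁ U y'
      exact ⟨x, rfl⟩
    · constructor
      · intro hx
        obtain ⟨m, hm⟩ := ex U ((q.app U).hom x) hx
        obtain ⟨z, rfl⟩ := p₁ U m
        rw [ha] at hm
        have h0 : (q.app U).hom (x - z ≫ a) = 0 := by
          have := map_sub (q.app U).hom x (z ≫ a)
          exact this.trans (sub_eq_zero.2 hm.symm)
        obtain ⟨y, hy⟩ := (q₂ U _).1 h0
        exact ⟨biprod.lift z y, by simp [hy]⟩
      · rintro ⟨z, rfl⟩
        have h₁ : (q.app U).hom ((z ≫ biprod.snd) ≫ t) = 0 := (q₂ U _).2 ⟨_, rfl⟩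
        have h₂ : (K.π.app U).hom ((q.app U).hom ((z ≫ biprod.fst) ≫ a)) = 0 := by
          rw [← ha]
          exact congr($(NatTrans.congr_app K.condition U).hom _)
        have h₃ : z ≫ biprod.desc a t = (z ≫ biprod.fst) ≫ a + (z ≫ biprod.snd) ≫ t := by
          simp [biprod.desc_eq]
        have h₄ := map_add (q.app U).hom ((z ≫ biprod.fst) ≫ a) ((z ≫ biprod.snd) ≫ t)
        change (K.π.app U).hom ((q.app U).hom _) = 0
        rw [h₃]
        refine (congrArg (K.π.app U).hom h₄).trans ?_
        refine (congrArg (K.π.app U).hom (congrArg₂ (· + ·) rfl h₁)).trans ?_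
        refine (congrArg (K.π.app U).hom (add_zero _)).trans h₂

lemma prop_biprod [HasBinaryBiproducts A] {M N : Aᵒᵖ ⥤ ModuleCat.{v} k}
    (hM : IsFinitelyPresented k M) (hN : IsFinitelyPresented k N) :
    IsFinitelyPresented k (M ⊞ N) := by
  rw [isFinitelyPresented_iff] at hM hN ⊢
  obtain ⟨S₁, S₀, s, p, p₁, p₂⟩ := hM
  obtain ⟨T₁, T₀, t, q, q₁, q₂⟩ := hN
  have hfst (U) (x : U.unop ⟶ S₀ ⊞ T₀) : ((biprod.fst : M ⊞ N ⟶ M).app U).hom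
      (((biprod.lift ((linearYoneda k A).map biprod.fst ≫ p)
        ((linearYoneda k A).map biprod.snd ≫ q)).app U).hom x) =
      (p.app U).hom (x ≫ biprod.fst) := by
    exact congr($(NatTrans.congr_app (biprod.lift_fst ((linearYoneda k A).map biprod.fst ≫ p)
        ((linearYoneda k A).map biprod.snd ≫ q)) U).hom x)
  have hsnd (U) (x : U.unop ⟶ S₀ ⊞ T₀) : ((biprod.snd : M ⊞ N ⟶ N).app U).hom
      (((biprod.lift ((linearYoneda k A).map biprod.fst ≫ p)
        ((linearYoneda k A).map biprod.snd ≫ q)).app U).hom x) =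
      (q.app U).hom (x ≫ biprod.snd) := by
    exact congr($(NatTrans.congr_app (biprod.lift_snd ((linearYoneda k A).map biprod.fst ≫ p)
        ((linearYoneda k A).map biprod.snd ≫ q)) U).hom x)
  have hext (U) (y y' : (M ⊞ N).obj U)
      (h₁ : ((biprod.fst : M ⊞ N ⟶ M).app U).hom y = ((biprod.fst : M ⊞ N ⟶ M).app U).hom y')
      (h₂ : ((biprod.snd : M ⊞ N ⟶ N).app U).hom y = ((biprod.snd : M ⊞ N ⟶ N).app U).hom y') :
      y = y' := by
    have e (z : (M ⊞ N).obj U) : ((biprod.inl : M ⟶ M ⊞ N).app U).hom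
        (((biprod.fst : M ⊞ N ⟶ M).app U).hom z) + ((biprod.inr : N ⟶ M ⊞ N).app U).hom
        (((biprod.snd : M ⊞ N ⟶ N).app U).hom z) = z :=
      congr($(NatTrans.congr_app (biprod.total (X := M) (Y := N)) U).hom z)
    rw [← e y, ← e y', h₁, h₂]
  refine ⟨S₁ ⊞ T₁, S₀ ⊞ T₀, biprod.map s t, biprod.lift ((linearYoneda k A).map biprod.fst ≫ p)
    ((linearYoneda k A).map biprod.snd ≫ q), fun U y => ?_, fun U x => ?_⟩
  · obtain ⟨x, hx⟩ := p₁ U (((biprod.fst : M ⊞ N ⟶ M).app U).hom y)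
    obtain ⟨x', hx'⟩ := q₁ U (((biprod.snd : M ⊞ N ⟶ N).app U).hom y)
    refine ⟨biprod.lift x x', hext U _ _ ?_ ?_⟩
    · rw [hfst, biprod.lift_fst, hx]
    · rw [hsnd, biprod.lift_snd, hx']
  · constructor
    · intro hx
      obtain ⟨z, hz⟩ := (p₂ U (x ≫ biprod.fst)).1 (by rw [← hfst, hx, map_zero])
      obtain ⟨z', hz'⟩ := (q₂ U (x ≫ biprod.snd)).1 (by rw [← hsnd, hx, map_zero])
      exact ⟨biprod.lift z z', by ext <;> simp [hz, hz']⟩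
    · rintro ⟨z, rfl⟩
      refine hext U _ _ ?_ ?_
      · rw [hfst, map_zero, p₂]
        exact ⟨z ≫ biprod.fst, by simp⟩
      · rw [hsnd, map_zero, q₂]
        exact ⟨z ≫ biprod.snd, by simp⟩

lemma isClosedUnderBinaryProducts [HasBinaryBiproducts A] :
    ObjectProperty.IsClosedUnderBinaryProducts (IsFinitelyPresented k (A := A)) where
  limitsOfShape_le := by
    rintro X ⟨p⟩
    let e : p.diag.obj ⟨.left⟩ ⊞ p.diag.obj ⟨.right⟩ ≅ X :=
      IsLimit.conePointsIsoOfNatIso (BinaryBiproduct.isLimit _ _) p.isLimit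
        (diagramIsoPair p.diag).symm
    exact ObjectProperty.prop_of_iso (IsFinitelyPresented k (A := A)) e
      (prop_biprod (p.prop_diag_obj _) (p.prop_diag_obj _))

lemma containsZero [HasZeroObject A] :
    ObjectProperty.ContainsZero (IsFinitelyPresented k (A := A)) where
  exists_zero := by
    refine ⟨_, isZero_zero _, ?_⟩
    rw [isFinitelyPresented_iff]
    have h (U) (y : (0 : Aᵒᵖ ⥤ ModuleCat.{v} k).obj U) : y = 0 := by
      have := (((evaluation _ _).obj U).map_isZero (isZero_zero (Aᵒᵖ ⥤ ModuleCat.{v} k)))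
      exact congr($(this.eq_of_src (𝟙 _) 0).hom y)
    refine ⟨0, 0, 0, 0, fun U y => ⟨0, (h U _).trans (h U _).symm⟩, fun U x => ?_⟩
    exact ⟨fun _ => ⟨0, (isZero_zero A).eq_of_tgt _ _⟩, fun _ => h U _⟩

end Modules

section Triangulated

variable {C : Type u} [Category.{v} C] [HasZeroObject C] [HasShift C ℤ] [Preadditive C]
  [∀ n : ℤ, (shiftFunctor C n).Additive] [Pretriangulated C]

/-- A full subcategory `T` of a triangulated category is cluster tilting if it is contravariantly
finite (every object has a right `T`-approximation), `Ext¹` vanishes between objects of `T`,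
and every `X` with `Ext¹(T', X) = 0` for all `T'` in `T` belongs to `T`; here
`Ext¹(X, Y) = Hom(X, Y⟦1⟧)`. Such a `T` is closed under isomorphisms and finite direct sums. -/
class IsClusterTilting (T : ObjectProperty C) : Prop where
  exists_rightApproximation (X : C) : ∃ (T₀ : C) (_ : T T₀) (f : T₀ ⟶ X),
    ∀ ⦃T' : C⦄ (_ : T T') (g : T' ⟶ X), ∃ h : T' ⟶ T₀, h ≫ f = g
  ext_eq_zero ⦃T' T'' : C⦄ (_ : T T') (_ : T T'') (f : T' ⟶ T''⟦(1 : ℤ)⟧) : f = 0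
  mem_of_ext_eq_zero (X : C) (_ : ∀ ⦃T' : C⦄ (_ : T T') (f : T' ⟶ X⟦(1 : ℤ)⟧), f = 0) : T X

variable (T : ObjectProperty C) [IsClusterTilting T]

instance : T.IsClosedUnderIsomorphisms where
  of_iso {X Y} e hX := IsClusterTilting.mem_of_ext_eq_zero _ fun T' hT' f => by
    have h := IsClusterTilting.ext_eq_zero hT' hX (f ≫ e.inv⟦(1 : ℤ)⟧')
    simpa using congr($h ≫ e.hom⟦(1 : ℤ)⟧')

instance : T.ContainsZero where
  exists_zero := ⟨0, isZero_zero C, IsClusterTilting.mem_of_ext_eq_zero _ fun _ _ _ =>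
    ((shiftFunctor C (1 : ℤ)).map_isZero (isZero_zero C)).eq_of_tgt _ _⟩

instance : T.IsClosedUnderFiniteProducts := by
  have : T.IsClosedUnderBinaryProducts := ⟨by
    rintro X ⟨p⟩
    let e : p.diag.obj ⟨.left⟩ ⊞ p.diag.obj ⟨.right⟩ ≅ X :=
      IsLimit.conePointsIsoOfNatIso (BinaryBiproduct.isLimit _ _) p.isLimit
        (diagramIsoPair p.diag).symm
    refine T.prop_of_iso e (IsClusterTilting.mem_of_ext_eq_zero _ fun T' hT' f => ?_)
    have h₁ := IsClusterTilting.ext_eq_zero hT' (p.prop_diag_obj ⟨.left⟩)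
      (f ≫ biprod.fst⟦(1 : ℤ)⟧')
    have h₂ := IsClusterTilting.ext_eq_zero hT' (p.prop_diag_obj ⟨.right⟩)
      (f ≫ biprod.snd⟦(1 : ℤ)⟧')
    have h₃ := congr(f ≫ (shiftFunctor C (1 : ℤ)).map
      $(biprod.total (X := p.diag.obj ⟨.left⟩) (Y := p.diag.obj ⟨.right⟩)))
    rw [Functor.map_add, Preadditive.comp_add, Functor.map_comp, Functor.map_comp,
      reassoc_of% h₁, reassoc_of% h₂, CategoryTheory.Functor.map_id, Category.comp_id] at h₃
    rw [← h₃]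
    simp⟩
  exact ObjectProperty.IsClosedUnderFiniteProducts.mk'

instance : HasZeroObject T.FullSubcategory := inferInstance

instance : HasBinaryBiproducts T.FullSubcategory :=
  have : HasFiniteBiproducts T.FullSubcategory := HasFiniteBiproducts.of_hasFiniteProducts
  hasBinaryBiproducts_of_finite_biproducts _

lemma hasWeakPullbacks : HasWeakPullbacks T.FullSubcategory := by
  intro X Y Z a b
  obtain ⟨K, i, δ, hK⟩ := distinguished_cocone_triangle₁ (biprod.desc a.hom (-b.hom))
  obtain ⟨W, hW, f, hf⟩ := IsClusterTilting.exists_rightApproximation (T := T) K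
  have hi : i ≫ biprod.desc a.hom (-b.hom) = 0 := comp_distTriang_mor_zero₁₂ _ hK
  refine ⟨⟨W, hW⟩, T.homMk (f ≫ i ≫ biprod.fst), T.homMk (f ≫ i ≫ biprod.snd), ?_, ?_⟩
  · ext1
    simp only [biprod.desc_eq] at hi
    have := congr(f ≫ $hi)
    simpa [← sub_eq_add_neg, sub_eq_zero] using this
  · intro U x y hxy
    have hxy' : x.hom ≫ a.hom = y.hom ≫ b.hom := congr(($hxy).hom)
    obtain ⟨l, hl⟩ : ∃ l : U.obj ⟶ K, biprod.lift x.hom y.hom = l ≫ i :=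
      Triangle.coyoneda_exact₂ _ hK (biprod.lift x.hom y.hom) (by
      change biprod.lift x.hom y.hom ≫ biprod.desc a.hom (-b.hom) = 0
      rw [biprod.lift_desc, hxy', Preadditive.comp_neg, add_neg_cancel])
    obtain ⟨h, hh⟩ := hf U.property l
    refine ⟨T.homMk h, ?_⟩
    ext1
    change h ≫ f ≫ i ≫ biprod.fst = x.hom
    rw [← Category.assoc, hh]
    have := congr($hl ≫ biprod.fst)
    rw [biprod.lift_fst, Category.assoc] at this
    exact this.symm

variable (k : Type w) [Field k] [Linear k C]

/-- The category `mod T` of finitely presented `T`-modules, i.e. of finitely presented contravariant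
`k`-linear functors from `T` to `k`-vector spaces. -/
abbrev ModT (T : ObjectProperty C) : Type _ :=
  (IsFinitelyPresented k (A := T.FullSubcategory)).FullSubcategory

/-- `mod T` is abelian: kernels, cokernels and finite products of finitely presented modules
are finitely presented. -/
noncomputable instance : Abelian (ModT k T) :=
  have := isClosedUnderKernels (k := k) (hasWeakPullbacks T)
  have := isClosedUnderCokernels (k := k) (A := T.FullSubcategory)
  have := containsZero (k := k) (A := T.FullSubcategory)
  have := isClosedUnderBinaryProducts (k := k) (A := T.FullSubcategory)
  have : ObjectProperty.IsClosedUnderFiniteProducts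
    (IsFinitelyPresented k (A := T.FullSubcategory)) := .mk'
  inferInstance

end Triangulated

section Serre

variable (k : Type w) [Field k] (D : Type u) [Category.{v} D] [Preadditive D] [Linear k D]

/-- A Serre functor on a `k`-linear category: an autoequivalence `Σ` with `k`-linear isomorphisms
`Hom(Y, Σ X) ≅ Hom(X, Y)^*`, natural in `X` and `Y`. (By naturality, `Σ` is `k`-linear.) -/
structure SerreFunctor where
  functor : D ⥤ D
  isEquivalence : functor.IsEquivalence
  duality (X Y : D) : (Y ⟶ functor.obj X) ≃ₗ[k] Module.Dual k (X ⟶ Y)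
  duality_comp {X Y Y' : D} (g : Y' ⟶ Y) (φ : Y ⟶ functor.obj X) (f : X ⟶ Y') :
    duality X Y' (g ≫ φ) f = duality X Y φ (f ≫ g)
  duality_comp_map {X X' Y : D} (φ : Y ⟶ functor.obj X) (g : X ⟶ X') (f : X' ⟶ Y) :
    duality X' Y (φ ≫ functor.map g) f = duality X Y φ (g ≫ f)

variable {k D}
variable [HasShift D ℤ] [∀ n : ℤ, (shiftFunctor D n).Additive]
  [∀ n : ℤ, (shiftFunctor D n).Linear k]

/-- With `Z = Σ(X⟦1⟧)`, the functional on `Hom(X, Z⟦-1⟧)` which sends `f` to minus the value of the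
functional corresponding to `𝟙 Z` at `f⟦1⟧ : X⟦1⟧ ⟶ Z⟦-1⟧⟦1⟧ ≅ Z`. -/
noncomputable def SerreFunctor.shiftFunctional (S : SerreFunctor k D) (X : D) :
    Module.Dual k (X ⟶ (S.functor.obj (X⟦(1 : ℤ)⟧))⟦(-1 : ℤ)⟧) where
  toFun f := - S.duality (X⟦(1 : ℤ)⟧) _ (𝟙 _) (f⟦(1 : ℤ)⟧' ≫ (shiftNegShift _ (1 : ℤ)).hom)
  map_add' f g := by
    rw [Functor.map_add, Preadditive.add_comp, map_add, neg_add]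
  map_smul' c f := by
    rw [Functor.map_smul, Linear.smul_comp, map_smul, RingHom.id_apply, smul_neg]

/-- The canonical commutation `η : Σ(X⟦1⟧) ⟶ (Σ X)⟦1⟧` of a Serre functor with the suspension,
which turns `Σ` into a triangle functor. It is determined by the duality: if the functionals
`Hom(X, Y) → k` and `Hom(X⟦1⟧, Y⟦1⟧) → k` correspond to `ψ : Y ⟶ Σ X` and to
`φ : Y⟦1⟧ ⟶ Σ(X⟦1⟧)`, then `φ ≫ η = ψ⟦1⟧` means that they agree up to the sign `-1`
under `f ↦ f⟦1⟧`; see `SerreFunctor.duality_shift`. -/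
noncomputable def SerreFunctor.shiftComparison (S : SerreFunctor k D) (X : D) :
    S.functor.obj (X⟦(1 : ℤ)⟧) ⟶ (S.functor.obj X)⟦(1 : ℤ)⟧ :=
  (shiftNegShift _ (1 : ℤ)).inv ≫ ((S.duality X _).symm (S.shiftFunctional X))⟦(1 : ℤ)⟧'

lemma SerreFunctor.duality_shift (S : SerreFunctor k D) {X Y : D}
    (φ : Y⟦(1 : ℤ)⟧ ⟶ S.functor.obj (X⟦(1 : ℤ)⟧)) (ψ : Y ⟶ S.functor.obj X)
    (h : φ ≫ S.shiftComparison X = ψ⟦(1 : ℤ)⟧') (f : X ⟶ Y) :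
    S.duality (X⟦(1 : ℤ)⟧) (Y⟦(1 : ℤ)⟧) φ (f⟦(1 : ℤ)⟧') = - S.duality X Y ψ f := by
  obtain ⟨χ, hχ⟩ : ∃ χ : Y ⟶ (S.functor.obj (X⟦(1 : ℤ)⟧))⟦(-1 : ℤ)⟧,
      χ⟦(1 : ℤ)⟧' = φ ≫ (shiftNegShift _ (1 : ℤ)).inv :=
    (shiftFunctor D (1 : ℤ)).map_surjective _
  have h₁ : ψ = χ ≫ (S.duality X _).symm (S.shiftFunctional X) := by
    apply (shiftFunctor D (1 : ℤ)).map_injective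
    rw [Functor.map_comp, hχ, ← h, Category.assoc]
    rfl
  rw [h₁, S.duality_comp, LinearEquiv.apply_symm_apply]
  simp only [SerreFunctor.shiftFunctional, LinearMap.coe_mk, AddHom.coe_mk, neg_neg, Functor.map_comp, Category.assoc, hχ,
    Iso.inv_hom_id, Category.comp_id]
  rw [← S.duality_comp, Category.comp_id]

variable (k D)

/-- A Calabi-Yau structure of dimension `d` on a `k`-linear triangulated category with suspension
`⟦1⟧`: a Serre functor `Σ` and an isomorphism of triangle functors from `⟦d⟧` to `Σ`, i.e.
an isomorphism of functors compatible with the commutations with the suspension. The commutation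
of the triangle functor `⟦d⟧` is the canonical one multiplied by `(-1)^d`, that of `Σ` is
`SerreFunctor.shiftComparison`. -/
structure CalabiYauStructure (d : ℤ) where
  serre : SerreFunctor k D
  iso : shiftFunctor D d ≅ serre.functor
  iso_shift (X : D) :
    iso.hom.app (X⟦(1 : ℤ)⟧) ≫ serre.shiftComparison X =
      d.negOnePow • ((shiftComm X (1 : ℤ) d).hom ≫ (iso.hom.app X)⟦(1 : ℤ)⟧')

variable {k D}

/-- The trace form `Hom(X, X⟦d⟧) → k` of a Calabi-Yau structure: the image of the identity under
`Hom(X, X⟦d⟧) ≅ Hom(X, Σ X) ≅ Hom(X, X)^*`. -/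
def CalabiYauStructure.trace {d : ℤ} (cy : CalabiYauStructure k D d) (X : D) :
    ShiftedHom X X d → k :=
  fun f => cy.serre.duality X X (f ≫ cy.iso.hom.app X) (𝟙 X)

end Serre

section StableCM

section
variable {D : Type u} [Category.{v} D] [HasZeroObject D] [HasShift D ℤ] [Preadditive D]
  [∀ n : ℤ, (shiftFunctor D n).Additive] [Pretriangulated D]

/-- The smallest strictly full triangulated subcategory containing the objects satisfying `P`. -/
def triangulatedHull (P : ObjectProperty D) : ObjectProperty D := fun X =>
  ∀ Q : ObjectProperty D, Q.IsTriangulated → Q.IsClosedUnderIsomorphisms → P ≤ Q → Q X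

variable (P : ObjectProperty D)

instance : (triangulatedHull P).IsClosedUnderIsomorphisms where
  of_iso e hX Q hQ hQ' hP := Q.prop_of_iso e (hX Q hQ hQ' hP)

instance : (triangulatedHull P).IsTriangulated where
  exists_zero := ⟨0, isZero_zero D, fun Q _ _ _ => Q.prop_zero⟩
  isStableUnderShiftBy n := ⟨fun _ hX Q hQ hQ' hP => Q.le_shift n _ (hX Q hQ hQ' hP)⟩
  ext₂' Z hZ h₁ h₃ := (triangulatedHull P).le_isoClosure _ fun Q hQ hQ' hP =>
    Q.ext_of_isTriangulatedClosed₂ Z hZ (h₁ Q hQ hQ' hP) (h₃ Q hQ hQ' hP)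
end

section
variable {D : Type u} [Category.{v} D] [Preadditive D] [HasShift D ℤ]

instance (k : Type*) [Ring k] [Linear k D] [∀ n : ℤ, (shiftFunctor D n).Linear k]
    (P : ObjectProperty D) [P.IsStableUnderShift ℤ] (n : ℤ) :
    (shiftFunctor P.FullSubcategory n).Linear k where
  map_smul {X Y} f r := by
    apply P.ι.map_injective
    rw [← cancel_mono ((P.ι.commShiftIso n).hom.app Y), Functor.commShiftIso_hom_naturality,
      Functor.map_smul, Functor.map_smul, Functor.map_smul, Linear.smul_comp, Linear.comp_smul,
      Functor.commShiftIso_hom_naturality]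
end

variable (A : Type u) [Category.{v} A] [Abelian A] [HasDerivedCategory.{w} A]

/-- The inclusion of an abelian category into its bounded derived category, as complexes
concentrated in degree `0`. -/
noncomputable def stalk : A ⥤ DerivedCategory.Bounded A :=
  ObjectProperty.lift _ (DerivedCategory.singleFunctor A 0)
    fun _ => ⟨⟨0, inferInstanceAs (DerivedCategory.IsGE _ 0)⟩,
      ⟨0, inferInstanceAs (DerivedCategory.IsLE _ 0)⟩⟩

/-- The full triangulated subcategory `D^b_f(A)` of `D^b(A)` generated by the projectives. -/
def finiteDerived : ObjectProperty (DerivedCategory.Bounded A) :=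
  triangulatedHull fun X => ∃ P : A, Projective P ∧ Nonempty (X ≅ (stalk A).obj P)

instance : (finiteDerived A).IsTriangulated :=
  inferInstanceAs (triangulatedHull _).IsTriangulated

/-- The stable Cohen-Macaulay category of `A`: the Verdier quotient `D^b(A)/D^b_f(A)`, with its
structure of a triangulated category. -/
abbrev StableCM := (finiteDerived A).trW.Localization

variable {A}

/-- The image of an object of `A` in the stable Cohen-Macaulay category. -/
noncomputable abbrev toStableCM (X : A) : StableCM A :=
  (finiteDerived A).trW.Q.obj ((stalk A).obj X)

/-- The canonical map `Ext^n(X, Y) → Hom(X, Y⟦n⟧)` from the Yoneda extensions in `A` to the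
morphisms of the stable Cohen-Macaulay category. -/
noncomputable def extToStableCM [HasExt.{w₁} A] {X Y : A} {n : ℕ} (e : Abelian.Ext X Y n) :
    ShiftedHom (toStableCM X) (toStableCM Y) (n : ℤ) :=
  ShiftedHom.map (X := (stalk A).obj X) (Y := (stalk A).obj Y)
    (ObjectProperty.homMk
      (e.hom ≫ (DerivedCategory.Bounded.ι.commShiftIso (n : ℤ)).inv.app ((stalk A).obj Y)))
    (finiteDerived A).trW.Q

end StableCM

end ClusterTilting

open ClusterTilting

universe v₁ u₁

/-! Let F : C → mod T send X to the restriction of Hom(-, X) to T. Approximation triangles T₁ → T₀ →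
X → T₁⟦1⟧ with T₁, T₀ in T make F full and essentially surjective. It is homological, kills T⟦1⟧,
and the F U with U in T are enough projectives. Serre duality makes F(U⟦2⟧) injective, and
approximation triangles of U⟦1⟧ and U⟦-1⟧ yield short exact sequences 0 → F T₁ → F T₀ → F(U⟦2⟧) → 0
and 0 → F U → F(T₁⟦2⟧) → F(T₀⟦2⟧) → 0. So mod T has enough injectives and is Gorenstein of dimension
at most one (`isGorensteinOne`).

For such an abelian category, a calculus of fractions with controlled denominators
(`map_trW_surjective`, `map_trW_injective`) shows that Extⁿ(X, Y) → 𝒮(X, SⁿY) is bijective for n ≥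
2, surjective for n = 1, and surjective for n = 0 if X embeds into a projective. Every object of 𝒮
is the image of such a torsionless X. Hence Hom-finiteness, and every question about 𝒮 becomes one
about Ext groups in mod T.

A Calabi-Yau structure is produced from trace forms that are symmetric, nondegenerate and compatible
with the suspension (`TraceFamily`). The forms come from C. Write a module as F(K⟦1⟧). The triangles
K → T₁ → T₀ → K⟦1⟧ and T₃ → T₂ → K → T₃⟦1⟧ splice to the start F T₂ → F T₁ → F T₀ of a projective
resolution. A class in Ext³(F(K⟦1⟧), F Z) is a map from the third syzygy R to F Z; its restriction
along F T₃ → R is a morphism y : T₃ → Z, and K → T₃⟦1⟧ → Z⟦1⟧ depends only on the class. This is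
`Resolution.theta`; for Z = K⟦1⟧ it is followed by the trace form of C on Hom(K, K⟦2⟧).

Symmetry is the naturality of `theta` (`theta_mk₀_comp`, `theta_comp_mk₀`). For nondegeneracy, a
linear form on Hom(K, L) that vanishes on the maps which become projectively trivial is represented
by a morphism in the image of `theta` (`exists_theta_eq_of_forall`). Compatibility with the
suspension is the equality of the traces of δ·h and h·δ for the class δ of a syzygy sequence
(`exists_resolution_syzygy`): there the sign of a rotated triangle cancels the sign of dimension
two.

Finally, the pairing of Ext¹(X, Y) with Ext²(Y, X) is the perfect pairing of 𝒮(X, SY) with 𝒮(SY,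
S³X), pulled back along the surjection Ext¹(X, Y) → 𝒮(X, SY). Its kernel in Ext¹ is the kernel of
this surjection, which consists of the classes that extend to I because Ext²(I/X, Y) embeds into 𝒮.
-/

namespace ClusterTilting

/-! ### Distinguished triangles given by their three morphisms -/

section Triangles

variable {D : Type u} [Category.{v} D] [HasZeroObject D] [HasShift D ℤ] [Preadditive D]
  [∀ n : ℤ, (shiftFunctor D n).Additive] [Pretriangulated D]
  {X Y Z : D} {a : X ⟶ Y} {b : Y ⟶ Z} {c : Z ⟶ X⟦(1 : ℤ)⟧}

/-- The candidate triangle `X ⟶ Y ⟶ Z ⟶ X⟦1⟧` is distinguished. -/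
def IsDist (a : X ⟶ Y) (b : Y ⟶ Z) (c : Z ⟶ X⟦(1 : ℤ)⟧) : Prop :=
  Triangle.mk a b c ∈ distTriang D

namespace IsDist

lemma zero₁₂ (h : IsDist a b c) : a ≫ b = 0 := comp_distTriang_mor_zero₁₂ _ h

lemma zero₂₃ (h : IsDist a b c) : b ≫ c = 0 := comp_distTriang_mor_zero₂₃ _ h

lemma zero₃₁ (h : IsDist a b c) : c ≫ a⟦(1 : ℤ)⟧' = 0 := comp_distTriang_mor_zero₃₁ _ h

lemma lift₁ (h : IsDist a b c) {V : D} (f : V ⟶ Y) (hf : f ≫ b = 0) :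
    ∃ g : V ⟶ X, g ≫ a = f := by
  obtain ⟨g, hg⟩ := Triangle.coyoneda_exact₂ _ h f hf
  exact ⟨g, hg.symm⟩

lemma lift₂ (h : IsDist a b c) {V : D} (f : V ⟶ Z) (hf : f ≫ c = 0) :
    ∃ g : V ⟶ Y, g ≫ b = f := by
  obtain ⟨g, hg⟩ := Triangle.coyoneda_exact₃ _ h f hf
  exact ⟨g, hg.symm⟩

lemma lift₃ (h : IsDist a b c) {V : D} (f : V ⟶ X⟦(1 : ℤ)⟧) (hf : f ≫ a⟦(1 : ℤ)⟧' = 0) :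
    ∃ g : V ⟶ Z, g ≫ c = f := by
  obtain ⟨g, hg⟩ := Triangle.coyoneda_exact₁ _ h f hf
  exact ⟨g, hg.symm⟩

lemma desc₃ (h : IsDist a b c) {V : D} (f : Y ⟶ V) (hf : a ≫ f = 0) :
    ∃ g : Z ⟶ V, b ≫ g = f := by
  obtain ⟨g, hg⟩ := Triangle.yoneda_exact₂ _ h f hf
  exact ⟨g, hg.symm⟩

lemma desc₁ (h : IsDist a b c) {V : D} (f : Z ⟶ V) (hf : b ≫ f = 0) :
    ∃ g : X⟦(1 : ℤ)⟧ ⟶ V, c ≫ g = f := by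
  obtain ⟨g, hg⟩ := Triangle.yoneda_exact₃ _ h f hf
  exact ⟨g, hg.symm⟩

lemma rotate (h : IsDist a b c) : IsDist b c (-a⟦(1 : ℤ)⟧') := rot_of_distTriang _ h

lemma of_rotate (h : IsDist b c (-a⟦(1 : ℤ)⟧')) : IsDist a b c :=
  (rotate_distinguished_triangle (Triangle.mk a b c)).2 h

variable {X' Y' Z' : D} {a' : X' ⟶ Y'} {b' : Y' ⟶ Z'} {c' : Z' ⟶ X'⟦(1 : ℤ)⟧}

lemma map₂ (h : IsDist a b c) (h' : IsDist a' b' c') (x : X ⟶ X') (z : Z ⟶ Z')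
    (hxz : c ≫ x⟦(1 : ℤ)⟧' = z ≫ c') : ∃ y : Y ⟶ Y', a ≫ y = x ≫ a' ∧ b ≫ z = y ≫ b' :=
  complete_distinguished_triangle_morphism₂ _ _ h h' x z hxz

lemma map₁ (h : IsDist a b c) (h' : IsDist a' b' c') (y : Y ⟶ Y') (z : Z ⟶ Z')
    (hyz : b ≫ z = y ≫ b') : ∃ x : X ⟶ X', a ≫ y = x ≫ a' ∧ c ≫ x⟦(1 : ℤ)⟧' = z ≫ c' :=
  complete_distinguished_triangle_morphism₁ _ _ h h' y z hyz

lemma exists₃ (a : X ⟶ Y) : ∃ (Z : D) (b : Y ⟶ Z) (c : Z ⟶ X⟦(1 : ℤ)⟧), IsDist a b c :=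
  distinguished_cocone_triangle a

lemma exists₁ (b : Y ⟶ Z) : ∃ (X : D) (a : X ⟶ Y) (c : Z ⟶ X⟦(1 : ℤ)⟧), IsDist a b c :=
  distinguished_cocone_triangle₁ b

lemma exists₂ (c : Z ⟶ X⟦(1 : ℤ)⟧) : ∃ (Y : D) (a : X ⟶ Y) (b : Y ⟶ Z), IsDist a b c :=
  distinguished_cocone_triangle₂ c

end IsDist

end Triangles

/-! ### Morphisms in a Verdier quotient by a subcategory without positive self-extensions -/

section VerdierQuotient

variable {D : Type u} [Category.{v} D] [HasZeroObject D] [HasShift D ℤ] [Preadditive D]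
  [∀ n : ℤ, (shiftFunctor D n).Additive] [Pretriangulated D]

/-- The objects obtained from the shifts `X⟦m⟧` with `m ≥ n` of objects `X` satisfying `P` by
finitely many extensions. -/
inductive ShiftedExtension (P : ObjectProperty D) (n : ℤ) : D → Prop
  | zero {Z : D} (hZ : IsZero Z) : ShiftedExtension P n Z
  | iso {X Y : D} (e : X ≅ Y) (hX : ShiftedExtension P n X) : ShiftedExtension P n Y
  | shift {X : D} (hX : P X) (m : ℤ) (hm : n ≤ m) : ShiftedExtension P n (X⟦m⟧)
  | ext (A : Triangle D) (hA : A ∈ distTriang D) (h₁ : ShiftedExtension P n A.obj₁)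
      (h₃ : ShiftedExtension P n A.obj₃) : ShiftedExtension P n A.obj₂

variable {P : ObjectProperty D}

lemma ShiftedExtension.mem_triangulatedHull {n : ℤ} {X : D} (h : ShiftedExtension P n X) :
    triangulatedHull P X := by
  induction h with
  | zero hZ =>
    exact ObjectProperty.prop_of_iso (triangulatedHull P) hZ.isoZero.symm
      (ObjectProperty.prop_zero _)
  | iso e _ h => exact ObjectProperty.prop_of_iso _ e h
  | shift hX m hm =>
    exact ObjectProperty.le_shift (triangulatedHull P) m _ (fun Q _ _ hP => hP _ hX)
  | ext A hA _ _ h₁ h₃ => exact ObjectProperty.ext_of_isTriangulatedClosed₂ _ A hA h₁ h₃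

lemma ShiftedExtension.shift' {n : ℤ} {X : D} (h : ShiftedExtension P n X) (a : ℤ) (n' : ℤ)
    (hn' : n + a = n') : ShiftedExtension P n' (X⟦a⟧) := by
  induction h with
  | zero hZ => exact .zero ((shiftFunctor D a).map_isZero hZ)
  | iso e _ h => exact .iso ((shiftFunctor D a).mapIso e) h
  | shift hX m hm =>
    exact .iso ((shiftFunctorAdd' D m a (m + a) rfl).app _) (.shift hX _ (by lia))
  | ext A hA _ _ h₁ h₃ => exact .ext _ (Triangle.shift_distinguished _ hA a) h₁ h₃

lemma ShiftedExtension.hom_eq_zero {n : ℤ} {X : D} (h : ShiftedExtension P n X) (Z : D)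
    (hZ : ∀ (Y : D) (_ : P Y) (m : ℤ) (_ : n ≤ m) (f : Z ⟶ Y⟦m⟧), f = 0) (f : Z ⟶ X) : f = 0 := by
  induction h with
  | zero hX => exact hX.eq_of_tgt _ _
  | iso e _ h => rw [← cancel_mono e.inv, h (f ≫ e.inv), zero_comp]
  | shift hX m hm => exact hZ _ hX m hm f
  | ext A hA _ _ h₁ h₃ =>
    obtain ⟨g, rfl⟩ := Triangle.coyoneda_exact₂ _ hA f (h₃ _)
    rw [h₁ g, zero_comp]

/-- The object `b` is built from shifts X⟦m⟧. The pieces with m ≤ n do not map to `W`, and by `hP`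
they do not map to pieces of higher shift either, so only the pieces with m > n matter. The formal
argument shows that the objects `b` with this property form a triangulated subcategory containing
`P`. -/
lemma exists_factorization_of_triangulatedHull
    (hP : ∀ ⦃X Y : D⦄ (_ : P X) (_ : P Y) (m m' : ℤ) (_ : m < m') (f : X⟦m⟧ ⟶ Y⟦m'⟧), f = 0)
    {b : D} (hb : triangulatedHull P b) (n : ℤ) {W : D}
    (hW : ∀ (X : D) (_ : P X) (m : ℤ) (_ : m ≤ n) (f : X⟦m⟧ ⟶ W), f = 0) (f : b ⟶ W) :
    ∃ (b' : D) (_ : ShiftedExtension P (n + 1) b') (x : b ⟶ b') (y : b' ⟶ W), x ≫ y = f := by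
  -- Both `n` and `W` are quantified inside `Q`: shifting changes both, and the extension step
  -- replaces `W` by a cone.
  let Q : ObjectProperty D := fun b => ∀ (n : ℤ) {W : D}
    (_ : ∀ (X : D) (_ : P X) (m : ℤ) (_ : m ≤ n) (f : X⟦m⟧ ⟶ W), f = 0) (f : b ⟶ W),
    ∃ (b' : D) (_ : ShiftedExtension P (n + 1) b') (x : b ⟶ b') (y : b' ⟶ W), x ≫ y = f
  have hQ : Q.IsClosedUnderIsomorphisms := ⟨fun e hX n W hW f => by
    obtain ⟨b', h, x, y, hxy⟩ := hX n hW (e.hom ≫ f)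
    exact ⟨b', h, e.inv ≫ x, y, by simp [hxy]⟩⟩
  have hQ₂ : Q.IsTriangulatedClosed₂ := .mk' fun A hA h₁ h₃ n W hW f => by
    obtain ⟨b₁, hb₁, x₁, y₁, hxy₁⟩ := h₁ n hW (A.mor₁ ≫ f)
    obtain ⟨W', i, δ, hW'⟩ := IsDist.exists₃ y₁
    -- The cone `W'` inherits the vanishing from `W`, because `b₁⟦1⟧` is built from shifts ≥ n + 2
    -- and receives no map from X⟦m⟧ with m ≤ n.
    have hvan (X : D) (hX : P X) (m : ℤ) (hm : m ≤ n) (g : X⟦m⟧ ⟶ W') : g = 0 := by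
      have h0 : g ≫ δ = 0 := (hb₁.shift' 1 (n + 2) (by ring)).hom_eq_zero _
        (fun Y hY m' hm' f' => hP hX hY m m' (by lia) f') _
      obtain ⟨g', rfl⟩ := hW'.lift₂ g h0
      rw [hW X hX m hm g', zero_comp]
    obtain ⟨f₃, hf₃⟩ := IsDist.desc₃ hA (f ≫ i) (by
      rw [← Category.assoc, ← hxy₁, Category.assoc, hW'.zero₁₂, comp_zero])
    obtain ⟨b₃, hb₃, x₃, y₃, hxy₃⟩ := h₃ n hvan f₃
    obtain ⟨b', j, p, hb'⟩ := IsDist.exists₂ (y₃ ≫ δ)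
    obtain ⟨l, hl, hl'⟩ := hb'.map₂ hW' (𝟙 _) y₃ (by simp)
    rw [Category.id_comp] at hl
    obtain ⟨x, hx⟩ := hb'.lift₂ (A.mor₂ ≫ x₃) (by
        rw [Category.assoc, reassoc_of% hxy₃, ← Category.assoc, hf₃, Category.assoc, hW'.zero₂₃,
          comp_zero])
    -- The composite `x ≫ l` agrees with `f` only after mapping to `W'`; the error comes from `b₁`
    -- and is absorbed into `x` through `j`.
    obtain ⟨z, hz⟩ := hW'.lift₁ (f - x ≫ l) (by
        rw [Preadditive.sub_comp, Category.assoc, ← hl', ← Category.assoc x, hx, Category.assoc,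
          hxy₃, hf₃, sub_self])
    refine ⟨b', .ext _ hb' hb₁ hb₃, x + z ≫ j, l, ?_⟩
    rw [Preadditive.add_comp, Category.assoc, hl, hz, add_sub_cancel]
  have : Q.IsTriangulated :=
    { exists_zero := ⟨0, isZero_zero D, fun n W _ f =>
        ⟨0, .zero (isZero_zero D), 0, 0, (isZero_zero D).eq_of_src _ _⟩⟩
      isStableUnderShiftBy := fun a => ⟨fun b hb n W hW f => by
        obtain ⟨b', hb', x, y, hxy⟩ := hb (n - a) (W := W⟦-a⟧) (fun X hX m hm g => by
            apply (shiftFunctor D a).map_injective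
            have := hW X hX (m + a) (by lia) ((shiftFunctorAdd' D m a (m + a) rfl).hom.app X ≫
              g⟦a⟧' ≫ (shiftFunctorCompIsoId D (-a) a (by simp)).hom.app W)
            rw [← cancel_mono ((shiftFunctorCompIsoId D (-a) a (by simp)).hom.app W),
              ← cancel_epi ((shiftFunctorAdd' D m a (m + a) rfl).hom.app X), this]
            simp)
          ((shiftFunctorCompIsoId D a (-a) (by simp)).inv.app b ≫ f⟦-a⟧')
        refine ⟨b'⟦a⟧, hb'.shift' a _ (by ring), x⟦a⟧',
          y⟦a⟧' ≫ (shiftFunctorCompIsoId D (-a) a (by simp)).hom.app W, ?_⟩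
        rw [← Category.assoc, ← Functor.map_comp, hxy, Functor.map_comp, Category.assoc]
        have := (shiftFunctorCompIsoId D (-a) a (by simp)).hom.naturality f
        dsimp at this
        rw [this, ← Category.assoc, shift_shiftFunctorCompIsoId_inv_app]
        simp⟩ }
  refine hb Q this hQ (fun X hX n W hW f => ?_) n hW f
  by_cases hn : 0 ≤ n
  · refine ⟨0, .zero (isZero_zero D), 0, 0, ?_⟩
    rw [← cancel_epi ((shiftFunctorZero D ℤ).hom.app X),
      hW X hX 0 hn ((shiftFunctorZero D ℤ).hom.app X ≫ f)]
    simp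
  · exact ⟨X, .iso ((shiftFunctorZero D ℤ).app X) (.shift hX 0 (by lia)), 𝟙 _, f, by simp⟩

/-- The connecting morphism from the cone of `s` to `W⟦1⟧` factors through an object with shifts > n
only. Completing the second factor to a triangle gives a denominator that refines `s`. -/
lemma exists_triangle_of_trW_triangulatedHull
    (hP : ∀ ⦃X Y : D⦄ (_ : P X) (_ : P Y) (m m' : ℤ) (_ : m < m') (f : X⟦m⟧ ⟶ Y⟦m'⟧), f = 0)
    (n : ℤ) {W Z : D}
    (hW : ∀ (X : D) (_ : P X) (m : ℤ) (_ : m ≤ n) (f : X⟦m⟧ ⟶ W⟦(1 : ℤ)⟧), f = 0)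
    (s : W ⟶ Z) (hs : (triangulatedHull P).trW s) :
    ∃ (Z' b : D) (x : Z ⟶ Z') (p : Z' ⟶ b) (δ : b ⟶ W⟦(1 : ℤ)⟧), ShiftedExtension P (n + 1) b ∧
      IsDist (s ≫ x) p δ := by
  obtain ⟨c, i, δ, hT, hc⟩ := hs
  obtain ⟨b, hb, u', v', huv⟩ := exists_factorization_of_triangulatedHull hP hc n hW δ
  obtain ⟨Z', s', p, hT'⟩ := IsDist.exists₂ v'
  obtain ⟨x, hx, -⟩ := IsDist.map₂ hT hT' (𝟙 _) u' (by simp [huv])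
  rw [Category.id_comp] at hx
  subst hx
  exact ⟨Z', b, x, p, v', hb, hT'⟩

variable [IsTriangulated D]

/-- Every left fraction V → Z ← W can be refined so that the cone of its denominator is built from
shifts ≥ n + 1. Then `V` has no maps to this cone, and the numerator lifts to `W`. -/
lemma map_trW_surjective
    (hP : ∀ ⦃X Y : D⦄ (_ : P X) (_ : P Y) (m m' : ℤ) (_ : m < m') (f : X⟦m⟧ ⟶ Y⟦m'⟧), f = 0)
    (n : ℤ) {V W : D}
    (hW : ∀ (X : D) (_ : P X) (m : ℤ) (_ : m ≤ n) (f : X⟦m⟧ ⟶ W⟦(1 : ℤ)⟧), f = 0)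
    (hV : ∀ (Y : D) (_ : P Y) (m : ℤ) (_ : n + 1 ≤ m) (f : V ⟶ Y⟦m⟧), f = 0) :
    Function.Surjective ((triangulatedHull P).trW.Q.map : (V ⟶ W) → _) := by
  intro φ
  obtain ⟨⟨f, s, hs⟩, rfl⟩ := Localization.exists_leftFraction _ (triangulatedHull P).trW φ
  obtain ⟨Z', b, x, p, δ, hb, hT⟩ := exists_triangle_of_trW_triangulatedHull hP n hW s hs
  obtain ⟨g, hg⟩ := hT.lift₁ (f ≫ x) (hb.hom_eq_zero _ hV _)
  refine ⟨g, ?_⟩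
  have h₁ : IsIso ((triangulatedHull P).trW.Q.map s) := Localization.inverts _ _ _ hs
  have h₂ : IsIso ((triangulatedHull P).trW.Q.map (s ≫ x)) :=
    Localization.inverts _ (triangulatedHull P).trW _ ⟨_, _, _, hT, hb.mem_triangulatedHull⟩
  have h₃ : IsIso ((triangulatedHull P).trW.Q.map x) := by
    rw [Functor.map_comp] at h₂
    exact IsIso.of_isIso_comp_left ((triangulatedHull P).trW.Q.map s) _
  rw [← cancel_mono ((triangulatedHull P).trW.Q.map s),
    ← cancel_mono ((triangulatedHull P).trW.Q.map x), MorphismProperty.LeftFraction.map_comp_map_s,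
    ← Functor.map_comp, ← Functor.map_comp, ← Functor.map_comp, Category.assoc, hg]

/-- A morphism killed by a denominator factors, after one suspension, through a cone built from
shifts ≥ n + 1. Undoing the suspension lowers the bound to m ≥ n, one less than for surjectivity. -/
lemma map_trW_injective
    (hP : ∀ ⦃X Y : D⦄ (_ : P X) (_ : P Y) (m m' : ℤ) (_ : m < m') (f : X⟦m⟧ ⟶ Y⟦m'⟧), f = 0)
    (n : ℤ) {V W : D}
    (hW : ∀ (X : D) (_ : P X) (m : ℤ) (_ : m ≤ n) (f : X⟦m⟧ ⟶ W⟦(1 : ℤ)⟧), f = 0)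
    (hV : ∀ (Y : D) (_ : P Y) (m : ℤ) (_ : n ≤ m) (f : V ⟶ Y⟦m⟧), f = 0) (f : V ⟶ W)
    (hf : (triangulatedHull P).trW.Q.map f = 0) : f = 0 := by
  rw [← Functor.map_zero, MorphismProperty.map_eq_iff_postcomp _ (triangulatedHull P).trW] at hf
  obtain ⟨Z, s, hs, h⟩ := hf
  obtain ⟨Z', b, x, p, δ, hb, hT⟩ := exists_triangle_of_trW_triangulatedHull hP n hW s hs
  rw [zero_comp] at h
  have h₀ : f⟦(1 : ℤ)⟧' ≫ (s ≫ x)⟦(1 : ℤ)⟧' = 0 := by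
    rw [← Functor.map_comp, reassoc_of% h, zero_comp, Functor.map_zero]
  obtain ⟨g, hg⟩ := hT.lift₃ _ h₀
  apply (shiftFunctor D (1 : ℤ)).map_injective
  rw [← hg, hb.hom_eq_zero _ (fun Y hY m hm f' => ?_) g, zero_comp, Functor.map_zero]
  obtain ⟨f'', hf''⟩ := (shiftFunctor D (1 : ℤ)).map_surjective
    (f' ≫ (shiftFunctorAdd' D (m - 1) 1 m (by ring)).hom.app Y)
  rw [← cancel_mono ((shiftFunctorAdd' D (m - 1) 1 m (by ring)).hom.app Y), ← hf'',
    hV Y hY (m - 1) (by lia) f'', Functor.map_zero, zero_comp]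

lemma isZero_trW_Q_obj (P : ObjectProperty D) [P.IsTriangulated] {X : D} (hX : P X) :
    IsZero (P.trW.Q.obj X) := by
  have h : P.trW (0 : X ⟶ 0) := by
    rw [ObjectProperty.trW_iff']
    exact ⟨X, 𝟙 X, 0, contractible_distinguished X, hX⟩
  have := Localization.inverts P.trW.Q _ _ h
  exact (P.trW.Q.map_isZero (isZero_zero D)).of_iso (asIso (P.trW.Q.map (0 : X ⟶ 0)))

end VerdierQuotient

/-! ### Comparison of Ext groups with morphisms of the stable category -/

section StableHoms

variable {A : Type u} [Category.{v} A] [Abelian A] [HasDerivedCategory.{w} A]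

open Abelian

lemma map_boundedι_injective {U V : DerivedCategory.Bounded A} {n : ℤ} (f g : ShiftedHom U V n)
    (h : f.map DerivedCategory.Bounded.ι = g.map DerivedCategory.Bounded.ι) : f = g := by
  apply DerivedCategory.Bounded.ι.map_injective
  exact (cancel_mono _).1 h

variable {X Y Z : A}

lemma stalk_hom_eq_zero_of_neg (n : ℤ) (hn : n < 0)
    (f : (stalk A).obj X ⟶ ((stalk A).obj Y)⟦n⟧) : f = 0 := by
  apply map_boundedι_injective (n := n)
  rw [ShiftedHom.map_zero]
  have : DerivedCategory.IsGE (((DerivedCategory.singleFunctor A 0).obj Y)⟦n⟧) (-n) :=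
    DerivedCategory.TStructure.t.isGE_shift _ 0 _ _ (by lia)
  exact DerivedCategory.TStructure.t.zero (X := (DerivedCategory.singleFunctor A 0).obj X)
    (Y := ((DerivedCategory.singleFunctor A 0).obj Y)⟦n⟧) _ 0 (-n) (by lia)

variable [HasExt.{w₁} A]

/-- The morphism `X ⟶ Y⟦n⟧` in the bounded derived category given by an extension. -/
noncomputable def extToBounded {n : ℕ} (e : Ext X Y n) :
    ShiftedHom ((stalk A).obj X) ((stalk A).obj Y) (n : ℤ) :=
  ObjectProperty.homMk
    (e.hom ≫ (DerivedCategory.Bounded.ι.commShiftIso (n : ℤ)).inv.app ((stalk A).obj Y))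

lemma extToStableCM_eq {n : ℕ} (e : Ext X Y n) :
    extToStableCM e = (extToBounded e).map (finiteDerived A).trW.Q := rfl

lemma extToBounded_map {n : ℕ} (e : Ext X Y n) :
    (extToBounded e).map DerivedCategory.Bounded.ι = e.hom := by
  refine (Category.assoc _ _ _).trans ?_
  refine (congrArg (e.hom ≫ ·) (Iso.inv_hom_id_app
    (DerivedCategory.Bounded.ι.commShiftIso (n : ℤ)) ((stalk A).obj Y))).trans ?_
  exact Category.comp_id _

lemma extToBounded_bijective (X Y : A) (n : ℕ) :
    Function.Bijective (extToBounded : Ext X Y n → _) := by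
  constructor
  · intro e e' h
    ext
    rw [← extToBounded_map, h, extToBounded_map]
  · intro f
    refine ⟨Ext.homEquiv.symm (f.map DerivedCategory.Bounded.ι), map_boundedι_injective _ _ ?_⟩
    rw [extToBounded_map]
    exact Ext.homEquiv.apply_symm_apply _

lemma extToBounded_comp {a b c : ℕ} (e : Ext X Y a) (f : Ext Y Z b) (h : a + b = c) :
    extToBounded (e.comp f h) = (extToBounded e).comp (extToBounded f) (by lia) := by
  apply map_boundedι_injective
  rw [extToBounded_map, ShiftedHom.map_comp, extToBounded_map, extToBounded_map, Ext.comp_hom]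
  rfl

lemma extToBounded_mk₀ (f : X ⟶ Y) :
    extToBounded (Ext.mk₀ f) = ShiftedHom.mk₀ _ (by simp) ((stalk A).map f) := by
  apply map_boundedι_injective
  rw [extToBounded_map, ShiftedHom.map_mk₀, Ext.mk₀_hom]
  rfl

lemma extToBounded_add {n : ℕ} (e f : Ext X Y n) :
    extToBounded (e + f) = extToBounded e + extToBounded f := by
  apply map_boundedι_injective
  rw [ShiftedHom.map_add, extToBounded_map, extToBounded_map, extToBounded_map, Ext.add_hom]
  rfl

lemma stalk_hom_eq_zero (n : ℤ) (hY : ∀ (m : ℕ) (_ : (m : ℤ) = n) (e : Ext X Y m), e = 0)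
    (f : (stalk A).obj X ⟶ ((stalk A).obj Y)⟦n⟧) : f = 0 := by
  by_cases hn : n < 0
  · exact stalk_hom_eq_zero_of_neg n hn f
  · obtain ⟨m, rfl⟩ := Int.eq_ofNat_of_zero_le (not_lt.1 hn)
    obtain ⟨e, he⟩ := (extToBounded_bijective X Y m).2 f
    obtain ⟨e', he'⟩ := (extToBounded_bijective X Y m).2 0
    rw [← he, ← he', hY m rfl e, hY m rfl e']

lemma stalk_shift_hom_eq_zero (p q : ℤ)
    (hY : ∀ (m : ℕ) (_ : p + m = q) (e : Ext X Y m), e = 0)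
    (f : ((stalk A).obj X)⟦p⟧ ⟶ ((stalk A).obj Y)⟦q⟧) : f = 0 := by
  obtain ⟨g, hg⟩ := (shiftFunctor _ p).map_surjective
    (f ≫ (shiftFunctorAdd' _ (q - p) p q (by ring)).hom.app ((stalk A).obj Y))
  rw [← cancel_mono ((shiftFunctorAdd' _ (q - p) p q (by ring)).hom.app ((stalk A).obj Y)), ← hg,
    stalk_hom_eq_zero (q - p) (fun m hm e => hY m (by lia) e) g, Functor.map_zero, zero_comp]

lemma stalk_projective_shift_hom_eq_zero [Projective X] (p q : ℤ) (hpq : p ≠ q)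
    (f : ((stalk A).obj X)⟦p⟧ ⟶ ((stalk A).obj Y)⟦q⟧) : f = 0 := by
  refine stalk_shift_hom_eq_zero p q (fun m hm e => ?_) f
  obtain _ | m := m
  · simp at hm; contradiction
  · exact e.eq_zero_of_projective

variable (A) in
/-- The stalks of the projective objects. -/
def projectiveStalk : ObjectProperty (DerivedCategory.Bounded A) :=
  fun U => ∃ P : A, Projective P ∧ Nonempty (U ≅ (stalk A).obj P)

lemma projectiveStalk_hom_eq_zero ⦃U V : DerivedCategory.Bounded A⦄ (hU : projectiveStalk A U)
    (hV : projectiveStalk A V) (m m' : ℤ) (h : m < m') (f : U⟦m⟧ ⟶ V⟦m'⟧) : f = 0 := by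
  obtain ⟨P, hP, ⟨i⟩⟩ := hU
  obtain ⟨P', hP', ⟨i'⟩⟩ := hV
  rw [← cancel_epi (i.inv⟦m⟧'), ← cancel_mono (i'.hom⟦m'⟧'), comp_zero, zero_comp]
  exact stalk_projective_shift_hom_eq_zero m m' h.ne _

lemma projectiveStalk_hom_stalk_eq_zero (n : ℤ) (U : DerivedCategory.Bounded A)
    (hU : projectiveStalk A U) (m : ℤ) (hm : m ≤ n)
    (f : U⟦m⟧ ⟶ (((stalk A).obj Y)⟦n⟧)⟦(1 : ℤ)⟧) : f = 0 := by
  obtain ⟨P, hP, ⟨i⟩⟩ := hU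
  rw [← cancel_epi (i.inv⟦m⟧'), comp_zero,
    ← cancel_mono ((shiftFunctorAdd' _ n 1 (n + 1) rfl).inv.app ((stalk A).obj Y)), zero_comp]
  exact stalk_projective_shift_hom_eq_zero m (n + 1) (by lia) _

lemma stalk_hom_projectiveStalk_eq_zero (n : ℕ)
    (hX : ∀ (P : A) [Projective P] (m : ℕ) (_ : n ≤ m) (e : Ext X P m), e = 0)
    (U : DerivedCategory.Bounded A) (hU : projectiveStalk A U) (m : ℤ) (hm : (n : ℤ) ≤ m)
    (f : (stalk A).obj X ⟶ U⟦m⟧) : f = 0 := by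
  obtain ⟨P, hP, ⟨i⟩⟩ := hU
  rw [← cancel_mono (i.hom⟦m⟧'), zero_comp]
  exact stalk_hom_eq_zero m (fun m' hm' e => hX P m' (by lia) e) _

/-- Nothing is asked of `Y`: a projective placed in shift m ≤ n has no maps to Y⟦n + 1⟧. Only the
extensions of `X` by projectives can obstruct. -/
lemma extToStableCM_surjective (X Y : A) (n : ℕ)
    (hX : ∀ (P : A) [Projective P] (m : ℕ) (_ : n + 1 ≤ m) (e : Ext X P m), e = 0) :
    Function.Surjective (extToStableCM : Ext X Y n → _) := by
  intro f
  obtain ⟨g, hg⟩ := map_trW_surjective (P := projectiveStalk A) projectiveStalk_hom_eq_zero n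
    (V := (stalk A).obj X) (W := ((stalk A).obj Y)⟦(n : ℤ)⟧)
    (projectiveStalk_hom_stalk_eq_zero n)
    (fun U hU m hm f =>
      stalk_hom_projectiveStalk_eq_zero (n + 1) hX U hU m (by push_cast; exact hm) f)
    (f ≫ ((finiteDerived A).trW.Q.commShiftIso (n : ℤ)).inv.app _)
  obtain ⟨e, rfl⟩ := (extToBounded_bijective X Y n).2 g
  refine ⟨e, ?_⟩
  rw [extToStableCM_eq]
  refine (cancel_mono (((finiteDerived A).trW.Q.commShiftIso (n : ℤ)).inv.app _)).1 (Eq.trans ?_ hg)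
  rw [ShiftedHom.map, Category.assoc, Iso.hom_inv_id_app]
  exact Category.comp_id _

lemma extToStableCM_add {n : ℕ} (e f : Ext X Y n) :
    extToStableCM (e + f) = extToStableCM e + extToStableCM f := by
  rw [extToStableCM_eq, extToBounded_add]
  exact ShiftedHom.map_add _ _ _

variable (X Y) in
/-- `extToStableCM` as an additive map. -/
noncomputable def extToStableCMAddHom (n : ℕ) :
    Ext X Y n →+ ShiftedHom (toStableCM X) (toStableCM Y) (n : ℤ) :=
  AddMonoidHom.mk' extToStableCM extToStableCM_add

lemma extToStableCM_zero {n : ℕ} : extToStableCM (0 : Ext X Y n) = 0 :=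
  (extToStableCMAddHom X Y n).map_zero

lemma extToStableCM_injective (X Y : A) (n : ℕ)
    (hX : ∀ (P : A) [Projective P] (m : ℕ) (_ : n ≤ m) (e : Ext X P m), e = 0) :
    Function.Injective (extToStableCM : Ext X Y n → _) := by
  refine (injective_iff_map_eq_zero (extToStableCMAddHom X Y n)).2 fun e he => ?_
  have h := map_trW_injective (P := projectiveStalk A) projectiveStalk_hom_eq_zero n
    (V := (stalk A).obj X) (W := ((stalk A).obj Y)⟦(n : ℤ)⟧)
    (projectiveStalk_hom_stalk_eq_zero n)
    (fun U hU m hm f => stalk_hom_projectiveStalk_eq_zero n hX U hU m hm f) (extToBounded e)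
    (by
      refine (cancel_mono (((finiteDerived A).trW.Q.commShiftIso (n : ℤ)).hom.app _)).1 ?_
      exact he.trans zero_comp.symm)
  apply (extToBounded_bijective X Y n).1
  rw [h]
  exact ((AddMonoidHom.mk' (extToBounded (X := X) (Y := Y) (n := n)) extToBounded_add).map_zero).symm

lemma extToStableCM_comp {a b c : ℕ} (e : Ext X Y a) (f : Ext Y Z b) (h : a + b = c) :
    extToStableCM (e.comp f h) = (extToStableCM e).comp (extToStableCM f) (by lia) := by
  rw [extToStableCM_eq, extToBounded_comp, ShiftedHom.map_comp]
  rfl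

variable (A) in
/-- The functor from `A` to its stable Cohen-Macaulay category. -/
noncomputable abbrev toStableCMFunctor : A ⥤ StableCM A := stalk A ⋙ (finiteDerived A).trW.Q

lemma extToStableCM_mk₀ (f : X ⟶ Y) :
    extToStableCM (Ext.mk₀ f) = ShiftedHom.mk₀ _ (by simp) ((toStableCMFunctor A).map f) := by
  rw [extToStableCM_eq, extToBounded_mk₀, ShiftedHom.map_mk₀]
  rfl

end StableHoms

/-! ### Gorenstein dimension one: objects of the stable category -/

section StableObjects

open Abelian

variable {A : Type u} [Category.{v} A] [Abelian A]

lemma shortExact_kernel {X Y : A} (f : X ⟶ Y) [Epi f] :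
    (ShortComplex.mk (kernel.ι f) f (kernel.condition f)).ShortExact :=
  { exact := ShortComplex.exact_of_f_is_kernel _ (kernelIsKernel f) }

lemma shortExact_cokernel {X Y : A} (f : X ⟶ Y) [Mono f] :
    (ShortComplex.mk f (cokernel.π f) (cokernel.condition f)).ShortExact :=
  { exact := ShortComplex.exact_of_g_is_cokernel _ (cokernelIsCokernel f) }

variable [HasDerivedCategory.{w} A]

lemma isZero_toStableCM (P : A) [Projective P] : IsZero (toStableCM P) :=
  isZero_trW_Q_obj _ (fun _ _ _ h => h _ ⟨P, inferInstance, ⟨Iso.refl _⟩⟩)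

variable [HasExt.{w₁} A]

lemma isDist_stalk {S : ShortComplex A} (hS : S.ShortExact) :
    IsDist ((stalk A).map S.f) ((stalk A).map S.g) (extToBounded hS.extClass) := by
  change DerivedCategory.Bounded.ι.mapTriangle.obj _ ∈ distTriang _
  refine isomorphic_distinguished _ hS.singleTriangle_distinguished _
    (Triangle.isoMk _ _ (Iso.refl _) (Iso.refl _) (Iso.refl _) ?_ ?_ ?_)
  · exact (Category.comp_id _).trans (Category.id_comp _).symm
  · exact (Category.comp_id _).trans (Category.id_comp _).symm
  · have h := extToBounded_map hS.extClass
    rw [ShortComplex.ShortExact.extClass_hom] at h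
    refine Eq.trans ?_ (h.trans (Category.id_comp _).symm)
    refine (congrArg (_ ≫ ·) ((shiftFunctor _ (1 : ℤ)).map_id _)).trans (Category.comp_id _)

lemma isDist_toStableCM {S : ShortComplex A} (hS : S.ShortExact) :
    IsDist ((toStableCMFunctor A).map S.f) ((toStableCMFunctor A).map S.g)
      (extToStableCM hS.extClass) :=
  (finiteDerived A).trW.Q.map_distinguished _ (isDist_stalk hS)

lemma isIso_of_isDist₂ {D : Type*} [Category* D] [HasZeroObject D] [HasShift D ℤ] [Preadditive D]
    [∀ n : ℤ, (shiftFunctor D n).Additive] [Pretriangulated D]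
    {X Y Z : D} {a : X ⟶ Y} {b : Y ⟶ Z} {c : Z ⟶ X⟦(1 : ℤ)⟧} (h : IsDist a b c)
    (hY : IsZero Y) : IsIso c :=
  (Triangle.isZero₂_iff_isIso₃ _ h).1 hY

lemma isIso_of_isDist₁ {D : Type*} [Category* D] [HasZeroObject D] [HasShift D ℤ] [Preadditive D]
    [∀ n : ℤ, (shiftFunctor D n).Additive] [Pretriangulated D]
    {X Y Z : D} {a : X ⟶ Y} {b : Y ⟶ Z} {c : Z ⟶ X⟦(1 : ℤ)⟧} (h : IsDist a b c)
    (hX : IsZero X) : IsIso b :=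
  (Triangle.isZero₁_iff_isIso₂ _ h).1 hX

lemma isIso_extClass_toStableCM {S : ShortComplex A} (hS : S.ShortExact) [Projective S.X₂] :
    IsIso (C := StableCM A) (X := toStableCM S.X₃) (Y := (toStableCM S.X₁)⟦(1 : ℤ)⟧)
      (extToStableCM hS.extClass) :=
  isIso_of_isDist₂ (isDist_toStableCM hS) (isZero_toStableCM _)

lemma isIso_toStableCM_map_g {S : ShortComplex A} (hS : S.ShortExact) [Projective S.X₁] :
    IsIso ((toStableCMFunctor A).map S.g) :=
  isIso_of_isDist₁ (isDist_toStableCM hS) (isZero_toStableCM _)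

variable (A) in
/-- Every projective object has injective dimension at most one, and every object embeds
into an object of projective dimension at most one. -/
class IsGorensteinOne : Prop where
  ext_projective_eq_zero (X P : A) [Projective P] (e : Ext X P 2) : e = 0
  exists_mono (X : A) : ∃ (S : ShortComplex A) (_ : S.ShortExact) (_ : Projective S.X₁)
    (_ : Projective S.X₂) (j : X ⟶ S.X₃), Mono j

variable (A) in
/-- The objects that embed into a projective object. -/
def IsTorsionless : ObjectProperty A := fun X => ∃ (P : A) (_ : Projective P) (i : X ⟶ P), Mono i

variable [EnoughProjectives A]

variable (A) in
/-- The objects of the stable Cohen-Macaulay category isomorphic to objects of `A`. -/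
def isStableObject : ObjectProperty (StableCM A) := fun U => ∃ X : A, Nonempty (U ≅ toStableCM X)

instance : (isStableObject A).IsClosedUnderIsomorphisms where
  of_iso e := by
    rintro ⟨X, ⟨i⟩⟩
    exact ⟨X, ⟨e.symm ≪≫ i⟩⟩

lemma isStableObject_shift_neg_one {U : StableCM A} (hU : isStableObject A U) :
    isStableObject A (U⟦(-1 : ℤ)⟧) := by
  obtain ⟨X, ⟨e⟩⟩ := hU
  have hS := shortExact_kernel (Projective.π X)
  have := isIso_extClass_toStableCM hS
  exact ⟨kernel (Projective.π X), ⟨(shiftFunctor _ (-1 : ℤ)).mapIso (e ≪≫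
    asIso (C := StableCM A) (X := toStableCM X)
      (Y := (toStableCM (kernel (Projective.π X)))⟦(1 : ℤ)⟧)
      (extToStableCM hS.extClass)) ≪≫ (shiftFunctorCompIsoId _ (1 : ℤ) (-1) (by simp)).app _⟩⟩

variable [IsGorensteinOne A]

lemma ext_projective_eq_zero (n : ℕ) (hn : 2 ≤ n) (X P : A) [Projective P] (e : Ext X P n) :
    e = 0 := by
  induction n, hn using Nat.le_induction generalizing X with
  | base => exact IsGorensteinOne.ext_projective_eq_zero X P e
  | succ n hn ih =>
    have hS := shortExact_kernel (Projective.π X)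
    obtain ⟨e', rfl⟩ := Ext.contravariant_sequence_exact₃ hS P e (Ext.eq_zero_of_projective _)
      (add_comm 1 n)
    rw [ih _ e', Ext.comp_zero]

/-- A torsionless object is a syzygy of the cokernel of its embedding, so its Extⁿ into projectives
is controlled by Extⁿ⁺¹ of that cokernel. -/
lemma ext_torsionless_projective_eq_zero (n : ℕ) (hn : 1 ≤ n) {X : A} (hX : IsTorsionless A X)
    (P : A) [Projective P] (e : Ext X P n) : e = 0 := by
  obtain ⟨P', _, i, _⟩ := hX
  have hS := shortExact_cokernel i
  obtain ⟨e', rfl⟩ := Ext.contravariant_sequence_exact₁ hS P e (add_comm 1 n)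
    (ext_projective_eq_zero _ (by lia) _ _ _)
  obtain ⟨m, rfl⟩ := Nat.exists_eq_add_of_le' hn
  rw [Ext.eq_zero_of_projective e', Ext.comp_zero]

lemma extToStableCM_bijective (X Y : A) (n : ℕ) (hn : 2 ≤ n) :
    Function.Bijective (extToStableCM : Ext X Y n → _) :=
  ⟨extToStableCM_injective X Y n fun P _ m _ e => ext_projective_eq_zero m (by lia) X P e,
    extToStableCM_surjective X Y n fun P _ m _ e => ext_projective_eq_zero m (by lia) X P e⟩

lemma extToStableCM_one_surjective (X Y : A) :
    Function.Surjective (extToStableCM : Ext X Y 1 → _) :=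
  extToStableCM_surjective X Y 1 fun P _ m _ e => ext_projective_eq_zero m (by lia) X P e

lemma toStableCM_map_surjective {X : A} (hX : IsTorsionless A X) (Y : A) :
    Function.Surjective ((toStableCMFunctor A).map : (X ⟶ Y) → _) := by
  intro f
  obtain ⟨e, he⟩ := extToStableCM_surjective X Y 0
    (fun P _ m hm e => ext_torsionless_projective_eq_zero m hm hX P e)
    (ShiftedHom.mk₀ _ (by simp) f)
  obtain ⟨g, rfl⟩ := (Ext.mk₀_bijective X Y).2 e
  rw [extToStableCM_mk₀] at he
  exact ⟨g, (ShiftedHom.homEquiv _ (by simp)).injective he⟩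

/-- Embed `X` into the cokernel of a monomorphism of projectives and pull back. The pullback lies in
a projective and maps onto `X` with projective kernel, which vanishes in the stable category. -/
lemma exists_torsionless_cover (X : A) :
    ∃ (L : A) (_ : IsTorsionless A L) (l : L ⟶ X), IsIso ((toStableCMFunctor A).map l) := by
  obtain ⟨S, hS, _, _, j, _⟩ := IsGorensteinOne.exists_mono X
  have := hS.epi_g
  have := hS.mono_f
  refine ⟨pullback S.g j, ⟨S.X₂, inferInstance, pullback.fst S.g j, inferInstance⟩,
    pullback.snd S.g j, ?_⟩
  obtain ⟨k, hk, hk'⟩ : ∃ k : S.X₁ ⟶ pullback S.g j, k ≫ pullback.fst S.g j = S.f ∧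
      k ≫ pullback.snd S.g j = 0 :=
    ⟨pullback.lift S.f 0 (by rw [S.zero, zero_comp]), pullback.lift_fst _ _ _,
      pullback.lift_snd _ _ _⟩
  have hT : (ShortComplex.mk k (pullback.snd S.g j) hk').ShortExact :=
    { exact := by
        rw [ShortComplex.exact_iff_exact_up_to_refinements]
        intro U (x : U ⟶ pullback S.g j) (hx : x ≫ pullback.snd S.g j = 0)
        obtain ⟨V, π, hπ, y, hy⟩ := hS.exact.exact_up_to_refinements (x ≫ pullback.fst S.g j) (by
          rw [Category.assoc, pullback.condition, reassoc_of% hx, zero_comp])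
        refine ⟨V, π, hπ, y, ?_⟩
        change π ≫ x = y ≫ k
        apply pullback.hom_ext
        · rw [Category.assoc, hy, Category.assoc, hk]
        · rw [Category.assoc, hx, Category.assoc, hk', comp_zero, comp_zero]
      mono_f := by
        have : Mono (k ≫ pullback.fst S.g j) := by rwa [hk]
        exact mono_of_mono _ (pullback.fst S.g j)
      epi_g := inferInstanceAs (Epi (pullback.snd S.g j)) }
  have : Projective (ShortComplex.mk k (pullback.snd S.g j) hk').X₁ := by assumption
  exact isIso_toStableCM_map_g hT

lemma isStableObject_shift_one {U : StableCM A} (hU : isStableObject A U) :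
    isStableObject A (U⟦(1 : ℤ)⟧) := by
  obtain ⟨X, ⟨e⟩⟩ := hU
  obtain ⟨L, ⟨P, _, i, _⟩, l, hl⟩ := exists_torsionless_cover X
  have hS := shortExact_cokernel i
  have := isIso_extClass_toStableCM hS
  exact ⟨cokernel i, ⟨(shiftFunctor _ (1 : ℤ)).mapIso (e ≪≫ (asIso ((toStableCMFunctor A).map l)).symm)
    ≪≫ (asIso (C := StableCM A) (X := toStableCM (cokernel i)) (Y := (toStableCM L)⟦(1 : ℤ)⟧)
      (extToStableCM hS.extClass)).symm⟩⟩

lemma isStableObject_shift {U : StableCM A} (hU : isStableObject A U) (n : ℤ) :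
    isStableObject A (U⟦n⟧) := by
  induction n using Int.induction_on with
  | zero => exact ObjectProperty.prop_of_iso _ ((shiftFunctorZero _ ℤ).app U).symm hU
  | succ n ih =>
    exact ObjectProperty.prop_of_iso _ ((shiftFunctorAdd' _ (n : ℤ) 1 _ rfl).app U).symm
      (isStableObject_shift_one ih)
  | pred n ih =>
    exact ObjectProperty.prop_of_iso _ ((shiftFunctorAdd' _ (-n : ℤ) (-1) _ rfl).app U).symm
      (isStableObject_shift_neg_one ih)

/-- With a torsionless source `L`, the morphism is represented by f : L → Y in `A`. Adding an
embedding L → P makes it a monomorphism into Y ⊞ P, stably the same object as Y, and the cone is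
then a cokernel in `A`. -/
lemma isStableObject_cone {U V W : StableCM A} {a : U ⟶ V} {b : V ⟶ W} {c : W ⟶ U⟦(1 : ℤ)⟧}
    (h : IsDist a b c) (hU : isStableObject A U) (hV : isStableObject A V) :
    isStableObject A W := by
  obtain ⟨X, ⟨e⟩⟩ := hU
  obtain ⟨Y, ⟨e'⟩⟩ := hV
  obtain ⟨L, hL, l, hl⟩ := exists_torsionless_cover X
  obtain ⟨f, hf⟩ := toStableCM_map_surjective hL Y ((toStableCMFunctor A).map l ≫ e.inv ≫ a ≫ e'.hom)
  obtain ⟨P, _, i, _⟩ := hL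
  have : Mono (biprod.lift f i) := by
    have : Mono (biprod.lift f i ≫ biprod.snd) := by simpa
    exact mono_of_mono _ (biprod.snd : Y ⊞ P ⟶ P)
  have hS := shortExact_cokernel (biprod.lift f i)
  have : IsIso ((toStableCMFunctor A).map (biprod.fst : Y ⊞ P ⟶ Y)) :=
    isIso_toStableCM_map_g (S := ShortComplex.mk (biprod.inr : P ⟶ Y ⊞ P) biprod.fst (by simp))
      (ShortComplex.Splitting.shortExact
        { r := biprod.snd, s := biprod.inl, f_r := by simp, s_g := by simp, id := by
            dsimp; rw [add_comm]; exact biprod.total })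
  let i₁ := e ≪≫ (asIso ((toStableCMFunctor A).map l)).symm
  let i₂ := e' ≪≫ (asIso ((toStableCMFunctor A).map (biprod.fst : Y ⊞ P ⟶ Y))).symm
  have comm : a ≫ i₂.hom = i₁.hom ≫ (toStableCMFunctor A).map (biprod.lift f i) := by
    rw [← cancel_mono ((toStableCMFunctor A).map (biprod.fst : Y ⊞ P ⟶ Y)), Category.assoc,
      Category.assoc, ← Functor.map_comp, biprod.lift_fst, hf]
    simp [i₁, i₂]
  exact ⟨_, ⟨Triangle.π₃.mapIso (isoTriangleOfIso₁₂ _ _ h (isDist_toStableCM hS) i₁ i₂ comm)⟩⟩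

open DerivedCategory.TStructure in
lemma isStableObject_Q_obj_of_isGE_of_isLE (U : DerivedCategory.Bounded A) (a : ℤ)
    (h : (t (C := A)).onBounded.IsGE U a) (h' : (t (C := A)).onBounded.IsLE U a) :
    isStableObject A ((finiteDerived A).trW.Q.obj U) := by
  have : DerivedCategory.IsGE U.obj a := ⟨h.1⟩
  have : DerivedCategory.IsLE U.obj a := ⟨h'.1⟩
  obtain ⟨X, ⟨e⟩⟩ := DerivedCategory.exists_iso_singleFunctor_obj_of_isGE_of_isLE U.obj a
  let e' : U ≅ ((stalk A).obj X)⟦-a⟧ := DerivedCategory.Bounded.ι.preimageIso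
    (e ≪≫ (((DerivedCategory.singleFunctors A).shiftIso (-a) a 0 (by simp)).app X).symm ≪≫
      (DerivedCategory.Bounded.ι.commShiftIso (-a)).symm.app ((stalk A).obj X))
  exact ObjectProperty.prop_of_iso _ ((finiteDerived A).trW.Q.mapIso e' ≪≫
    ((finiteDerived A).trW.Q.commShiftIso (-a)).app _).symm
    (isStableObject_shift ⟨X, ⟨Iso.refl _⟩⟩ (-a))

open DerivedCategory.TStructure in
-- Induction on the cohomological amplitude: a complex is the cone of a morphism between its
-- truncations, up to a shift.
lemma isStableObject_Q_obj_of_bounded (n : ℕ) : ∀ (U : DerivedCategory.Bounded A) (a : ℤ)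
    (_ : (t (C := A)).onBounded.IsGE U a) (_ : (t (C := A)).onBounded.IsLE U (a + n)),
    isStableObject A ((finiteDerived A).trW.Q.obj U) := by
  induction n with
  | zero =>
    intro U a h h'
    rw [Nat.cast_zero, add_zero] at h'
    exact isStableObject_Q_obj_of_isGE_of_isLE U a h h'
  | succ n ih =>
    intro U a h₁ h₂
    have h₂' : (t (C := A)).onBounded.IsLE U (a + n + 1) := by
      convert h₂ using 1
      push_cast
      ring
    have hT := (t (C := A)).onBounded.triangleLEGE_distinguished (a + n) (a + n + 1) rfl U
    have hT' : IsDist _ _ _ := (finiteDerived A).trW.Q.map_distinguished _ (inv_rot_of_distTriang _ hT)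
    refine isStableObject_cone hT' (ObjectProperty.prop_of_iso _
      (((finiteDerived A).trW.Q.commShiftIso (-1 : ℤ)).app _).symm
        (isStableObject_shift_neg_one ?_)) ?_
    · exact isStableObject_Q_obj_of_isGE_of_isLE _ (a + n + 1) (inferInstanceAs ((t (C := A)).onBounded.IsGE
        (((t (C := A)).onBounded.truncGE (a + n + 1)).obj U) (a + n + 1)))
        (inferInstanceAs ((t (C := A)).onBounded.IsLE
        (((t (C := A)).onBounded.truncGE (a + n + 1)).obj U) (a + n + 1)))
    · exact ih _ a (inferInstanceAs ((t (C := A)).onBounded.IsGE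
        (((t (C := A)).onBounded.truncLE (a + n)).obj U) a))
        (inferInstanceAs ((t (C := A)).onBounded.IsLE
        (((t (C := A)).onBounded.truncLE (a + n)).obj U) (a + n)))

lemma isStableObject_of_isGorensteinOne (U : StableCM A) : isStableObject A U := by
  obtain ⟨V, ⟨e⟩⟩ := (Localization.essSurj (finiteDerived A).trW.Q
    (finiteDerived A).trW).mem_essImage U
  obtain ⟨⟨a, ha⟩, ⟨b, hb⟩⟩ := V.property
  refine ObjectProperty.prop_of_iso _ e
    (isStableObject_Q_obj_of_bounded (b - a).toNat V a ⟨ha.1⟩ ⟨?_⟩)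
  exact DerivedCategory.TStructure.t.le_monotone (show b ≤ a + (b - a).toNat by lia) _ hb.1

end StableObjects

/-! ### Trace forms of a Calabi-Yau structure -/

section CalabiYau

variable {k : Type w} [Field k] {D : Type u} [Category.{v} D] [Preadditive D] [Linear k D]
  [HasShift D ℤ] [∀ n : ℤ, (shiftFunctor D n).Additive] [∀ n : ℤ, (shiftFunctor D n).Linear k]

namespace CalabiYauStructure

variable {d : ℤ} (cy : CalabiYauStructure k D d)

lemma trace_comp {X Y : D} (f : X ⟶ Y) (g : Y ⟶ X⟦d⟧) :
    cy.trace X (f ≫ g) = cy.serre.duality X Y (g ≫ cy.iso.hom.app X) f := by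
  unfold trace
  rw [Category.assoc, cy.serre.duality_comp f (g ≫ cy.iso.hom.app X) (𝟙 X), Category.id_comp]

lemma trace_comp_map {X Y : D} (f : X ⟶ Y) (g : Y ⟶ X⟦d⟧) :
    cy.trace Y (g ≫ f⟦d⟧') = cy.trace X (f ≫ g) := by
  refine Eq.trans ?_ (cy.trace_comp f g).symm
  unfold trace
  rw [Category.assoc, cy.iso.hom.naturality, ← Category.assoc, SerreFunctor.duality_comp_map,
    Category.comp_id]

lemma trace_add {X : D} (f g : X ⟶ X⟦d⟧) : cy.trace X (f + g) = cy.trace X f + cy.trace X g := by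
  unfold trace
  rw [Preadditive.add_comp, map_add, LinearMap.add_apply]

lemma trace_smul {X : D} (c : k) (f : X ⟶ X⟦d⟧) : cy.trace X (c • f) = c • cy.trace X f := by
  unfold trace
  rw [Linear.smul_comp, map_smul, LinearMap.smul_apply]

lemma exists_trace_comp_eq {X Y : D} (θ : Module.Dual k (X ⟶ Y)) :
    ∃ g : Y ⟶ X⟦d⟧, ∀ f, cy.trace X (f ≫ g) = θ f := by
  refine ⟨(cy.serre.duality X Y).symm θ ≫ cy.iso.inv.app X, fun f => ?_⟩
  rw [trace_comp, Category.assoc, Iso.inv_hom_id_app]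
  simp

/-- The commutation of the Serre functor contributes -1 and that of `⟦d⟧` contributes (-1)^d. The
total sign (-1)^(d+1) is -1 in dimension two and +1 in dimension three. -/
lemma trace_shift {X : D} (g : X ⟶ X⟦d⟧) :
    cy.trace (X⟦(1 : ℤ)⟧) (g⟦(1 : ℤ)⟧' ≫ (shiftComm X (1 : ℤ) d).inv) =
      -(d.negOnePow • cy.trace X g) := by
  have h := cy.serre.duality_shift (X := X) (Y := X)
    (g⟦(1 : ℤ)⟧' ≫ (shiftComm X (1 : ℤ) d).inv ≫ cy.iso.hom.app _)
    (d.negOnePow • (g ≫ cy.iso.hom.app X)) (by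
      rw [Category.assoc, Category.assoc, iso_shift, Linear.comp_units_smul,
        Linear.comp_units_smul, Iso.inv_hom_id_assoc, Units.smul_def, Units.smul_def,
        Functor.map_zsmul, Functor.map_comp]) (𝟙 X)
  unfold trace
  rw [CategoryTheory.Functor.map_id, Units.smul_def, map_zsmul] at h
  rw [Category.assoc]
  exact h

/-- The invariant form `Hom(X, X⟦1⟧⟦1⟧) → k` of a Calabi-Yau structure of dimension two. -/
noncomputable def form (cy : CalabiYauStructure k D 2) (X : D) :
    (X ⟶ X⟦(1 : ℤ)⟧⟦(1 : ℤ)⟧) →ₗ[k] k where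
  toFun g := cy.trace X (g ≫ (shiftFunctorAdd' D (1 : ℤ) 1 2 rfl).inv.app X)
  map_add' f g := by rw [Preadditive.add_comp]; exact cy.trace_add _ _
  map_smul' c f := by rw [Linear.smul_comp]; exact cy.trace_smul _ _

section

variable (cy : CalabiYauStructure k D 2)

lemma form_comp_map {X Y : D} (f : X ⟶ Y) (g : Y ⟶ X⟦(1 : ℤ)⟧⟦(1 : ℤ)⟧) :
    cy.form Y (g ≫ f⟦(1 : ℤ)⟧'⟦(1 : ℤ)⟧') = cy.form X (f ≫ g) := by
  refine Eq.trans ?_ ((cy.trace_comp_map f (g ≫ (shiftFunctorAdd' D (1 : ℤ) 1 2 rfl).inv.app X)).trans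
    (congrArg (cy.trace X) (Category.assoc _ _ _).symm))
  refine congrArg (cy.trace Y) ?_
  rw [Category.assoc, Category.assoc]
  exact congrArg (g ≫ ·) ((shiftFunctorAdd' D (1 : ℤ) 1 2 rfl).inv.naturality f)

lemma exists_form_comp_eq {X Y : D} (θ : Module.Dual k (X ⟶ Y)) :
    ∃ g : Y ⟶ X⟦(1 : ℤ)⟧⟦(1 : ℤ)⟧, ∀ f, cy.form X (f ≫ g) = θ f := by
  obtain ⟨g, hg⟩ := cy.exists_trace_comp_eq θ
  refine ⟨g ≫ (shiftFunctorAdd' D (1 : ℤ) 1 2 rfl).hom.app X, fun f => Eq.trans ?_ (hg f)⟩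
  refine congrArg (cy.trace X) ?_
  rw [Category.assoc, Category.assoc, Iso.hom_inv_id_app, Category.comp_id]

lemma eq_zero_of_form_comp {X Y : D} (f : X ⟶ Y)
    (hf : ∀ g : Y ⟶ X⟦(1 : ℤ)⟧⟦(1 : ℤ)⟧, cy.form X (f ≫ g) = 0) : f = 0 := by
  rw [← Module.forall_dual_apply_eq_zero_iff k]
  intro θ
  obtain ⟨g, hg⟩ := cy.exists_form_comp_eq θ
  rw [← hg, hf]

lemma form_shift {X : D} (g : X ⟶ X⟦(1 : ℤ)⟧⟦(1 : ℤ)⟧) :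
    cy.form (X⟦(1 : ℤ)⟧) (g⟦(1 : ℤ)⟧') = -cy.form X g := by
  have h := cy.trace_shift (g ≫ (shiftFunctorAdd' D (1 : ℤ) 1 2 rfl).inv.app X)
  rw [Int.negOnePow_even 2 (by decide), one_smul] at h
  refine Eq.trans ?_ h
  refine congrArg (cy.trace _) ?_
  rw [Functor.map_comp, Category.assoc]
  refine congrArg (g⟦(1 : ℤ)⟧' ≫ ·) ?_
  change _ = _ ≫ (shiftFunctorComm D 1 2).inv.app X
  rw [shiftFunctorComm_eq D 1 2 3 rfl]
  have := shiftFunctorAdd'_assoc_inv_app (C := D) (1 : ℤ) 1 1 2 2 3 rfl rfl rfl X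
  dsimp only [Iso.trans_inv, Iso.symm_inv, NatTrans.comp_app]
  rw [← Category.assoc]
  refine Eq.trans ?_ (congrArg (· ≫ (shiftFunctorAdd' D (1 : ℤ) 2 3 rfl).hom.app X) this.symm)
  rw [Category.assoc, Iso.inv_hom_id_app]
  exact (Category.comp_id _).symm

end

end CalabiYauStructure

end CalabiYau

/-! ### Calabi-Yau structures from trace forms -/

section Construction

variable {k : Type w} [Field k] {D : Type u} [Category.{v} D] [Preadditive D] [Linear k D]
  [HasShift D ℤ] [∀ n : ℤ, (shiftFunctor D n).Additive] [∀ n : ℤ, (shiftFunctor D n).Linear k]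

variable (k D) in
/-- A family of trace forms `Hom(X, X⟦d⟧) → k` inducing a Calabi-Yau structure whose Serre
functor is the shift `⟦d⟧`. -/
structure TraceFamily (d : ℤ) where
  trace (X : D) : (X ⟶ X⟦d⟧) →ₗ[k] k
  trace_comp_map {X Y : D} (f : X ⟶ Y) (g : Y ⟶ X⟦d⟧) : trace Y (g ≫ f⟦d⟧') = trace X (f ≫ g)
  eq_zero_of_trace_comp {X Y : D} (f : X ⟶ Y) (hf : ∀ g : Y ⟶ X⟦d⟧, trace X (f ≫ g) = 0) : f = 0
  trace_shift {X : D} (g : X ⟶ X⟦d⟧) :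
    trace (X⟦(1 : ℤ)⟧) (g⟦(1 : ℤ)⟧' ≫ (shiftComm X (1 : ℤ) d).inv) = -(d.negOnePow • trace X g)

namespace TraceFamily

variable {d : ℤ} (t : TraceFamily k D d)

/-- The pairing between `Hom(Y, X⟦d⟧)` and `Hom(X, Y)`. -/
def pairing (X Y : D) : (Y ⟶ X⟦d⟧) →ₗ[k] Module.Dual k (X ⟶ Y) :=
  LinearMap.mk₂ k (fun g f => t.trace X (f ≫ g)) (by simp) (by simp) (by simp) (by simp)

@[simp]
lemma pairing_apply {X Y : D} (g : Y ⟶ X⟦d⟧) (f : X ⟶ Y) : t.pairing X Y g f = t.trace X (f ≫ g) :=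
  rfl

/-- Symmetry of the trace turns nondegeneracy in one variable into nondegeneracy in the other, since
every morphism X⟦d⟧ → Y⟦d⟧ is a shift. -/
lemma pairing_injective (X Y : D) : Function.Injective (t.pairing X Y) := by
  rw [injective_iff_map_eq_zero]
  intro g hg
  refine t.eq_zero_of_trace_comp g fun h => ?_
  obtain ⟨f, rfl⟩ := (shiftFunctor D d).map_surjective h
  rw [t.trace_comp_map]
  exact congr($hg f)

lemma pairing_flip_injective (X Y : D) : Function.Injective (t.pairing X Y).flip := by
  rw [injective_iff_map_eq_zero]
  intro f hf
  exact t.eq_zero_of_trace_comp f fun g => congr($hf g)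

variable [∀ X Y : D, Module.Finite k (X ⟶ Y)]

/-- Injectivity in both variables forces the two finite dimensions to agree. -/
lemma pairing_bijective (X Y : D) : Function.Bijective (t.pairing X Y) := by
  refine ⟨t.pairing_injective X Y, ?_⟩
  refine (LinearMap.injective_iff_surjective_of_finrank_eq_finrank ?_).1 (t.pairing_injective X Y)
  refine le_antisymm (LinearMap.finrank_le_finrank_of_injective (t.pairing_injective X Y)) ?_
  rw [Subspace.dual_finrank_eq]
  refine (LinearMap.finrank_le_finrank_of_injective (t.pairing_flip_injective X Y)).trans ?_
  rw [Subspace.dual_finrank_eq]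

/-- The Serre functor `⟦d⟧` of a family of trace forms. -/
noncomputable def serreFunctor : SerreFunctor k D where
  functor := shiftFunctor D d
  isEquivalence := inferInstance
  duality X Y := LinearEquiv.ofBijective (t.pairing X Y) (t.pairing_bijective X Y)
  duality_comp g φ f := by simp
  duality_comp_map φ g f := by
    change t.trace _ (f ≫ φ ≫ _) = t.trace _ ((g ≫ f) ≫ φ)
    rw [← Category.assoc, t.trace_comp_map, Category.assoc]

/-- This is where `trace_shift` enters: its sign says exactly that the commutation determined by the
duality is the one which the triangle functor `⟦d⟧` carries, so that the identity is an isomorphism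
of triangle functors. -/
lemma shiftComparison_serreFunctor (X : D) :
    t.serreFunctor.shiftComparison X = d.negOnePow • (shiftComm X (1 : ℤ) d).hom := by
  obtain ⟨ψ, hψ⟩ := (shiftFunctor D (1 : ℤ)).map_surjective
    ((shiftNegShift (X⟦(1 : ℤ)⟧⟦d⟧) (1 : ℤ)).hom ≫ (d.negOnePow • (shiftComm X (1 : ℤ) d).hom))
  have key (f : X ⟶ (X⟦(1 : ℤ)⟧⟦d⟧)⟦(-1 : ℤ)⟧) :
      -t.trace _ (f⟦(1 : ℤ)⟧' ≫ (shiftNegShift _ (1 : ℤ)).hom) = t.trace X (f ≫ ψ) := by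
    have h := t.trace_shift (f ≫ ψ)
    rw [Functor.map_comp, hψ, Category.assoc, Category.assoc, Linear.units_smul_comp,
      Linear.comp_units_smul, Linear.comp_units_smul, Iso.hom_inv_id, Category.comp_id,
      Units.smul_def, Units.smul_def, map_zsmul, ← Units.smul_def, ← Units.smul_def] at h
    have h' := congr(-d.negOnePow • $h)
    simpa [smul_smul] using h'
  have : (t.serreFunctor.duality X _).symm (t.serreFunctor.shiftFunctional X) = ψ := by
    refine (LinearEquiv.symm_apply_eq _).2 (LinearMap.ext fun f => ?_)
    change -t.trace _ ((f⟦(1 : ℤ)⟧' ≫ (shiftNegShift _ (1 : ℤ)).hom) ≫ 𝟙 _) = t.trace X (f ≫ ψ)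
    exact (congrArg (fun g => -t.trace _ g) (Category.comp_id _)).trans (key f)
  unfold SerreFunctor.shiftComparison
  refine (congrArg (fun φ => (shiftNegShift _ (1 : ℤ)).inv ≫ φ⟦(1 : ℤ)⟧') this).trans ?_
  exact (congrArg (_ ≫ ·) hψ).trans (Iso.inv_hom_id_assoc _ _)

/-- The Calabi-Yau structure defined by a family of trace forms. -/
noncomputable def calabiYauStructure : CalabiYauStructure k D d where
  serre := t.serreFunctor
  iso := Iso.refl _
  iso_shift X := by
    rw [shiftComparison_serreFunctor]
    refine (Category.id_comp _).trans (congrArg (d.negOnePow • ·) ?_)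
    exact ((congrArg (_ ≫ ·) (CategoryTheory.Functor.map_id _ _)).trans (Category.comp_id _)).symm

lemma calabiYauStructure_trace {X : D} (f : ShiftedHom X X d) :
    t.calabiYauStructure.trace X f = t.trace X f := by
  change t.trace X (𝟙 X ≫ f ≫ 𝟙 _) = _
  simp

end TraceFamily

end Construction

/-! ### Third extensions through three-step resolutions -/

section YonedaTriple

open Abelian

variable {A : Type u} [Category.{v} A] [Abelian A]

/-- A homomorphism to the middle term of a short exact sequence lifts to the first. -/
lemma shortExact_lift {S : ShortComplex A} (hS : S.ShortExact) {X : A} (f : X ⟶ S.X₂)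
    (hf : f ≫ S.g = 0) : ∃ g : X ⟶ S.X₁, g ≫ S.f = f :=
  have := hS.mono_f
  ⟨hS.exact.lift f hf, hS.exact.lift_f f hf⟩

variable [HasExt.{w} A]

lemma exists_eq_extClass_comp {S : ShortComplex A} (hS : S.ShortExact) [Projective S.X₂] {Y : A}
    {n n' : ℕ} (h : 1 + n = n') (e : Ext S.X₃ Y n') :
    ∃ e' : Ext S.X₁ Y n, e = hS.extClass.comp e' h := by
  obtain rfl : n' = n + 1 := by lia
  obtain ⟨e', he'⟩ := Ext.contravariant_sequence_exact₃ hS Y e (Ext.eq_zero_of_projective _) h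
  exact ⟨e', he'.symm⟩

lemma eq_zero_of_extClass_comp {S : ShortComplex A} (hS : S.ShortExact) [Projective S.X₂] {Y : A}
    {n n' : ℕ} (hn : 1 ≤ n) (h : 1 + n = n') (e : Ext S.X₁ Y n)
    (he : hS.extClass.comp e h = 0) : e = 0 := by
  obtain ⟨m, rfl⟩ := Nat.exists_eq_add_of_le' hn
  obtain ⟨e', rfl⟩ := Ext.contravariant_sequence_exact₁ hS Y e h he
  rw [Ext.eq_zero_of_projective e', Ext.comp_zero]

lemma exists_of_extClass_comp_mk₀_eq_zero {S : ShortComplex A} (hS : S.ShortExact) {Y : A}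
    (f : S.X₁ ⟶ Y) (hf : hS.extClass.comp (Ext.mk₀ f) (add_zero 1) = 0) :
    ∃ g : S.X₂ ⟶ Y, S.f ≫ g = f := by
  obtain ⟨e, he⟩ := Ext.contravariant_sequence_exact₁ hS Y (Ext.mk₀ f) (add_zero 1) hf
  obtain ⟨g, rfl⟩ := (Ext.mk₀_bijective _ _).2 e
  rw [Ext.mk₀_comp_mk₀] at he
  exact ⟨g, (Ext.mk₀_bijective _ _).1 he⟩

/-- The splicing of `0 ⟶ R ⟶ P₂ ⟶ P₁ ⟶ P₀ ⟶ M ⟶ 0` into short exact sequences. -/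
structure YonedaTriple (M P₀ P₁ P₂ R : A) where
  N : A
  N' : A
  i₀ : N ⟶ P₀
  p₀ : P₀ ⟶ M
  i₁ : N' ⟶ P₁
  p₁ : P₁ ⟶ N
  i₂ : R ⟶ P₂
  p₂ : P₂ ⟶ N'
  zero₀ : i₀ ≫ p₀ = 0
  zero₁ : i₁ ≫ p₁ = 0
  zero₂ : i₂ ≫ p₂ = 0
  shortExact₀ : (ShortComplex.mk i₀ p₀ zero₀).ShortExact
  shortExact₁ : (ShortComplex.mk i₁ p₁ zero₁).ShortExact
  shortExact₂ : (ShortComplex.mk i₂ p₂ zero₂).ShortExact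

namespace YonedaTriple

variable {M P₀ P₁ P₂ R : A} (E : YonedaTriple M P₀ P₁ P₂ R)

/-- The extension class of the last two short exact sequences. -/
noncomputable def classTail : Ext E.N R 2 :=
  E.shortExact₁.extClass.comp E.shortExact₂.extClass (by lia)

/-- The class in `Ext³(M, R)`. -/
noncomputable def extClass : Ext M R 3 :=
  E.shortExact₀.extClass.comp E.classTail (by lia)

lemma classTail_comp {X : A} {n a : ℕ} (x : Ext R X n) (h : 2 + n = a) :
    E.classTail.comp x h =
      E.shortExact₁.extClass.comp (E.shortExact₂.extClass.comp x rfl) (by lia) :=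
  Ext.comp_assoc _ _ _ _ _ (by lia)

lemma extClass_comp {X : A} {n a : ℕ} (x : Ext R X n) (h : 3 + n = a) :
    E.extClass.comp x h =
      E.shortExact₀.extClass.comp (E.classTail.comp x rfl) (by lia) :=
  Ext.comp_assoc _ _ _ _ _ (by lia)

lemma exists_classTail_comp_eq [Projective P₁] [Projective P₂] {X : A} (e : Ext E.N X 2) :
    ∃ x : R ⟶ X, e = E.classTail.comp (Ext.mk₀ x) (add_zero 2) := by
  have : Projective (ShortComplex.mk E.i₁ E.p₁ E.zero₁).X₂ := by assumption
  have : Projective (ShortComplex.mk E.i₂ E.p₂ E.zero₂).X₂ := by assumption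
  obtain ⟨e', rfl⟩ := exists_eq_extClass_comp E.shortExact₁ (n := 1) (by lia) e
  obtain ⟨e'', rfl⟩ := exists_eq_extClass_comp E.shortExact₂ (n := 0) (by lia) e'
  obtain ⟨x, rfl⟩ := (Ext.mk₀_bijective _ _).2 e''
  exact ⟨x, (E.classTail_comp _ _).symm⟩

lemma exists_extClass_comp_eq [Projective P₀] [Projective P₁] [Projective P₂] {X : A}
    (e : Ext M X 3) : ∃ x : R ⟶ X, e = E.extClass.comp (Ext.mk₀ x) (add_zero 3) := by
  have : Projective (ShortComplex.mk E.i₀ E.p₀ E.zero₀).X₂ := by assumption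
  obtain ⟨e', rfl⟩ := exists_eq_extClass_comp E.shortExact₀ (n := 2) (by lia) e
  obtain ⟨x, rfl⟩ := E.exists_classTail_comp_eq e'
  exact ⟨x, (E.extClass_comp _ _).symm⟩

/-- The dimension shifts Ext¹ → Ext² → Ext³ lose nothing. Only the first one, from Hom to Ext¹, has
a kernel, namely the maps that extend over `P₂`. -/
lemma exists_of_extClass_comp_eq_zero [Projective P₀] [Projective P₁] [Projective P₂] {X : A}
    (x : R ⟶ X) (hx : E.extClass.comp (Ext.mk₀ x) (add_zero 3) = 0) :
    ∃ y : P₂ ⟶ X, E.i₂ ≫ y = x := by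
  have : Projective (ShortComplex.mk E.i₀ E.p₀ E.zero₀).X₂ := by assumption
  have : Projective (ShortComplex.mk E.i₁ E.p₁ E.zero₁).X₂ := by assumption
  rw [extClass_comp] at hx
  have h := eq_zero_of_extClass_comp E.shortExact₀ (by lia) _ _ hx
  rw [classTail_comp] at h
  exact exists_of_extClass_comp_mk₀_eq_zero E.shortExact₂ x
    (eq_zero_of_extClass_comp E.shortExact₁ (by lia) _ _ h)

lemma extClass_naturality {S S' : ShortComplex A} (hS : S.ShortExact) (hS' : S'.ShortExact)
    (φ₁ : S.X₁ ⟶ S'.X₁) (φ₂ : S.X₂ ⟶ S'.X₂) (φ₃ : S.X₃ ⟶ S'.X₃)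
    (h₁ : φ₁ ≫ S'.f = S.f ≫ φ₂) (h₂ : φ₂ ≫ S'.g = S.g ≫ φ₃) :
    hS.extClass.comp (Ext.mk₀ φ₁) (add_zero 1) = (Ext.mk₀ φ₃).comp hS'.extClass (zero_add 1) :=
  (ShortComplex.ShortExact.extClass_naturality hS hS' ⟨φ₁, φ₂, φ₃, h₁, h₂⟩)

lemma exists_shortExact_map {S S' : ShortComplex A} (hS : S.ShortExact) (hS' : S'.ShortExact)
    (φ₂ : S.X₂ ⟶ S'.X₂) (φ₃ : S.X₃ ⟶ S'.X₃) (h₂ : φ₂ ≫ S'.g = S.g ≫ φ₃) :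
    ∃ φ₁ : S.X₁ ⟶ S'.X₁, φ₁ ≫ S'.f = S.f ≫ φ₂ ∧
      hS.extClass.comp (Ext.mk₀ φ₁) (add_zero 1) =
        (Ext.mk₀ φ₃).comp hS'.extClass (zero_add 1) := by
  obtain ⟨φ₁, h₁⟩ := shortExact_lift hS' (S.f ≫ φ₂) (by
    rw [Category.assoc, h₂, S.zero_assoc, zero_comp])
  exact ⟨φ₁, h₁, extClass_naturality hS hS' φ₁ φ₂ φ₃ h₁ h₂⟩

/-- A chain map induces maps on the successive syzygies, and the extension classes of the three
short exact sequences are natural for them. The conditions are put on the composites P₂ → P₁ → P₀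
because only these are images of morphisms of `C` in the application. -/
lemma exists_map {M' P₀' P₁' P₂' R' : A} (E' : YonedaTriple M' P₀' P₁' P₂' R') (φ : M ⟶ M')
    (φ₀ : P₀ ⟶ P₀') (φ₁ : P₁ ⟶ P₁') (φ₂ : P₂ ⟶ P₂') (h : φ₀ ≫ E'.p₀ = E.p₀ ≫ φ)
    (h₀ : φ₁ ≫ E'.p₁ ≫ E'.i₀ = E.p₁ ≫ E.i₀ ≫ φ₀) (h₁ : φ₂ ≫ E'.p₂ ≫ E'.i₁ = E.p₂ ≫ E.i₁ ≫ φ₁) :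
    ∃ ρ : R ⟶ R', ρ ≫ E'.i₂ = E.i₂ ≫ φ₂ ∧
      E.extClass.comp (Ext.mk₀ ρ) (add_zero 3) = (Ext.mk₀ φ).comp E'.extClass (zero_add 3) := by
  have : Mono E'.i₀ := E'.shortExact₀.mono_f
  have : Mono E'.i₁ := E'.shortExact₁.mono_f
  obtain ⟨ν, hν, h₀'⟩ := exists_shortExact_map E.shortExact₀ E'.shortExact₀ φ₀ φ h
  obtain ⟨ν', hν', h₁'⟩ := exists_shortExact_map E.shortExact₁ E'.shortExact₁ φ₁ ν (by
    dsimp at hν ⊢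
    rw [← cancel_mono E'.i₀, Category.assoc, Category.assoc, hν, h₀])
  obtain ⟨ρ, hρ, h₂'⟩ := exists_shortExact_map E.shortExact₂ E'.shortExact₂ φ₂ ν' (by
    dsimp at hν' ⊢
    rw [← cancel_mono E'.i₁, Category.assoc, Category.assoc, hν', h₁])
  refine ⟨ρ, hρ, ?_⟩
  rw [extClass_comp, classTail_comp]
  dsimp only at h₀' h₁' h₂' ⊢
  rw [h₂', ← Ext.comp_assoc (a₁₂ := 1) (a₂₃ := 1) _ _ _ _ _ (by lia), h₁',
    Ext.comp_assoc (a₁₂ := 1) (a₂₃ := 2) _ _ _ _ _ (by lia),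
    ← Ext.comp_assoc (a₁₂ := 1) (a₂₃ := 2) _ _ _ _ _ (by lia), h₀',
    Ext.comp_assoc (a₁₂ := 1) (a₂₃ := 3) _ _ _ _ _ (by lia)]
  all_goals rfl

end YonedaTriple

end YonedaTriple

/-! ### The functor to modules: injectives and the Gorenstein property -/

section RestrictedYoneda

open Abelian

variable {C : Type u} [Category.{v} C] [Preadditive C] [HasZeroObject C] [HasShift C ℤ]
  [∀ n : ℤ, (shiftFunctor C n).Additive] [Pretriangulated C]
  {A : Type u₁} [Category.{v₁} A] [Abelian A]

/-- A map from U in `T` to `T₁⟦1⟧` dies in `T₀⟦1⟧` by rigidity, hence comes from a map U → X. The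
latter lifts to `T₀` and so becomes zero in `T₁⟦1⟧`. -/
lemma exists_isDist_of_mem (T : ObjectProperty C) [IsClusterTilting T] {T₀ X : C} (hT₀ : T T₀)
    (b : T₀ ⟶ X) (hb : ∀ ⦃U : C⦄ (_ : T U) (g : U ⟶ X), ∃ h : U ⟶ T₀, h ≫ b = g) :
    ∃ (T₁ : C) (_ : T T₁) (a : T₁ ⟶ T₀) (c : X ⟶ T₁⟦(1 : ℤ)⟧), IsDist a b c := by
  obtain ⟨T₁, a, c, h⟩ := IsDist.exists₁ b
  refine ⟨T₁, IsClusterTilting.mem_of_ext_eq_zero _ fun U hU f => ?_, a, c, h⟩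
  obtain ⟨g, rfl⟩ := h.lift₃ f (IsClusterTilting.ext_eq_zero hU hT₀ _)
  obtain ⟨h', rfl⟩ := hb hU g
  rw [Category.assoc, h.zero₂₃, comp_zero]

lemma IsDist.exists_lift_of_mem (T : ObjectProperty C) [IsClusterTilting T] {X Y Z : C}
    {a : X ⟶ Y} {b : Y ⟶ Z} {c : Z ⟶ X⟦(1 : ℤ)⟧} (h : IsDist a b c) (hX : T X) {U : C}
    (hU : T U) (f : U ⟶ Z) : ∃ g : U ⟶ Y, g ≫ b = f :=
  h.lift₂ f (IsClusterTilting.ext_eq_zero hU hX _)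

lemma exists_isDist (T : ObjectProperty C) [IsClusterTilting T] (X : C) :
    ∃ (T₁ T₀ : C) (_ : T T₁) (_ : T T₀) (a : T₁ ⟶ T₀) (b : T₀ ⟶ X) (c : X ⟶ T₁⟦(1 : ℤ)⟧),
      IsDist a b c := by
  obtain ⟨T₀, hT₀, b, hb⟩ := IsClusterTilting.exists_rightApproximation (T := T) X
  obtain ⟨T₁, hT₁, a, c, h⟩ := exists_isDist_of_mem T hT₀ b hb
  exact ⟨T₁, T₀, hT₁, hT₀, a, b, c, h⟩

lemma exists_isDist_shift (T : ObjectProperty C) [IsClusterTilting T] (K : C) :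
    ∃ (T₁ T₀ : C) (_ : T T₁) (_ : T T₀) (κ : K ⟶ T₁) (b : T₁ ⟶ T₀) (z : T₀ ⟶ K⟦(1 : ℤ)⟧),
      IsDist κ b z := by
  obtain ⟨T₁, T₀, h₁, h₀, b, z, e, h⟩ := exists_isDist T (K⟦(1 : ℤ)⟧)
  obtain ⟨κ, hκ⟩ := (shiftFunctor C (1 : ℤ)).map_surjective (-e)
  refine ⟨T₁, T₀, h₁, h₀, κ, b, z, IsDist.of_rotate ?_⟩
  rwa [hκ, neg_neg]

/-- The properties of the functor `C ⥤ mod T` which sends `X` to the restriction of `Hom(-, X)`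
to `T`. -/
structure IsRestrictedYoneda (T : ObjectProperty C) (F : C ⥤ A) : Prop where
  map_bijective {U : C} (hU : T U) (X : C) : Function.Bijective (F.map : (U ⟶ X) → _)
  projective {U : C} (hU : T U) : Projective (F.obj U)
  map_eq_zero {X Y : C} (f : X ⟶ Y) (hf : ∀ ⦃U : C⦄ (_ : T U) (u : U ⟶ X), u ≫ f = 0) :
    F.map f = 0

namespace IsRestrictedYoneda

variable {T : ObjectProperty C} {F : C ⥤ A}

lemma map_surjective (hF : IsRestrictedYoneda T F) {U X : C} (hU : T U) (f : F.obj U ⟶ F.obj X) :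
    ∃ g : U ⟶ X, F.map g = f := (hF.map_bijective hU X).2 f

lemma map_injective (hF : IsRestrictedYoneda T F) {U X : C} (hU : T U) {f g : U ⟶ X}
    (h : F.map f = F.map g) : f = g := (hF.map_bijective hU X).1 h

section

variable [F.IsHomological] {X Y Z : C} {a : X ⟶ Y} {b : Y ⟶ Z} {c : Z ⟶ X⟦(1 : ℤ)⟧}

lemma _root_.ClusterTilting.IsDist.map_zero (h : IsDist a b c) : F.map a ≫ F.map b = 0 := by
  rw [← F.map_comp, h.zero₁₂, F.map_zero]

variable (F) in
lemma _root_.ClusterTilting.IsDist.exact (h : IsDist a b c) :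
    (ShortComplex.mk (F.map a) (F.map b) h.map_zero).Exact :=
  F.map_distinguished_exact _ h

variable (F) in
lemma _root_.ClusterTilting.IsDist.epi (h : IsDist a b c) (hc : F.map c = 0) :
    Epi (F.map b) :=
  (ShortComplex.exact_iff_epi _ hc).1 (h.rotate.exact F)

variable (F) in
lemma _root_.ClusterTilting.IsDist.mono (h : IsDist a b c) (ha : F.map a = 0) :
    Mono (F.map b) :=
  (ShortComplex.exact_iff_mono _ ha).1 (h.exact F)

lemma isZero_map_shift [IsClusterTilting T] (hF : IsRestrictedYoneda T F) {U : C} (hU : T U) :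
    IsZero (F.obj (U⟦(1 : ℤ)⟧)) := by
  rw [IsZero.iff_id_eq_zero, ← F.map_id]
  refine hF.map_eq_zero _ fun V hV u => ?_
  rw [IsClusterTilting.ext_eq_zero hV hU u, zero_comp]

lemma epi_map [IsClusterTilting T] (hF : IsRestrictedYoneda T F) (h : IsDist a b c)
    (hX : T X) : Epi (F.map b) :=
  h.epi F ((hF.isZero_map_shift hX).eq_of_tgt _ _)

/-- The object `X` has a presentation by `T₁` and `T₀`, on which `F` is already fully faithful. A
morphism of modules is lifted on `T₀` and descends along the triangle. -/
lemma full [F.Additive] [IsClusterTilting T] (hF : IsRestrictedYoneda T F) : F.Full where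
  map_surjective {X Y} φ := by
    obtain ⟨T₁, T₀, h₁, h₀, a, b, c, h⟩ := exists_isDist T X
    obtain ⟨y, hy⟩ := hF.map_surjective h₀ (F.map b ≫ φ)
    obtain ⟨f, rfl⟩ := h.desc₃ y (hF.map_injective h₁ (by
      rw [F.map_comp, hy, ← Category.assoc, h.map_zero, zero_comp, F.map_zero]))
    have := hF.epi_map h h₁
    refine ⟨f, ?_⟩
    rw [← cancel_epi (F.map b), ← hy, F.map_comp]

variable [F.EssSurj]

lemma exists_epi [IsClusterTilting T] (hF : IsRestrictedYoneda T F) (M : A) :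
    ∃ (U : C) (_ : T U) (p : F.obj U ⟶ M), Epi p := by
  obtain ⟨T₁, T₀, h₁, h₀, a, b, c, h⟩ := exists_isDist T (F.objPreimage M)
  have := hF.epi_map h h₁
  exact ⟨T₀, h₀, F.map b ≫ (F.objObjPreimageIso M).hom, inferInstance⟩

lemma enoughProjectives [IsClusterTilting T] (hF : IsRestrictedYoneda T F) :
    EnoughProjectives A where
  presentation M := by
    obtain ⟨U, hU, p, hp⟩ := hF.exists_epi M
    have := hF.projective hU
    exact ⟨⟨F.obj U, p⟩⟩

/-- If M ≅ F X, the approximation triangle of X⟦-1⟧ gives, after suspension, T₀⟦1⟧ → X → T₁⟦2⟧, and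
`F` kills the first term. -/
lemma exists_mono_shift [IsClusterTilting T] (hF : IsRestrictedYoneda T F) (M : A) :
    ∃ (U : C) (_ : T U) (j : M ⟶ F.obj (U⟦(1 : ℤ)⟧⟦(1 : ℤ)⟧)), Mono j := by
  let X := F.objPreimage M
  obtain ⟨T₁, T₀, h₁, h₀, a, b, c, h⟩ := exists_isDist T (X⟦(-1 : ℤ)⟧)
  have : Mono (F.map (-c⟦(1 : ℤ)⟧')) := by
    refine h.rotate.rotate.rotate.rotate.mono F ?_
    exact (hF.isZero_map_shift h₀).eq_of_src _ _
  let e : M ≅ F.obj (X⟦(-1 : ℤ)⟧⟦(1 : ℤ)⟧) :=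
    (F.objObjPreimageIso M).symm ≪≫ F.mapIso (shiftNegShift X (1 : ℤ)).symm
  exact ⟨T₁, h₁, e.hom ≫ F.map (-c⟦(1 : ℤ)⟧'), inferInstance⟩

/-- The triangle U⟦1⟧ → T₁ → T₀ → U⟦2⟧ becomes short exact because `F` kills U⟦1⟧ and T₁⟦1⟧. It
bounds the projective dimension of F(U⟦2⟧) by one. -/
lemma exists_shortExact_shift_shift [IsClusterTilting T] (hF : IsRestrictedYoneda T F)
    {U : C} (hU : T U) :
    ∃ (T₁ T₀ : C) (_ : T T₁) (_ : T T₀) (a : T₁ ⟶ T₀) (b : T₀ ⟶ U⟦(1 : ℤ)⟧⟦(1 : ℤ)⟧)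
      (w : F.map a ≫ F.map b = 0), (ShortComplex.mk (F.map a) (F.map b) w).ShortExact := by
  obtain ⟨T₁, T₀, h₁, h₀, κ, b, z, h⟩ := exists_isDist_shift T (U⟦(1 : ℤ)⟧)
  exact ⟨T₁, T₀, h₁, h₀, b, z, h.rotate.map_zero,
    { exact := h.rotate.exact F
      mono_f := h.mono F ((hF.isZero_map_shift hU).eq_of_src _ _)
      epi_g := hF.epi_map h.rotate h₁ }⟩

end

section Serre

variable {k : Type w} [Field k] [Linear k C] [∀ n : ℤ, (shiftFunctor C n).Linear k]

lemma _root_.ClusterTilting.CalabiYauStructure.eq_zero_of_form_comp'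
    (cy : CalabiYauStructure k C 2) {X Y : C} (g : Y ⟶ X⟦(1 : ℤ)⟧⟦(1 : ℤ)⟧)
    (hg : ∀ f : X ⟶ Y, cy.form X (f ≫ g) = 0) : g = 0 := by
  refine cy.eq_zero_of_form_comp g fun h => ?_
  obtain ⟨h, rfl⟩ := (shiftFunctor C (1 : ℤ)).map_surjective h
  obtain ⟨f, rfl⟩ := (shiftFunctor C (1 : ℤ)).map_surjective h
  rw [cy.form_comp_map, hg]

variable [F.Additive] [F.IsHomological] [F.EssSurj] [IsClusterTilting T]

/-- By duality, morphisms Y → U⟦2⟧ are linear forms on Hom(U, Y), the value of F Y at U. Extending a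
morphism along a monomorphism is thus extending a linear form along an injection of vector spaces.
-/
lemma injective_map_shift_shift (hF : IsRestrictedYoneda T F)
    (cy : CalabiYauStructure k C 2) {U : C} (hU : T U) :
    Injective (F.obj (U⟦(1 : ℤ)⟧⟦(1 : ℤ)⟧)) where
  factors {M N} φ j hj := by
    have := hF.full
    obtain ⟨g, hg⟩ := F.map_surjective ((F.objObjPreimageIso M).hom ≫ φ)
    obtain ⟨f, hf⟩ := F.map_surjective
      ((F.objObjPreimageIso M).hom ≫ j ≫ (F.objObjPreimageIso N).inv)
    have hf' : Mono (F.map f) := by rw [hf]; infer_instance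
    let L : (U ⟶ F.objPreimage M) →ₗ[k] (U ⟶ F.objPreimage N) := Linear.rightComp k U f
    have hL : LinearMap.ker L = ⊥ := LinearMap.ker_eq_bot'.2 fun x hx =>
      hF.map_injective hU (by
        rw [← cancel_mono (F.map f), ← F.map_comp, F.map_zero, zero_comp]
        exact (congrArg F.map hx).trans (F.map_zero _ _))
    -- The linear retraction `l` extends the linear form of `g` from Hom(U, M) to Hom(U, N); `h`
    -- represents the extension.
    obtain ⟨l, hl⟩ := LinearMap.exists_leftInverse_of_injective L hL
    obtain ⟨h, hh⟩ := cy.exists_form_comp_eq (((cy.form U).comp (Linear.rightComp k U g)).comp l)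
    have hfg : f ≫ h = g := by
      rw [← sub_eq_zero]
      refine cy.eq_zero_of_form_comp' _ fun x => ?_
      rw [Preadditive.comp_sub, map_sub, ← Category.assoc, hh, sub_eq_zero]
      exact congr(cy.form U ($hl x ≫ g))
    refine ⟨(F.objObjPreimageIso N).inv ≫ F.map h, ?_⟩
    rw [← cancel_epi (F.objObjPreimageIso M).hom, ← hg, ← hfg, F.map_comp, hf]
    simp

lemma enoughInjectives (hF : IsRestrictedYoneda T F)
    (cy : CalabiYauStructure k C 2) : EnoughInjectives A where
  presentation M := by
    obtain ⟨U, hU, j, hj⟩ := hF.exists_mono_shift M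
    exact ⟨⟨_, hF.injective_map_shift_shift cy hU, j, hj⟩⟩

variable [HasExt.{w₁} A]

/-- The approximation triangle of U⟦-1⟧, suspended, gives an injective resolution 0 → F U → F(T₁⟦2⟧)
→ F(T₀⟦2⟧) → 0 of length one. -/
lemma ext_eq_zero_of_mem (hF : IsRestrictedYoneda T F)
    (cy : CalabiYauStructure k C 2) {U : C} (hU : T U) (M : A)
    (e : Ext M (F.obj U) 2) : e = 0 := by
  obtain ⟨T₁, T₀, h₁, h₀, a, b, c, h⟩ := exists_isDist T (U⟦(-1 : ℤ)⟧)
  have h' := h.rotate.rotate.rotate.rotate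
  have h'' := h'.rotate
  have : Mono (F.map (-c⟦(1 : ℤ)⟧')) :=
    h'.mono F ((hF.isZero_map_shift h₀).eq_of_src _ _)
  have : Epi (F.map (- (-a⟦(1 : ℤ)⟧')⟦(1 : ℤ)⟧')) := by
    refine h''.epi F (IsZero.eq_of_tgt ?_ _ _)
    exact (hF.isZero_map_shift hU).of_iso
      (F.mapIso ((shiftFunctor C (1 : ℤ)).mapIso (shiftNegShift U (1 : ℤ))))
  have hS : (ShortComplex.mk _ _ h''.map_zero).ShortExact := { exact := h''.exact F }
  have := hF.injective_map_shift_shift cy h₁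
  have := hF.injective_map_shift_shift cy h₀
  have key (e : Ext M (F.obj (U⟦(-1 : ℤ)⟧⟦(1 : ℤ)⟧)) 2) : e = 0 := by
    obtain ⟨e', rfl⟩ := Ext.covariant_sequence_exact₁ M hS e
      (Ext.eq_zero_of_injective (I := F.obj (T₁⟦(1 : ℤ)⟧⟦(1 : ℤ)⟧)) _) rfl
    rw [Ext.eq_zero_of_injective (I := F.obj (T₀⟦(1 : ℤ)⟧⟦(1 : ℤ)⟧)) e', Ext.zero_comp]
  have h0 := congr(($(key (e.comp (Ext.mk₀ (F.map (shiftNegShift U (1 : ℤ)).inv)) rfl))).comp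
    (Ext.mk₀ (F.map (shiftNegShift U (1 : ℤ)).hom)) (add_zero 2))
  rw [Ext.comp_assoc (a₂₃ := 0) _ _ _ _ (by lia) (by lia), Ext.mk₀_comp_mk₀, ← F.map_comp,
    Iso.inv_hom_id, F.map_id, Ext.comp_mk₀_id, Ext.zero_comp] at h0
  exact h0

lemma isGorensteinOne (hF : IsRestrictedYoneda T F)
    (cy : CalabiYauStructure k C 2) : IsGorensteinOne A where
  ext_projective_eq_zero X P _ e := by
    obtain ⟨U, hU, p, hp⟩ := hF.exists_epi P
    have h0 := congr(($(hF.ext_eq_zero_of_mem cy hU X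
      (e.comp (Ext.mk₀ (Projective.factorThru (𝟙 P) p)) rfl))).comp (Ext.mk₀ p) (add_zero 2))
    rwa [Ext.comp_assoc (a₂₃ := 0) _ _ _ _ (by lia) (by lia), Ext.mk₀_comp_mk₀,
      Projective.factorThru_comp, Ext.comp_mk₀_id, Ext.zero_comp] at h0
  exists_mono X := by
    obtain ⟨U, hU, j, hj⟩ := hF.exists_mono_shift X
    obtain ⟨T₁, T₀, h₁, h₀, a, b, w, h⟩ := hF.exists_shortExact_shift_shift hU
    exact ⟨_, h, hF.projective h₁, hF.projective h₀, j, hj⟩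

end Serre

lemma finite_hom (hF : IsRestrictedYoneda T F) [IsClusterTilting T] (k : Type w) [Field k]
    [Linear k C] [Linear k A] [F.Additive] [F.IsHomological] [F.Linear k] [F.EssSurj]
    [∀ X Y : C, Module.Finite k (X ⟶ Y)] (M N : A) : Module.Finite k (M ⟶ N) := by
  have := hF.full
  have h : Function.Surjective
      ((Linear.homCongr k (F.objObjPreimageIso M) (F.objObjPreimageIso N)).toLinearMap.comp
        (F.mapLinearMap k : (F.objPreimage M ⟶ F.objPreimage N) →ₗ[k] _)) :=
    (Linear.homCongr k (F.objObjPreimageIso M) (F.objObjPreimageIso N)).surjective.comp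
      F.map_surjective
  exact Module.Finite.of_surjective _ h

end IsRestrictedYoneda

end RestrictedYoneda

/-! ### Resolutions from approximation triangles and the map `theta` -/

section Resolution

open Abelian

section

variable {A : Type u₁} [Category.{v₁} A] [Abelian A]

lemma YonedaTriple.exists_of_exact {M P₀ P₁ P₂ : A} (f₂ : P₂ ⟶ P₁) (f₁ : P₁ ⟶ P₀) (f₀ : P₀ ⟶ M)
    [Epi f₀] (w₂ : f₂ ≫ f₁ = 0) (w₁ : f₁ ≫ f₀ = 0) (h₂ : (ShortComplex.mk f₂ f₁ w₂).Exact)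
    (h₁ : (ShortComplex.mk f₁ f₀ w₁).Exact) :
    ∃ (R : A) (E : YonedaTriple M P₀ P₁ P₂ R), E.p₀ = f₀ ∧ E.p₁ ≫ E.i₀ = f₁ ∧
      E.p₂ ≫ E.i₁ = f₂ := by
  have : Epi (kernel.lift f₀ f₁ w₁) := h₁.epi_kernelLift
  have w₂' : f₂ ≫ kernel.lift f₀ f₁ w₁ = 0 := by
    rw [← cancel_mono (kernel.ι f₀), Category.assoc, kernel.lift_ι, w₂, zero_comp]
  have h₂' : (ShortComplex.mk f₂ (kernel.lift f₀ f₁ w₁) w₂').Exact :=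
    (ShortComplex.exact_iff_of_epi_of_isIso_of_mono
      (S₁ := ShortComplex.mk f₂ (kernel.lift f₀ f₁ w₁) w₂') (S₂ := ShortComplex.mk f₂ f₁ w₂)
      { τ₁ := 𝟙 _, τ₂ := 𝟙 _, τ₃ := kernel.ι f₀ }).2 h₂
  have : Epi (kernel.lift _ f₂ w₂') := h₂'.epi_kernelLift
  exact ⟨_, ⟨_, _, kernel.ι f₀, f₀, kernel.ι _, kernel.lift f₀ f₁ w₁, kernel.ι _,
    kernel.lift _ f₂ w₂', _, _, _, shortExact_kernel _, shortExact_kernel _,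
    shortExact_kernel _⟩, rfl, kernel.lift_ι _ _ _, kernel.lift_ι _ _ _⟩

end

variable {C : Type u} [Category.{v} C] [Preadditive C] [HasZeroObject C] [HasShift C ℤ]
  [∀ n : ℤ, (shiftFunctor C n).Additive] [Pretriangulated C]
  {A : Type u₁} [Category.{v₁} A] [Abelian A]

/-- Approximation triangles of `K` and of `K⟦1⟧`, and the beginning
`R ⟶ F T₂ ⟶ F T₁ ⟶ F T₀` of a projective resolution of `F (K⟦1⟧)` which they define. -/
structure Resolution (T : ObjectProperty C) (F : C ⥤ A) (K : C) where
  T₀ : C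
  T₁ : C
  T₂ : C
  T₃ : C
  mem₀ : T T₀
  mem₁ : T T₁
  mem₂ : T T₂
  mem₃ : T T₃
  s : T₃ ⟶ T₂
  c : T₂ ⟶ K
  r : K ⟶ T₃⟦(1 : ℤ)⟧
  κ : K ⟶ T₁
  b : T₁ ⟶ T₀
  z : T₀ ⟶ K⟦(1 : ℤ)⟧
  isDist : IsDist s c r
  isDist' : IsDist κ b z
  R : A
  E : YonedaTriple (F.obj (K⟦(1 : ℤ)⟧)) (F.obj T₀) (F.obj T₁) (F.obj T₂) R
  p₀ : E.p₀ = F.map z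
  p₁ : E.p₁ ≫ E.i₀ = F.map b
  p₂ : E.p₂ ≫ E.i₁ = F.map (c ≫ κ)

lemma IsRestrictedYoneda.nonempty_resolution {T : ObjectProperty C} [IsClusterTilting T]
    {F : C ⥤ A} [F.IsHomological]
    (hF : IsRestrictedYoneda T F) (K : C) : Nonempty (Resolution T F K) := by
  obtain ⟨T₃, T₂, h₃, h₂, s, c, r, h⟩ := exists_isDist T K
  obtain ⟨T₁, T₀, h₁, h₀, κ, b, z, h'⟩ := exists_isDist_shift T K
  have := hF.epi_map h'.rotate h₁
  have := hF.epi_map h h₃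
  have w : F.map (c ≫ κ) ≫ F.map b = 0 := by
    rw [F.map_comp, Category.assoc, h'.map_zero, comp_zero]
  obtain ⟨R, E, p₀, p₁, p₂⟩ := YonedaTriple.exists_of_exact (F.map (c ≫ κ)) (F.map b) (F.map z)
    w h'.rotate.map_zero
    ((ShortComplex.exact_iff_of_epi_of_isIso_of_mono
      (S₁ := ShortComplex.mk (F.map (c ≫ κ)) (F.map b) w)
      (S₂ := ShortComplex.mk (F.map κ) (F.map b) h'.map_zero)
      { τ₁ := F.map c, τ₂ := 𝟙 _, τ₃ := 𝟙 _ }).2 (h'.exact F)) (h'.rotate.exact F)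
  exact ⟨⟨T₀, T₁, T₂, T₃, h₀, h₁, h₂, h₃, s, c, r, κ, b, z, h, h', R, E, p₀, p₁, p₂⟩⟩

namespace Resolution

variable {T : ObjectProperty C} {F : C ⥤ A} {K : C}

section

variable [F.IsHomological]

lemma exists_ℓ (S : Resolution T F K) : ∃ ℓ : F.obj S.T₃ ⟶ S.R, ℓ ≫ S.E.i₂ = F.map S.s := by
  have : Mono S.E.i₁ := S.E.shortExact₁.mono_f
  exact shortExact_lift S.E.shortExact₂ (F.map S.s) (by
    dsimp only
    rw [← cancel_mono S.E.i₁, Category.assoc, S.p₂, ← F.map_comp, ← Category.assoc,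
      S.isDist.zero₁₂, zero_comp, zero_comp, F.map_zero])

/-- The morphism `F T₃ ⟶ R` induced by `s`. -/
noncomputable def ℓ (S : Resolution T F K) : F.obj S.T₃ ⟶ S.R := S.exists_ℓ.choose

lemma ℓ_i₂ (S : Resolution T F K) : S.ℓ ≫ S.E.i₂ = F.map S.s := S.exists_ℓ.choose_spec

instance (S : Resolution T F K) : Mono S.E.i₂ := S.E.shortExact₂.mono_f

end

variable {k : Type w} [Field k] [Linear k C] [Linear k A] [HasExt.{w₁} A]
  [∀ n : ℤ, (shiftFunctor C n).Linear k] [F.Additive] [F.IsHomological] [F.Linear k]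

variable (k) in
/-- The linear map which sends `x : R ⟶ F Z` to the class of its Yoneda product with the class of
the resolution. -/
noncomputable def toExt (S : Resolution T F K) (M : A) :
    (S.R ⟶ M) →ₗ[k] Ext (F.obj (K⟦(1 : ℤ)⟧)) M 3 where
  toFun x := S.E.extClass.comp (Ext.mk₀ x) (add_zero 3)
  map_add' x y := by rw [Ext.mk₀_add, Ext.comp_add]
  map_smul' a x := by rw [Ext.mk₀_smul, Ext.comp_smul, RingHom.id_apply]

variable (k) in
/-- The linear map which sends `x : R ⟶ F Z` to `r ≫ y⟦1⟧'`, where `y : T₃ ⟶ Z` satisfies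
`F y = ℓ ≫ x`. -/
noncomputable def preTheta (S : Resolution T F K) (hF : IsRestrictedYoneda T F) (Z : C) :
    (S.R ⟶ F.obj Z) →ₗ[k] (K ⟶ Z⟦(1 : ℤ)⟧) :=
  (Linear.leftComp k _ S.r).comp (((shiftFunctor C (1 : ℤ)).mapLinearMap k).comp
    ((LinearEquiv.ofBijective (F.mapLinearMap k)
      (hF.map_bijective S.mem₃ Z)).symm.toLinearMap.comp (Linear.leftComp k _ S.ℓ)))

lemma preTheta_eq (S : Resolution T F K) (hF : IsRestrictedYoneda T F) {Z : C}
    (x : S.R ⟶ F.obj Z) (y : S.T₃ ⟶ Z) (h : F.map y = S.ℓ ≫ x) :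
    S.preTheta k hF Z x = S.r ≫ y⟦(1 : ℤ)⟧' := by
  have : (LinearEquiv.ofBijective (F.mapLinearMap k) (hF.map_bijective S.mem₃ Z)).symm
      (S.ℓ ≫ x) = y := (LinearEquiv.symm_apply_eq _).2 h.symm
  exact congr(S.r ≫ (shiftFunctor C (1 : ℤ)).map $this)

variable [IsClusterTilting T]

lemma toExt_surjective (S : Resolution T F K) (hF : IsRestrictedYoneda T F) (M : A) :
    Function.Surjective (S.toExt k M) := by
  have := hF.projective S.mem₀
  have := hF.projective S.mem₁
  have := hF.projective S.mem₂
  intro e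
  obtain ⟨x, hx⟩ := S.E.exists_extClass_comp_eq e
  exact ⟨x, hx.symm⟩

/-- A representative with zero class extends over F T₂, so `y` factors through `s`, and the
composite of `r` with `s⟦1⟧` vanishes. -/
lemma preTheta_eq_zero (S : Resolution T F K) (hF : IsRestrictedYoneda T F) {Z : C}
    (x : S.R ⟶ F.obj Z) (hx : S.toExt k _ x = 0) : S.preTheta k hF Z x = 0 := by
  have := hF.projective S.mem₀
  have := hF.projective S.mem₁
  have := hF.projective S.mem₂
  obtain ⟨y, rfl⟩ := S.E.exists_of_extClass_comp_eq_zero x hx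
  obtain ⟨y', rfl⟩ := hF.map_surjective S.mem₂ y
  rw [S.preTheta_eq hF _ (S.s ≫ y') (by rw [F.map_comp, ← ℓ_i₂, Category.assoc]),
    Functor.map_comp, ← Category.assoc, S.isDist.zero₃₁, zero_comp]

variable (k) in
lemma exists_theta (S : Resolution T F K) (hF : IsRestrictedYoneda T F) (Z : C) :
    ∃ θ : Ext (F.obj (K⟦(1 : ℤ)⟧)) (F.obj Z) 3 →ₗ[k] (K ⟶ Z⟦(1 : ℤ)⟧),
      ∀ x, θ (S.toExt k _ x) = S.preTheta k hF Z x := by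
  obtain ⟨σ, hσ⟩ := (S.toExt k (F.obj Z)).exists_rightInverse_of_surjective
    (LinearMap.range_eq_top.2 (S.toExt_surjective hF _))
  refine ⟨(S.preTheta k hF Z).comp σ, fun x => ?_⟩
  rw [← sub_eq_zero, LinearMap.comp_apply, ← map_sub]
  refine S.preTheta_eq_zero hF _ ?_
  rw [map_sub, sub_eq_zero]
  exact congr($hσ (S.toExt k _ x))

variable (k) in
/-- The linear map `Ext³(F (K⟦1⟧), F Z) → Hom(K, Z⟦1⟧)` induced by `preTheta`. -/
noncomputable def theta (S : Resolution T F K) (hF : IsRestrictedYoneda T F) (Z : C) :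
    Ext (F.obj (K⟦(1 : ℤ)⟧)) (F.obj Z) 3 →ₗ[k] (K ⟶ Z⟦(1 : ℤ)⟧) :=
  (S.exists_theta k hF Z).choose

lemma theta_extClass_comp (S : Resolution T F K) (hF : IsRestrictedYoneda T F) {Z : C}
    (x : S.R ⟶ F.obj Z) (y : S.T₃ ⟶ Z) (h : F.map y = S.ℓ ≫ x) :
    S.theta k hF Z (S.E.extClass.comp (Ext.mk₀ x) (add_zero 3)) = S.r ≫ y⟦(1 : ℤ)⟧' :=
  ((S.exists_theta k hF Z).choose_spec x).trans (S.preTheta_eq hF x y h)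

lemma exists_theta_eq (S : Resolution T F K) (hF : IsRestrictedYoneda T F) {Z : C}
    (e : Ext (F.obj (K⟦(1 : ℤ)⟧)) (F.obj Z) 3) :
    ∃ (x : S.R ⟶ F.obj Z) (y : S.T₃ ⟶ Z), F.map y = S.ℓ ≫ x ∧
      e = S.E.extClass.comp (Ext.mk₀ x) (add_zero 3) := by
  have := hF.projective S.mem₀
  have := hF.projective S.mem₁
  have := hF.projective S.mem₂
  obtain ⟨x, hx⟩ := S.E.exists_extClass_comp_eq e
  obtain ⟨y, hy⟩ := hF.map_surjective S.mem₃ (S.ℓ ≫ x)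
  exact ⟨x, y, hy, hx⟩

lemma theta_comp_mk₀ (S : Resolution T F K) (hF : IsRestrictedYoneda T F) {Z Z' : C} (g : Z ⟶ Z')
    (e : Ext (F.obj (K⟦(1 : ℤ)⟧)) (F.obj Z) 3) :
    S.theta k hF Z' (e.comp (Ext.mk₀ (F.map g)) (add_zero 3)) =
      S.theta k hF Z e ≫ g⟦(1 : ℤ)⟧' := by
  obtain ⟨x, y, h, rfl⟩ := S.exists_theta_eq hF e
  rw [Ext.comp_assoc (a₂₃ := 0) _ _ _ _ (by lia) (by lia), Ext.mk₀_comp_mk₀,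
    S.theta_extClass_comp hF x y h, S.theta_extClass_comp hF (x ≫ F.map g) (y ≫ g)
      (by rw [F.map_comp, h, Category.assoc]), Functor.map_comp, Category.assoc]

/-- A morphism f : K → K' extends to both approximation triangles, since maps from objects of `T`
lift through right approximations. The resulting chain map computes both sides. -/
lemma theta_mk₀_comp (S : Resolution T F K) (hF : IsRestrictedYoneda T F) {K' : C}
    (S' : Resolution T F K') (f : K ⟶ K') {Z : C} (e : Ext (F.obj (K'⟦(1 : ℤ)⟧)) (F.obj Z) 3) :
    S.theta k hF Z ((Ext.mk₀ (F.map (f⟦(1 : ℤ)⟧'))).comp e (zero_add 3)) =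
      f ≫ S'.theta k hF Z e := by
  obtain ⟨x, y, h, rfl⟩ := S'.exists_theta_eq hF e
  obtain ⟨t₂, ht₂⟩ := S'.isDist.exists_lift_of_mem T S'.mem₃ S.mem₂ (S.c ≫ f)
  obtain ⟨t₃, hs, hr⟩ := S.isDist.map₁ S'.isDist t₂ f ht₂.symm
  obtain ⟨t₀, ht₀⟩ := S'.isDist'.rotate.exists_lift_of_mem T S'.mem₁ S.mem₀ (S.z ≫ f⟦(1 : ℤ)⟧')
  obtain ⟨t₁, hb, hκ⟩ := S.isDist'.rotate.map₁ S'.isDist'.rotate t₀ (f⟦(1 : ℤ)⟧') ht₀.symm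
  have hκ' : S.κ ≫ t₁ = f ≫ S'.κ := by
    apply (shiftFunctor C (1 : ℤ)).map_injective
    rw [Functor.map_comp, Functor.map_comp]
    rwa [Preadditive.neg_comp, Preadditive.comp_neg, neg_inj] at hκ
  obtain ⟨ρ, hρ, hρ'⟩ := S.E.exists_map S'.E (F.map (f⟦(1 : ℤ)⟧')) (F.map t₀) (F.map t₁)
    (F.map t₂) (by rw [S.p₀, S'.p₀, ← F.map_comp, ← F.map_comp, ht₀])
    (by rw [S'.p₁, reassoc_of% S.p₁, ← F.map_comp, ← F.map_comp, hb])
    (by rw [S'.p₂, reassoc_of% S.p₂, ← F.map_comp, ← F.map_comp, reassoc_of% ht₂,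
      Category.assoc, hκ'])
  rw [← Ext.comp_assoc (a₁₂ := 3) _ _ _ (by lia) (by lia) (by lia), ← hρ',
    Ext.comp_assoc (a₂₃ := 0) _ _ _ _ (by lia) (by lia), Ext.mk₀_comp_mk₀,
    S'.theta_extClass_comp hF x y h, S.theta_extClass_comp hF (ρ ≫ x) (t₃ ≫ y), Functor.map_comp,
    reassoc_of% hr]
  have : S.ℓ ≫ ρ = F.map t₃ ≫ S'.ℓ := by
    rw [← cancel_mono S'.E.i₂, Category.assoc, Category.assoc, hρ, ℓ_i₂, reassoc_of% S.ℓ_i₂,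
      ← F.map_comp, ← F.map_comp, hs]
  rw [reassoc_of% this, F.map_comp, h]

end Resolution

end Resolution

/-! ### Nondegeneracy and compatibility with syzygies -/

section

open Abelian

variable {C : Type u} [Category.{v} C] [Preadditive C] [HasZeroObject C] [HasShift C ℤ]
  [∀ n : ℤ, (shiftFunctor C n).Additive] [Pretriangulated C]

/-- The octahedron of T₂ → L → T₁ relates the three cones T₃⟦1⟧, T₀ and K⟦1⟧. As `F` kills T₃⟦1⟧ and
T₂⟦1⟧, it exhibits F(K⟦1⟧) as the syzygy of F(L⟦1⟧) in F T₀. -/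
lemma exists_octahedron [IsTriangulated C] {T₀ T₁ T₂ T₃ L : C} {s : T₃ ⟶ T₂} {c : T₂ ⟶ L}
    {r : L ⟶ T₃⟦(1 : ℤ)⟧} {κ : L ⟶ T₁} {b : T₁ ⟶ T₀} {z : T₀ ⟶ L⟦(1 : ℤ)⟧} (h : IsDist s c r)
    (h' : IsDist κ b z) :
    ∃ (K : C) (κ' : K ⟶ T₂) (q : T₁ ⟶ K⟦(1 : ℤ)⟧) (w : T₃ ⟶ K) (m : K⟦(1 : ℤ)⟧ ⟶ T₀),
      IsDist κ' (c ≫ κ) q ∧ w ≫ κ' = s ∧ q ≫ m = b ∧ m ≫ z = -κ'⟦(1 : ℤ)⟧' ≫ c⟦(1 : ℤ)⟧' ∧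
        IsDist (w⟦(1 : ℤ)⟧') m (z ≫ r⟦(1 : ℤ)⟧') := by
  obtain ⟨K, κ', q, h''⟩ := IsDist.exists₁ (c ≫ κ)
  let o := Triangulated.someOctahedron (rfl : c ≫ κ = c ≫ κ) h.rotate h' h''.rotate
  obtain ⟨w, hw⟩ := (shiftFunctor C (1 : ℤ)).map_surjective o.m₁
  refine ⟨K, κ', q, w, o.m₃, h'', (shiftFunctor C (1 : ℤ)).map_injective ?_, o.comm₃, ?_, ?_⟩
  · have := o.comm₂
    rw [← hw, Preadditive.comp_neg, neg_inj] at this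
    rw [Functor.map_comp, this]
  · rw [← o.comm₄, Preadditive.neg_comp]
  · rw [hw]
    exact o.mem

variable {A : Type u₁} [Category.{v₁} A] [Abelian A]

/-- The morphisms that factor through a projective object. -/
def FactorsThroughProjective {M N : A} (f : M ⟶ N) : Prop :=
  ∃ (P : A) (_ : Projective P) (a : M ⟶ P) (b : P ⟶ N), a ≫ b = f

lemma FactorsThroughProjective.add {M N : A} {f g : M ⟶ N} (hf : FactorsThroughProjective f)
    (hg : FactorsThroughProjective g) : FactorsThroughProjective (f + g) := by
  obtain ⟨P, _, a, b, rfl⟩ := hf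
  obtain ⟨Q, _, c, d, rfl⟩ := hg
  exact ⟨P ⊞ Q, inferInstance, biprod.lift a c, biprod.desc b d, by simp⟩

variable {T : ObjectProperty C} [IsClusterTilting T] {F : C ⥤ A} {K L : C}
  {k : Type w} [Field k] [Linear k C] [Linear k A] [HasExt.{w₁} A]
  [∀ n : ℤ, (shiftFunctor C n).Linear k] [F.Additive] [F.IsHomological] [F.Linear k]

variable (k) in
-- The triangle `h` embeds F(K⟦1⟧) into F U₀, so a map from the third syzygy to F(K⟦1⟧) can be given
-- by a suitable map T₂ → U₀. The two vanishing conditions on `g` are what is needed to construct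
-- it.
lemma Resolution.exists_theta_eq_of_forall (hF : IsRestrictedYoneda T F) (S : Resolution T F L)
    {U₁ U₀ : C} (hU₁ : T U₁) (hU₀ : T U₀) {e : U₁⟦(1 : ℤ)⟧ ⟶ K⟦(1 : ℤ)⟧} {m : K⟦(1 : ℤ)⟧ ⟶ U₀}
    {d : U₀ ⟶ U₁⟦(1 : ℤ)⟧⟦(1 : ℤ)⟧} (h : IsDist e m d) (g : L ⟶ K⟦(1 : ℤ)⟧⟦(1 : ℤ)⟧)
    (hg : ∀ ⦃U : C⦄ (_ : T U) (u : U ⟶ L), u ≫ g = 0)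
    (hg' : ∀ ⦃V : C⦄ (_ : T (V⟦(1 : ℤ)⟧)) (v : V ⟶ L), v ≫ g = 0) :
    ∃ ξ : Ext (F.obj (L⟦(1 : ℤ)⟧)) (F.obj (K⟦(1 : ℤ)⟧)) 3, S.theta k hF _ ξ = g := by
  -- The triangle T₀⟦-1⟧ → L → T₁ → T₀: as `g` kills maps from T₀⟦-1⟧, it factors through κ.
  obtain ⟨a, ha⟩ : ∃ a : S.T₁ ⟶ K⟦(1 : ℤ)⟧⟦(1 : ℤ)⟧, S.κ ≫ a = g := by
    let ε := shiftNegShift S.T₀ (1 : ℤ)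
    obtain ⟨v, hv⟩ := (shiftFunctor C (1 : ℤ)).map_surjective (ε.hom ≫ S.z)
    have hv' := hg' (T.prop_of_iso ε.symm S.mem₀) v
    obtain ⟨a, ha⟩ := S.isDist'.rotate.desc₁ (g⟦(1 : ℤ)⟧') (by
      rw [← cancel_epi ε.hom, ← Category.assoc, ← hv, ← Functor.map_comp, hv', Functor.map_zero,
        comp_zero])
    obtain ⟨a', rfl⟩ := (shiftFunctor C (1 : ℤ)).map_surjective a
    refine ⟨-a', (shiftFunctor C (1 : ℤ)).map_injective ?_⟩
    rw [← ha, Functor.map_comp, Functor.map_neg, Preadditive.comp_neg, Preadditive.neg_comp]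
  obtain ⟨b, hb⟩ := h.rotate.lift₃ a (IsClusterTilting.ext_eq_zero S.mem₁ hU₀ _)
  -- Here the other condition enters: `g` kills `c`, whose source is in `T`.
  obtain ⟨y, hy⟩ := h.rotate.lift₂ (S.c ≫ S.κ ≫ b) (by
    rw [Category.assoc, Category.assoc, hb, ha, hg S.mem₂])
  obtain ⟨x, hx, hx'⟩ := S.isDist.map₁ h.rotate y (S.κ ≫ b) hy.symm
  have := h.mono F ((hF.isZero_map_shift hU₁).eq_of_src _ _)
  have : Mono (ShortComplex.mk (F.map m) (F.map d) h.rotate.map_zero).f := this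
  obtain ⟨x', hx''⟩ : ∃ x' : S.R ⟶ F.obj (K⟦(1 : ℤ)⟧), x' ≫ F.map m = S.E.i₂ ≫ F.map y := by
    refine ⟨(h.rotate.exact F).lift (S.E.i₂ ≫ F.map y) ?_, (h.rotate.exact F).lift_f _ _⟩
    dsimp only
    rw [Category.assoc, ← F.map_comp, hy, ← Category.assoc S.c, F.map_comp, ← S.p₂,
      Category.assoc, reassoc_of% S.E.zero₂, zero_comp]
  refine ⟨S.E.extClass.comp (Ext.mk₀ x') (add_zero 3), ?_⟩
  rw [S.theta_extClass_comp hF x' x, hx', Category.assoc, hb, ha]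
  rw [← cancel_mono (F.map m), Category.assoc, hx'', reassoc_of% S.ℓ_i₂, ← F.map_comp,
    ← F.map_comp, hx]

/-- Otherwise some linear form vanishes on the morphisms that become projectively trivial but not on
`f`. Duality represents it by a morphism `g`, which kills maps from T and from T⟦-1⟧, since F(·⟦1⟧)
makes these objects zero and projective respectively. So `g` comes from some ξ, whose trace against
`f` is nonzero. -/
lemma Resolution.factorsThroughProjective (hF : IsRestrictedYoneda T F)
    (cy : CalabiYauStructure k C 2) (S : Resolution T F K) (S' : Resolution T F L)
    {U₁ U₀ : C} (hU₁ : T U₁) (hU₀ : T U₀) {e : U₁⟦(1 : ℤ)⟧ ⟶ K⟦(1 : ℤ)⟧} {m : K⟦(1 : ℤ)⟧ ⟶ U₀}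
    {d : U₀ ⟶ U₁⟦(1 : ℤ)⟧⟦(1 : ℤ)⟧} (h : IsDist e m d) (f : K ⟶ L)
    (hf : ∀ ξ : Ext (F.obj (L⟦(1 : ℤ)⟧)) (F.obj (K⟦(1 : ℤ)⟧)) 3,
      cy.form K (S.theta k hF _ ((Ext.mk₀ (F.map (f⟦(1 : ℤ)⟧'))).comp ξ (zero_add 3))) = 0) :
    FactorsThroughProjective (F.map (f⟦(1 : ℤ)⟧')) := by
  let N : Submodule k (K ⟶ L) :=
    { carrier := {f | FactorsThroughProjective (F.map (f⟦(1 : ℤ)⟧'))}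
      add_mem' := fun {f g} hf hg => by
        change FactorsThroughProjective (F.map ((f + g)⟦(1 : ℤ)⟧'))
        rw [Functor.map_add, Functor.map_add]
        exact hf.add hg
      zero_mem' := ⟨0, inferInstance, 0, 0, by simp⟩
      smul_mem' := fun a f ⟨P, hP, x, y, hxy⟩ => ⟨P, hP, x, a • y, by
        rw [Functor.map_smul, Functor.map_smul, Linear.comp_smul, hxy]⟩ }
  by_contra hN
  obtain ⟨θ, hθ, hθ'⟩ := N.exists_dual_map_eq_bot_of_notMem (x := f) hN inferInstance
  have hθN (x : K ⟶ L) (hx : FactorsThroughProjective (F.map (x⟦(1 : ℤ)⟧'))) : θ x = 0 := by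
    have := Submodule.mem_map_of_mem (f := θ) (show x ∈ N from hx)
    rwa [hθ', Submodule.mem_bot] at this
  obtain ⟨g, hg⟩ := cy.exists_form_comp_eq θ
  obtain ⟨ξ, rfl⟩ := S'.exists_theta_eq_of_forall k hF hU₁ hU₀ h g
    (fun U hU x => cy.eq_zero_of_form_comp' _ fun x' => by
      rw [← Category.assoc, hg]
      refine hθN _ ⟨0, inferInstance, 0, 0, ?_⟩
      rw [Functor.map_comp, F.map_comp, (hF.isZero_map_shift hU).eq_of_tgt (F.map _) 0,
        zero_comp, zero_comp])
    (fun V hV x => cy.eq_zero_of_form_comp' _ fun x' => by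
      rw [← Category.assoc, hg]
      exact hθN _ ⟨_, hF.projective hV, F.map (x'⟦(1 : ℤ)⟧'), F.map (x⟦(1 : ℤ)⟧'), by
        rw [← F.map_comp, ← Functor.map_comp]⟩)
  have := hf ξ
  rw [S.theta_mk₀_comp hF S', hg] at this
  exact hθ this

/-- With K from the octahedron, the resolution of F(K⟦1⟧) can be chosen to continue that of F(L⟦1⟧).
Both products are then computed from one morphism v : K → L⟦1⟧, and both traces reduce to the form
of K on v ≫ (r ≫ w⟦1⟧)⟦1⟧. -/
lemma exists_resolution_syzygy [IsTriangulated C] (hF : IsRestrictedYoneda T F)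
    (cy : CalabiYauStructure k C 2)
    {T₀ T₁ : C} (h₀ : T T₀) (h₁ : T T₁) {κ : L ⟶ T₁} {b : T₁ ⟶ T₀} {z : T₀ ⟶ L⟦(1 : ℤ)⟧}
    (h' : IsDist κ b z) :
    ∃ (K T₃ : C) (_ : T T₃) (e : T₃⟦(1 : ℤ)⟧ ⟶ K⟦(1 : ℤ)⟧) (m : K⟦(1 : ℤ)⟧ ⟶ T₀)
      (d : T₀ ⟶ T₃⟦(1 : ℤ)⟧⟦(1 : ℤ)⟧) (_ : IsDist e m d) (w : F.map m ≫ F.map z = 0)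
      (hS : (ShortComplex.mk (F.map m) (F.map z) w).ShortExact)
      (S : Resolution T F K) (S' : Resolution T F L),
      ∀ h : Ext (F.obj (K⟦(1 : ℤ)⟧)) (F.obj (L⟦(1 : ℤ)⟧)) 2,
        cy.form K (S.theta k hF _ (h.comp hS.extClass (by rfl : 2 + 1 = 3))) =
          cy.form L (S'.theta k hF _ (hS.extClass.comp h (by rfl : 1 + 2 = 3))) := by
  have := hF.full
  obtain ⟨T₃, T₂, h₃, h₂, s, c, r, hL⟩ := exists_isDist T L
  obtain ⟨K, κ', q, w, m, hK, hw, hm, hm', hw'⟩ := exists_octahedron hL h'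
  obtain ⟨V₃, V₂, hV₃, hV₂, s', c', r', hV⟩ := exists_isDist T K
  have hmono : Mono (F.map m) := hw'.mono F ((hF.isZero_map_shift h₃).eq_of_src _ _)
  have hz : Epi (F.map z) := hF.epi_map h'.rotate h₁
  have hq : Epi (F.map q) := hF.epi_map hK.rotate h₂
  have hc' : Epi (F.map c') := hF.epi_map hV hV₃
  have hr : Mono (F.map (r⟦(1 : ℤ)⟧')) := by
    have : Mono (F.map (-r⟦(1 : ℤ)⟧')) :=
      hL.rotate.rotate.rotate.rotate.mono F ((hF.isZero_map_shift h₂).eq_of_src _ _)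
    rw [F.map_neg] at this
    rw [← neg_neg (F.map (r⟦(1 : ℤ)⟧'))]
    infer_instance
  have w₀ : F.map m ≫ F.map z = 0 := by
    rw [← F.map_comp, hm', F.map_neg, F.map_comp,
      (hF.isZero_map_shift h₂).eq_of_tgt (F.map _) 0, zero_comp, neg_zero]
  have hS₀ : (ShortComplex.mk (F.map m) (F.map z) w₀).ShortExact :=
    { exact := (ShortComplex.exact_iff_of_epi_of_isIso_of_mono
        (S₁ := ShortComplex.mk (F.map m) (F.map z) w₀)
        (S₂ := ShortComplex.mk (F.map m) (F.map (z ≫ r⟦(1 : ℤ)⟧')) hw'.rotate.map_zero)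
        { τ₁ := 𝟙 _, τ₂ := 𝟙 _, τ₃ := F.map (r⟦(1 : ℤ)⟧') }).2 (hw'.rotate.exact F) }
  obtain ⟨N, i₁, w₁, hS₁⟩ : ∃ (N : A) (i₁ : N ⟶ F.obj T₁) (w₁ : i₁ ≫ F.map q = 0),
    (ShortComplex.mk i₁ (F.map q) w₁).ShortExact := ⟨_, _, _, shortExact_kernel (F.map q)⟩
  have hi₁ : Mono i₁ := hS₁.mono_f
  obtain ⟨p₂, hp₂⟩ := shortExact_lift hS₁ (F.map (c ≫ κ)) hK.rotate.map_zero
  dsimp only at p₂ hp₂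
  have hp₂e : Epi p₂ := by
    rw [Preadditive.epi_iff_cancel_zero]
    intro Z x hx
    obtain ⟨W, π, hπ, y, hy⟩ := (hK.rotate.exact F).exact_up_to_refinements i₁ w₁
    dsimp only at y hy
    have : π = y ≫ p₂ := by rw [← cancel_mono i₁, hy, Category.assoc, hp₂]
    rw [← cancel_epi π, this, Category.assoc, hx, comp_zero, comp_zero]
  have hp₂κ : F.map κ' ≫ p₂ = 0 := by
    rw [← cancel_mono i₁, Category.assoc, hp₂, hK.map_zero, zero_comp]
  obtain ⟨R, i₂, w₂, hS₂⟩ : ∃ (R : A) (i₂ : R ⟶ F.obj T₂) (w₂ : i₂ ≫ p₂ = 0),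
    (ShortComplex.mk i₂ p₂ w₂).ShortExact := ⟨_, _, _, shortExact_kernel p₂⟩
  have hi₂ : Mono i₂ := hS₂.mono_f
  obtain ⟨π, hπ⟩ := shortExact_lift hS₂ (F.map κ') hp₂κ
  dsimp only at π hπ
  have hπe : Epi π := by
    rw [Preadditive.epi_iff_cancel_zero]
    intro Z x hx
    obtain ⟨W, π', hπ', y, hy⟩ := (hK.exact F).exact_up_to_refinements i₂
      (show i₂ ≫ F.map (c ≫ κ) = 0 by rw [← hp₂, reassoc_of% w₂, zero_comp])
    dsimp only at y hy
    have : π' = y ≫ π := by rw [← cancel_mono i₂, hy, Category.assoc, hπ]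
    rw [← cancel_epi π', this, Category.assoc, hx, comp_zero, comp_zero]
  obtain ⟨R', i₃, w₃, hS₃⟩ : ∃ (R' : A) (i₃ : R' ⟶ F.obj V₂) (w₃ : i₃ ≫ F.map c' ≫ π = 0),
    (ShortComplex.mk i₃ (F.map c' ≫ π) w₃).ShortExact :=
      ⟨_, _, _, shortExact_kernel (F.map c' ≫ π)⟩
  let EL : YonedaTriple (F.obj (L⟦(1 : ℤ)⟧)) (F.obj T₀) (F.obj T₁) (F.obj T₂) R :=
    ⟨_, N, F.map m, F.map z, i₁, F.map q, i₂, p₂, w₀, w₁, w₂, hS₀, hS₁, hS₂⟩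
  -- The first two short exact sequences of `EK` are the last two of `EL`.
  let EK : YonedaTriple (F.obj (K⟦(1 : ℤ)⟧)) (F.obj T₁) (F.obj T₂) (F.obj V₂) R' :=
    ⟨N, R, i₁, F.map q, i₂, p₂, i₃, F.map c' ≫ π, w₁, w₂, w₃, hS₁, hS₂, hS₃⟩
  let SL : Resolution T F L := ⟨T₀, T₁, T₂, T₃, h₀, h₁, h₂, h₃, s, c, r, κ, b, z, hL, h', R, EL,
    rfl, by rw [← F.map_comp, hm], hp₂⟩
  let SK : Resolution T F K := ⟨T₁, T₂, V₂, V₃, h₁, h₂, hV₂, hV₃, s', c', r', κ', c ≫ κ, q, hV, hK,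
    R', EK, rfl, hp₂, by rw [F.map_comp, ← hπ, Category.assoc]⟩
  refine ⟨K, T₃, h₃, _, m, _, hw', w₀, hS₀, SK, SL, fun h => ?_⟩
  have := hF.projective h₁
  have := hF.projective h₂
  obtain ⟨x, rfl⟩ : ∃ x : R ⟶ F.obj (L⟦(1 : ℤ)⟧),
    h = EL.classTail.comp (Ext.mk₀ x) (add_zero 2) := EL.exists_classTail_comp_eq h
  obtain ⟨v, hv⟩ := F.map_surjective (π ≫ x)
  have hL' : SL.theta k hF _ (hS₀.extClass.comp (EL.classTail.comp (Ext.mk₀ x) (add_zero 2))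
      (by rfl : 1 + 2 = 3)) = r ≫ (w ≫ v)⟦(1 : ℤ)⟧' := by
    refine (congrArg _ (EL.extClass_comp (Ext.mk₀ x) (add_zero 3)).symm).trans
      (SL.theta_extClass_comp hF x (w ≫ v) ?_)
    have : SL.ℓ = F.map w ≫ π := by
      rw [← cancel_mono SL.E.i₂, SL.ℓ_i₂, Category.assoc]
      change F.map s = F.map w ≫ π ≫ i₂
      rw [hπ, ← F.map_comp, hw]
    rw [this, F.map_comp, hv, Category.assoc]
  obtain ⟨y, hy⟩ := h'.rotate.exists_lift_of_mem T h₁ hV₂ (c' ≫ v)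
  obtain ⟨x', hx', hx''⟩ := YonedaTriple.exists_shortExact_map hS₃ hS₀ (F.map y) x (by
    dsimp only
    rw [← F.map_comp, hy, F.map_comp, hv, Category.assoc])
  dsimp only at x' hx' hx''
  obtain ⟨u, hu, hu'⟩ := hV.map₁ hw'.rotate y (v ≫ r⟦(1 : ℤ)⟧') (by rw [reassoc_of% hy])
  -- By `hu'` this equals -v ≫ (r ≫ w⟦1⟧)⟦1⟧; the minus sign is that of the rotated triangle.
  have hK' : SK.theta k hF _ ((EL.classTail.comp (Ext.mk₀ x) (add_zero 2)).comp hS₀.extClass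
      (by rfl : 2 + 1 = 3)) = r' ≫ u⟦(1 : ℤ)⟧' := by
    refine Eq.trans (congrArg _ ?_) (SK.theta_extClass_comp hF x' u ?_)
    · rw [Ext.comp_assoc (a₂₃ := 1) _ _ _ _ (by lia) (by lia), ← hx'']
      exact (EL.classTail_comp (hS₃.extClass.comp (Ext.mk₀ x') (add_zero 1)) rfl).trans
        ((EK.extClass_comp (Ext.mk₀ x') (add_zero 3)).trans
          (congrArg (fun e => hS₁.extClass.comp e (by rfl : 1 + 2 = 3))
            (EK.classTail_comp (Ext.mk₀ x') rfl))).symm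
    · rw [← cancel_mono (F.map m), ← F.map_comp, ← hu, Category.assoc, hx', F.map_comp]
      have := congr($(SK.ℓ_i₂) ≫ F.map y)
      rw [Category.assoc] at this
      exact this.symm
  -- Symmetry moves the other trace to K⟦1⟧, and `form_shift` brings it back to K with the sign that
  -- cancels the previous one.
  have h₄ := (cy.form_comp_map (r ≫ w⟦(1 : ℤ)⟧') (v⟦(1 : ℤ)⟧')).symm
  have h₅ := cy.form_shift (v ≫ (r ≫ w⟦(1 : ℤ)⟧')⟦(1 : ℤ)⟧')
  rw [Functor.map_comp] at h₅
  rw [hL', hK', hu', Preadditive.comp_neg, map_neg, Functor.map_comp, ← Category.assoc r, h₄, h₅,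
    Functor.map_comp, Category.assoc]

end

/-! ### Trace forms on third self-extensions -/

section ExtTrace

open Abelian

section

variable {A : Type u₁} [Category.{v₁} A] [Abelian A] [HasExt.{w₁} A]

lemma mk₀_comp_assoc {X Y Z W : A} {a b c : ℕ} (f : X ⟶ Y) (e : Ext Y Z a) (e' : Ext Z W b)
    (h : a + b = c) :
    ((Ext.mk₀ f).comp e (zero_add a)).comp e' h =
      (Ext.mk₀ f).comp (e.comp e' h) (zero_add c) :=
  Ext.comp_assoc _ _ _ _ _ (by lia)

variable (k : Type w) [Field k] [Linear k A]

variable (A) in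
/-- A family of trace forms on `Ext³(M, M)` which is invariant in degrees zero and one, and
whose radical in degree zero consists of morphisms factoring through projectives. -/
structure ExtTrace where
  trace (M : A) : Ext M M 3 →ₗ[k] k
  trace_mk₀_comp {M N : A} (f : M ⟶ N) (ξ : Ext N M 3) :
    trace M ((Ext.mk₀ f).comp ξ (zero_add 3)) = trace N (ξ.comp (Ext.mk₀ f) (add_zero 3))
  exists_syzygy (M : A) : ∃ (N P : A) (_ : Projective P) (i : N ⟶ P) (p : P ⟶ M) (w : i ≫ p = 0)
    (hS : (ShortComplex.mk i p w).ShortExact), ∀ h : Ext N M 2,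
      trace N (h.comp hS.extClass (by rfl : 2 + 1 = 3)) =
        trace M (hS.extClass.comp h (by rfl : 1 + 2 = 3))
  factorsThroughProjective {L N : A} (hL : IsTorsionless A L) (f : L ⟶ N)
    (hf : ∀ ξ : Ext N L 3, trace L ((Ext.mk₀ f).comp ξ (zero_add 3)) = 0) :
    FactorsThroughProjective f

end

variable {C : Type u} [Category.{v} C] [Preadditive C] [HasZeroObject C] [HasShift C ℤ]
  [∀ n : ℤ, (shiftFunctor C n).Additive] [Pretriangulated C]
  {A : Type u₁} [Category.{v₁} A] [Abelian A]
  {T : ObjectProperty C} [IsClusterTilting T] {F : C ⥤ A} {K L : C}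
  {k : Type w} [Field k] [Linear k C] [Linear k A] [HasExt.{w₁} A]
  [∀ n : ℤ, (shiftFunctor C n).Linear k] [F.Additive] [F.IsHomological] [F.Linear k]

namespace Resolution

/-- The trace form on `Ext³(M, M)` computed by means of a resolution of `M ≅ F (K⟦1⟧)`. -/
noncomputable def trace (hF : IsRestrictedYoneda T F) (cy : CalabiYauStructure k C 2)
    (S : Resolution T F K) {M : A} (e : F.obj (K⟦(1 : ℤ)⟧) ≅ M) : Ext M M 3 →ₗ[k] k :=
  ((cy.form K).comp (S.theta k hF _)).comp
    (((Ext.mk₀ e.hom).precompOfLinear k _ (zero_add 3)).comp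
      ((Ext.mk₀ e.inv).postcompOfLinear k _ (add_zero 3)))

lemma trace_eq (hF : IsRestrictedYoneda T F) (cy : CalabiYauStructure k C 2)
    (S : Resolution T F K) {M : A} (e : F.obj (K⟦(1 : ℤ)⟧) ≅ M) (ξ : Ext M M 3) :
    S.trace hF cy e ξ = cy.form K (S.theta k hF _
      ((Ext.mk₀ e.hom).comp (ξ.comp (Ext.mk₀ e.inv) (add_zero 3)) (zero_add 3))) := rfl

lemma trace_mk₀_comp (hF : IsRestrictedYoneda T F) (cy : CalabiYauStructure k C 2)
    (S : Resolution T F K) (S' : Resolution T F L) {M N : A} (e : F.obj (K⟦(1 : ℤ)⟧) ≅ M)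
    (e' : F.obj (L⟦(1 : ℤ)⟧) ≅ N) (φ : M ⟶ N) (ξ : Ext N M 3) :
    S.trace hF cy e ((Ext.mk₀ φ).comp ξ (zero_add 3)) =
      S'.trace hF cy e' (ξ.comp (Ext.mk₀ φ) (add_zero 3)) := by
  have := hF.full
  obtain ⟨f, hf⟩ := F.map_surjective (e.hom ≫ φ ≫ e'.inv)
  obtain ⟨f, rfl⟩ := (shiftFunctor C (1 : ℤ)).map_surjective f
  let ξ' : Ext (F.obj (L⟦(1 : ℤ)⟧)) (F.obj (K⟦(1 : ℤ)⟧)) 3 :=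
    (Ext.mk₀ e'.hom).comp (ξ.comp (Ext.mk₀ e.inv) (add_zero 3)) (zero_add 3)
  have h₁ := S.theta_mk₀_comp (k := k) hF S' f ξ'
  have h₂ := S'.theta_comp_mk₀ (k := k) hF (f⟦(1 : ℤ)⟧') ξ'
  rw [hf] at h₁ h₂
  rw [trace_eq, trace_eq]
  have e₁ : (Ext.mk₀ (e.hom ≫ φ ≫ e'.inv)).comp ξ' (zero_add 3) =
      (Ext.mk₀ e.hom).comp (((Ext.mk₀ φ).comp ξ (zero_add 3)).comp (Ext.mk₀ e.inv) (add_zero 3))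
        (zero_add 3) := by
    simp [ξ']
  have e₂ : ξ'.comp (Ext.mk₀ (e.hom ≫ φ ≫ e'.inv)) (add_zero 3) =
      (Ext.mk₀ e'.hom).comp ((ξ.comp (Ext.mk₀ φ) (add_zero 3)).comp (Ext.mk₀ e'.inv) (add_zero 3))
        (zero_add 3) := by
    simp [ξ']
  rw [← e₁, ← e₂, h₁, h₂, cy.form_comp_map]

/-- Symmetry was proved for two unrelated resolutions; applied to the identity it gives independence
of all choices. -/
lemma trace_eq_trace (hF : IsRestrictedYoneda T F) (cy : CalabiYauStructure k C 2)
    (S : Resolution T F K) (S' : Resolution T F L) {M : A} (e : F.obj (K⟦(1 : ℤ)⟧) ≅ M)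
    (e' : F.obj (L⟦(1 : ℤ)⟧) ≅ M) (ξ : Ext M M 3) :
    S.trace hF cy e ξ = S'.trace hF cy e' ξ := by
  simpa using S.trace_mk₀_comp hF cy S' e e' (𝟙 M) ξ

end Resolution

namespace IsRestrictedYoneda

variable [F.EssSurj]

variable (F) in
/-- The desuspension of a preimage of `M` under `F`. -/
noncomputable def preimage (M : A) : C := (F.objPreimage M)⟦(-1 : ℤ)⟧

variable (F) in
/-- The isomorphism between the image of the suspension of `preimage F M` and `M`. -/
noncomputable def preimageIso (M : A) : F.obj ((preimage F M)⟦(1 : ℤ)⟧) ≅ M :=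
  F.mapIso (shiftNegShift _ (1 : ℤ)) ≪≫ F.objObjPreimageIso M

/-- A choice of resolution for every object of `A`. -/
noncomputable def resolution (hF : IsRestrictedYoneda T F) (M : A) :
    Resolution T F (preimage F M) := (hF.nonempty_resolution _).some

/-- After enlarging P to some F T₀, lift the cokernel projection to z : T₀ → K⟦1⟧. It is a right
approximation because F z is epi, so its fibre lies in `T`. This puts a torsionless object in the
position of a syzygy. -/
lemma exists_isDist_of_mono (hF : IsRestrictedYoneda T F) {L P : A} [Projective P] (i : L ⟶ P)
    [Mono i] : ∃ (K T₁ T₀ : C) (_ : T T₁) (_ : T T₀) (κ : K ⟶ T₁) (b : T₁ ⟶ T₀)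
      (z : T₀ ⟶ K⟦(1 : ℤ)⟧) (_ : IsDist κ b z) (j : L ⟶ F.obj T₀) (w : j ≫ F.map z = 0),
      (ShortComplex.mk j (F.map z) w).ShortExact := by
  have := hF.full
  obtain ⟨T₀, h₀, p, hp⟩ := hF.exists_epi P
  let j := i ≫ Projective.factorThru (𝟙 P) p
  have : Mono j := by
    have : Mono (Projective.factorThru (𝟙 P) p) := mono_of_mono_fac (Projective.factorThru_comp _ _)
    exact mono_comp _ _
  let e := preimageIso F (cokernel j)
  obtain ⟨z, hz⟩ := F.map_surjective (cokernel.π j ≫ e.inv)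
  have hze : Epi (F.map z) := by rw [hz]; infer_instance
  obtain ⟨T₁, h₁, b, c, h⟩ := exists_isDist_of_mem T h₀ z (fun U hU g => by
    have := hF.projective hU
    obtain ⟨x, hx⟩ := hF.map_surjective hU (Projective.factorThru (F.map g) (F.map z))
    exact ⟨x, hF.map_injective hU (by rw [F.map_comp, hx, Projective.factorThru_comp])⟩)
  obtain ⟨κ, hκ⟩ := (shiftFunctor C (1 : ℤ)).map_surjective (-c)
  have w : j ≫ F.map z = 0 := by rw [hz, cokernel.condition_assoc, zero_comp]
  refine ⟨_, T₁, T₀, h₁, h₀, κ, b, z, IsDist.of_rotate (by rwa [hκ, neg_neg]), j, w, ?_⟩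
  exact ShortComplex.shortExact_of_iso
    (ShortComplex.isoMk (S₁ := ShortComplex.mk j (cokernel.π j) (cokernel.condition j))
      (S₂ := ShortComplex.mk j (F.map z) w) (Iso.refl _) (Iso.refl _) e.symm
      (by simp) (by simp [hz]))
    (shortExact_cokernel j)

/-- The trace forms on `Ext³` defined by a Calabi-Yau structure of dimension two. -/
noncomputable def extTrace [IsTriangulated C] (hF : IsRestrictedYoneda T F)
    (cy : CalabiYauStructure k C 2) : ExtTrace A k where
  trace M := (hF.resolution M).trace hF cy (preimageIso F M)
  trace_mk₀_comp f ξ := Resolution.trace_mk₀_comp hF cy _ _ _ _ f ξ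
  exists_syzygy M := by
    obtain ⟨T₁, T₀, h₁, h₀, κ, b, z, h⟩ := exists_isDist_shift T (preimage F M)
    obtain ⟨K, T₃, h₃, e, m, d, hd, w, hS, S, S', H⟩ :=
      exists_resolution_syzygy hF cy h₀ h₁ h
    let ε := preimageIso F M
    have w' : F.map m ≫ F.map z ≫ ε.hom = 0 := by rw [reassoc_of% w, zero_comp]
    have hS' : (ShortComplex.mk (F.map m) (F.map z ≫ ε.hom) w').ShortExact :=
      ShortComplex.shortExact_of_iso
        (ShortComplex.isoMk (S₁ := ShortComplex.mk (F.map m) (F.map z) w)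
          (S₂ := ShortComplex.mk (F.map m) (F.map z ≫ ε.hom) w') (Iso.refl _) (Iso.refl _) ε
          (by simp) (by simp)) hS
    refine ⟨_, _, hF.projective h₀, _, _, w', hS', fun x => ?_⟩
    rw [(hF.resolution _).trace_eq_trace hF cy S _ (Iso.refl _),
      (hF.resolution _).trace_eq_trace hF cy S' _ ε, Resolution.trace_eq, Resolution.trace_eq]
    have key : (Ext.mk₀ ε.hom).comp hS'.extClass (zero_add 1) = hS.extClass := by
      have := YonedaTriple.extClass_naturality hS hS' (𝟙 _) (𝟙 _) ε.hom (by simp) (by simp)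
      rw [← this]
      exact Ext.comp_mk₀_id _
    have H' := H (x.comp (Ext.mk₀ ε.inv) (add_zero 2))
    rw [← key] at H'
    have e₁ : (Ext.mk₀ (Iso.refl (F.obj (K⟦(1 : ℤ)⟧))).hom).comp
        ((x.comp hS'.extClass (by rfl : 2 + 1 = 3)).comp
          (Ext.mk₀ (Iso.refl (F.obj (K⟦(1 : ℤ)⟧))).inv) (add_zero 3)) (zero_add 3) =
        (x.comp (Ext.mk₀ ε.inv) (add_zero 2)).comp
          ((Ext.mk₀ ε.hom).comp hS'.extClass (zero_add 1)) (by rfl : 2 + 1 = 3) := by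
      simp
    have e₂ : (Ext.mk₀ ε.hom).comp ((hS'.extClass.comp x (by rfl : 1 + 2 = 3)).comp
        (Ext.mk₀ ε.inv) (add_zero 3)) (zero_add 3) =
        ((Ext.mk₀ ε.hom).comp hS'.extClass (zero_add 1)).comp
          (x.comp (Ext.mk₀ ε.inv) (add_zero 2)) (by rfl : 1 + 2 = 3) := by
      rw [mk₀_comp_assoc, Ext.comp_assoc_of_third_deg_zero]
    exact (congrArg (fun y => cy.form K (S.theta k hF _ y)) e₁).trans
      (H'.trans (congrArg (fun y => cy.form _ (S'.theta k hF _ y)) e₂).symm)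
  factorsThroughProjective {L N} hL f hf := by
    have := hF.full
    obtain ⟨P, _, i, _⟩ := hL
    obtain ⟨L', T₁, T₀, h₁, h₀, κ, b, z, h, j, w', hj⟩ := hF.exists_isDist_of_mono i
    obtain ⟨K, T₃, h₃, e, m, d, hd, w, hS, S, S', H⟩ :=
      exists_resolution_syzygy hF cy h₀ h₁ h
    have := hj.mono_f
    have := hS.mono_f
    obtain ⟨α, hα⟩ := shortExact_lift hj (F.map m) w
    obtain ⟨β, hβ⟩ := shortExact_lift hS j w'
    -- Both objects are kernels of F z.
    let ψ : F.obj (K⟦(1 : ℤ)⟧) ≅ L :=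
      { hom := α
        inv := β
        hom_inv_id := by
          rw [← cancel_mono (ShortComplex.mk (F.map m) (F.map z) w).f]
          simp [hα, hβ]
        inv_hom_id := by
          rw [← cancel_mono (ShortComplex.mk j (F.map z) w').f]
          simp [hα, hβ] }
    let ε := preimageIso F N
    obtain ⟨g, hg⟩ := F.map_surjective (ψ.hom ≫ f ≫ ε.inv)
    obtain ⟨g, rfl⟩ := (shiftFunctor C (1 : ℤ)).map_surjective g
    obtain ⟨Q, hQ, a, c, hac⟩ := S.factorsThroughProjective hF cy (hF.resolution N) h₃ h₀ hd g
      (fun ξ => by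
        have := hf ((Ext.mk₀ ε.inv).comp (ξ.comp (Ext.mk₀ ψ.hom) (add_zero 3)) (zero_add 3))
        rw [(hF.resolution _).trace_eq_trace hF cy S _ ψ, Resolution.trace_eq] at this
        rw [hg]
        simpa using this)
    exact ⟨Q, hQ, ψ.inv ≫ a, c ≫ ε.hom, by
      rw [Category.assoc, reassoc_of% hac, hg]; simp⟩

end IsRestrictedYoneda

end ExtTrace

/-- If g, read on N, is the product of x with δ, then its suspension, read on M, is the product of δ
with x. This reduces compatibility of traces with the suspension to the exchange of two factors. -/
lemma shift_conj_eq {D : Type u} [Category.{v} D] [HasShift D ℤ] {U M N : D}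
    (e : U⟦(1 : ℤ)⟧ ≅ M) (δ : M ≅ N⟦(1 : ℤ)⟧) (ε : U ≅ N) (hε : ε.hom⟦(1 : ℤ)⟧' = e.hom ≫ δ.hom)
    (g : U ⟶ U⟦(3 : ℤ)⟧) (x : N ⟶ M⟦(2 : ℤ)⟧)
    (hx : ε.inv ≫ g ≫ ε.hom⟦(3 : ℤ)⟧' =
      x ≫ δ.hom⟦(2 : ℤ)⟧' ≫ (shiftFunctorAdd' D (1 : ℤ) 2 3 rfl).inv.app N) :
    e.inv ≫ (g⟦(1 : ℤ)⟧' ≫ (shiftComm U (1 : ℤ) 3).inv) ≫ e.hom⟦(3 : ℤ)⟧' =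
      δ.hom ≫ x⟦(1 : ℤ)⟧' ≫ (shiftFunctorAdd' D (2 : ℤ) 1 3 rfl).inv.app M := by
  have h₁ : (shiftComm U (1 : ℤ) 3).inv ≫ ε.hom⟦(1 : ℤ)⟧'⟦(3 : ℤ)⟧' =
      ε.hom⟦(3 : ℤ)⟧'⟦(1 : ℤ)⟧' ≫ (shiftComm N (1 : ℤ) 3).inv :=
    ((shiftFunctorComm D (1 : ℤ) 3).inv.naturality ε.hom).symm
  have h₂ : ((shiftFunctorAdd' D (1 : ℤ) 2 3 rfl).inv.app N)⟦(1 : ℤ)⟧' ≫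
      (shiftComm N (1 : ℤ) 3).inv = (shiftFunctorAdd' D (2 : ℤ) 1 3 rfl).inv.app (N⟦(1 : ℤ)⟧) := by
    change _ ≫ (shiftFunctorComm D 1 3).inv.app N = _
    rw [shiftFunctorComm_eq D 1 3 4 rfl]
    have := shiftFunctorAdd'_assoc_inv_app (C := D) (1 : ℤ) 2 1 3 3 4 rfl rfl rfl N
    dsimp only [Iso.trans_inv, Iso.symm_inv, NatTrans.comp_app]
    rw [← Category.assoc]
    refine (congrArg (· ≫ (shiftFunctorAdd' D (1 : ℤ) 3 4 rfl).hom.app N) this).trans ?_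
    rw [Category.assoc, Iso.inv_hom_id_app]
    exact Category.comp_id _
  have h₃ := (shiftFunctorAdd' D (2 : ℤ) 1 3 rfl).inv.naturality δ.hom
  have h₄ := congr($(congrArg (shiftFunctor D (1 : ℤ)).map hx) ≫ (shiftComm N (1 : ℤ) 3).inv)
  simp only [Functor.map_comp, Category.assoc, h₂] at h₄
  rw [← h₁, hε] at h₄
  have h₅ : δ.hom ≫ ε.inv⟦(1 : ℤ)⟧' = e.inv := by
    rw [← cancel_mono (ε.hom⟦(1 : ℤ)⟧'), Category.assoc, ← Functor.map_comp, ε.inv_hom_id,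
      CategoryTheory.Functor.map_id, Category.comp_id, hε, Iso.inv_hom_id_assoc]
  rw [← cancel_mono (δ.hom⟦(3 : ℤ)⟧'), ← h₅]
  simp only [Category.assoc]
  rw [← Functor.map_comp, h₄]
  refine congrArg (fun y => δ.hom ≫ x⟦(1 : ℤ)⟧' ≫ y) h₃

/-! ### Transport of the trace forms to the stable category -/

section StableTrace

open Abelian

variable {A : Type u₁} [Category.{v₁} A] [Abelian A] [HasDerivedCategory.{w₂} A]
  {k : Type w} [Field k] [Linear k A]

instance : (stalk A).Linear k where
  map_smul f r := by
    ext
    exact (DerivedCategory.singleFunctor A 0).map_smul r f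

instance : (stalk A).Additive where
  map_add {X Y f g} := by
    ext
    exact (DerivedCategory.singleFunctor A 0).map_add

variable [HasExt.{w₁} A]

lemma extToStableCM_smul {X Y : A} {n : ℕ} (r : k) (e : Ext X Y n) :
    extToStableCM (r • e) = r • extToStableCM e := by
  rw [Ext.smul_eq_comp_mk₀, extToStableCM_comp, extToStableCM_mk₀, ShiftedHom.comp_mk₀,
    Functor.map_smul, Functor.map_smul, Linear.comp_smul, CategoryTheory.Functor.map_id]
  exact congrArg (r • ·) ((congrArg (extToStableCM e ≫ ·)
    ((shiftFunctor (StableCM A) (n : ℤ)).map_id _)).trans (Category.comp_id _))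

variable (k) in
/-- `extToStableCM` as a linear map. -/
noncomputable def extToStableCMLinear (X Y : A) (n : ℕ) :
    Ext X Y n →ₗ[k] (toStableCM X ⟶ (toStableCM Y)⟦(n : ℤ)⟧) where
  toFun := extToStableCM
  map_add' := extToStableCM_add
  map_smul' := extToStableCM_smul

lemma extToStableCM_mk₀_comp {X Y Z : A} {n : ℕ} (f : X ⟶ Y) (e : Ext Y Z n) :
    extToStableCM ((Ext.mk₀ f).comp e (zero_add n)) =
      (toStableCMFunctor A).map f ≫ extToStableCM e := by
  rw [extToStableCM_comp, extToStableCM_mk₀]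
  exact ShiftedHom.mk₀_comp _ _ _ _

lemma extToStableCM_comp_mk₀ {X Y Z : A} {n : ℕ} (e : Ext X Y n) (f : Y ⟶ Z) :
    extToStableCM (e.comp (Ext.mk₀ f) (add_zero n)) =
      extToStableCM e ≫ ((toStableCMFunctor A).map f)⟦(n : ℤ)⟧' := by
  rw [extToStableCM_comp, extToStableCM_mk₀]
  exact ShiftedHom.comp_mk₀ _ _ _ _

lemma toStableCM_map_eq_zero {X Y : A} {f : X ⟶ Y} (hf : FactorsThroughProjective f) :
    (toStableCMFunctor A).map f = 0 := by
  obtain ⟨P, _, a, b, rfl⟩ := hf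
  rw [Functor.map_comp, (isZero_toStableCM P).eq_of_src ((toStableCMFunctor A).map b) 0]
  exact comp_zero

variable [EnoughProjectives A] [IsGorensteinOne A]

variable (k) in
lemma finite_stableCM_hom [∀ M N : A, Module.Finite k (M ⟶ N)] (U V : StableCM A) :
    Module.Finite k (U ⟶ V) := by
  obtain ⟨M, ⟨e⟩⟩ := isStableObject_of_isGorensteinOne U
  obtain ⟨N, ⟨e'⟩⟩ := isStableObject_of_isGorensteinOne V
  obtain ⟨L, hL, l, hl⟩ := exists_torsionless_cover M
  let ε : U ≅ toStableCM L := e ≪≫ (asIso ((toStableCMFunctor A).map l)).symm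
  exact Module.Finite.of_surjective ((Linear.homCongr k ε.symm e'.symm).toLinearMap.comp
    ((toStableCMFunctor A).mapLinearMap k : (L ⟶ N) →ₗ[k] _))
    ((Linear.homCongr k ε.symm e'.symm).surjective.comp (toStableCM_map_surjective hL N))

variable (k) in
/-- The identification of `Ext³(M, N)` with the morphisms of the stable category. -/
noncomputable def extEquiv (M N : A) :
    Ext M N 3 ≃ₗ[k] (toStableCM M ⟶ (toStableCM N)⟦(3 : ℤ)⟧) :=
  LinearEquiv.ofBijective (extToStableCMLinear k M N 3) (extToStableCM_bijective M N 3 (by lia))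

lemma extEquiv_mk₀_comp {X Y Z : A} (f : X ⟶ Y) (e : Ext Y Z 3) :
    extEquiv k X Z ((Ext.mk₀ f).comp e (zero_add 3)) =
      (toStableCMFunctor A).map f ≫ extEquiv k Y Z e := extToStableCM_mk₀_comp f e

lemma extEquiv_comp_mk₀ {X Y Z : A} (e : Ext X Y 3) (f : Y ⟶ Z) :
    extEquiv k X Z (e.comp (Ext.mk₀ f) (add_zero 3)) =
      extEquiv k X Y e ≫ ((toStableCMFunctor A).map f)⟦(3 : ℤ)⟧' := extToStableCM_comp_mk₀ e f

namespace ExtTrace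

variable (τ : ExtTrace A k)

/-- The trace form on the stable endomorphisms of degree three of an object of `A`. -/
noncomputable def stalkTrace (M : A) : (toStableCM M ⟶ (toStableCM M)⟦(3 : ℤ)⟧) →ₗ[k] k :=
  (τ.trace M).comp (extEquiv k M M).symm.toLinearMap

lemma stalkTrace_extEquiv {M : A} (e : Ext M M 3) :
    τ.stalkTrace M (extEquiv k M M e) = τ.trace M e :=
  congrArg (τ.trace M) ((extEquiv k M M).symm_apply_apply e)

lemma stalkTrace_map_comp {M N : A} (f : M ⟶ N) (g : toStableCM N ⟶ (toStableCM M)⟦(3 : ℤ)⟧) :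
    τ.stalkTrace M ((toStableCMFunctor A).map f ≫ g) =
      τ.stalkTrace N (g ≫ ((toStableCMFunctor A).map f)⟦(3 : ℤ)⟧') := by
  obtain ⟨ξ, rfl⟩ := (extEquiv k N M).surjective g
  have h₁ := τ.stalkTrace_extEquiv ((Ext.mk₀ f).comp ξ (zero_add 3))
  have h₂ := τ.stalkTrace_extEquiv (ξ.comp (Ext.mk₀ f) (add_zero 3))
  rw [extEquiv_mk₀_comp] at h₁
  rw [extEquiv_comp_mk₀] at h₂
  exact h₁.trans ((τ.trace_mk₀_comp f ξ).trans h₂.symm)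

/-- A stable morphism need not come from `A`, but it does after precomposition with a torsionless
cover, which is itself a stably invertible morphism of `A`. -/
lemma stalkTrace_comp {M N : A} (f : toStableCM M ⟶ toStableCM N)
    (g : toStableCM N ⟶ (toStableCM M)⟦(3 : ℤ)⟧) :
    τ.stalkTrace M (f ≫ g) = τ.stalkTrace N (g ≫ f⟦(3 : ℤ)⟧') := by
  obtain ⟨L, hL, l, hl⟩ := exists_torsionless_cover M
  obtain ⟨φ, hφ⟩ := toStableCM_map_surjective hL N ((toStableCMFunctor A).map l ≫ f)
  let ε : toStableCM L ≅ toStableCM M := asIso ((toStableCMFunctor A).map l)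
  have hε (x : toStableCM M ⟶ (toStableCM L)⟦(3 : ℤ)⟧) :
      τ.stalkTrace L (ε.hom ≫ x) = τ.stalkTrace M (x ≫ ε.hom⟦(3 : ℤ)⟧') :=
    τ.stalkTrace_map_comp l x
  have hφ' (x : toStableCM N ⟶ (toStableCM L)⟦(3 : ℤ)⟧) :
      τ.stalkTrace L ((ε.hom ≫ f) ≫ x) = τ.stalkTrace N (x ≫ (ε.hom ≫ f)⟦(3 : ℤ)⟧') := by
    have : (toStableCMFunctor A).map φ = ε.hom ≫ f := hφ
    rw [← this]
    exact τ.stalkTrace_map_comp φ x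
  have h₁ := hε (f ≫ g ≫ ε.inv⟦(3 : ℤ)⟧')
  have h₂ := hφ' (g ≫ ε.inv⟦(3 : ℤ)⟧')
  have h₃ : ε.inv⟦(3 : ℤ)⟧' ≫ ε.hom⟦(3 : ℤ)⟧' = 𝟙 _ := by
    rw [← Functor.map_comp, ε.inv_hom_id, CategoryTheory.Functor.map_id]
  rw [Category.assoc, h₁, Category.assoc, Category.assoc, h₃, Category.comp_id, Category.assoc,
    Functor.map_comp, reassoc_of% h₃] at h₂
  exact h₂

/-- An object of `A` isomorphic to the given object of the stable category. -/
noncomputable def repr (U : StableCM A) : A := (isStableObject_of_isGorensteinOne U).choose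

/-- The isomorphism to the image of the representing object. -/
noncomputable def reprIso (U : StableCM A) : U ≅ toStableCM (repr U) :=
  (isStableObject_of_isGorensteinOne U).choose_spec.some

/-- The trace form on the endomorphisms of degree three of an object of the stable category. -/
noncomputable def stableTrace (U : StableCM A) : (U ⟶ U⟦(3 : ℤ)⟧) →ₗ[k] k :=
  (τ.stalkTrace (repr U)).comp
    ((Linear.leftComp k _ (reprIso U).inv).comp (Linear.rightComp k _ ((reprIso U).hom⟦(3 : ℤ)⟧')))

lemma stableTrace_eq {U : StableCM A} {M : A} (e : U ≅ toStableCM M) (f : U ⟶ U⟦(3 : ℤ)⟧) :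
    τ.stableTrace U f = τ.stalkTrace M (e.inv ≫ f ≫ e.hom⟦(3 : ℤ)⟧') := by
  have h := τ.stalkTrace_comp (e.inv ≫ (reprIso U).hom)
    ((reprIso U).inv ≫ f ≫ e.hom⟦(3 : ℤ)⟧')
  have h₁ : (reprIso U).hom ≫ (reprIso U).inv = 𝟙 U := Iso.hom_inv_id _
  have h₂ : e.hom⟦(3 : ℤ)⟧' ≫ e.inv⟦(3 : ℤ)⟧' = 𝟙 _ := by
    rw [← Functor.map_comp, e.hom_inv_id, CategoryTheory.Functor.map_id]
  rw [Category.assoc, reassoc_of% h₁, Category.assoc, Category.assoc, Functor.map_comp,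
    reassoc_of% h₂] at h
  exact h.symm

lemma stableTrace_toStableCM {M : A} (f : toStableCM M ⟶ (toStableCM M)⟦(3 : ℤ)⟧) :
    τ.stableTrace (toStableCM M) f = τ.stalkTrace M f := by
  rw [τ.stableTrace_eq (Iso.refl _)]
  refine congrArg _ ?_
  refine (Category.id_comp _).trans ?_
  exact (congrArg (f ≫ ·) (CategoryTheory.Functor.map_id _ _)).trans (Category.comp_id _)

lemma stableTrace_comp_map {U V : StableCM A} (f : U ⟶ V) (g : V ⟶ U⟦(3 : ℤ)⟧) :
    τ.stableTrace V (g ≫ f⟦(3 : ℤ)⟧') = τ.stableTrace U (f ≫ g) := by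
  let e := reprIso U
  let e' := reprIso V
  have h := τ.stalkTrace_comp (e.inv ≫ f ≫ e'.hom) (e'.inv ≫ g ≫ e.hom⟦(3 : ℤ)⟧')
  have h₁ : e'.hom ≫ e'.inv = 𝟙 V := Iso.hom_inv_id _
  have h₂ : e.hom⟦(3 : ℤ)⟧' ≫ e.inv⟦(3 : ℤ)⟧' = 𝟙 _ := by
    rw [← Functor.map_comp, e.hom_inv_id, CategoryTheory.Functor.map_id]
  rw [τ.stableTrace_eq e, τ.stableTrace_eq e']
  rw [Category.assoc, Category.assoc, reassoc_of% h₁, Category.assoc, Category.assoc,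
    Functor.map_comp, Functor.map_comp, reassoc_of% h₂] at h
  rw [Category.assoc, Category.assoc, h]

/-- After replacing the source by a torsionless object, the morphism lifts to `A`. In the radical,
the lift factors through a projective and is stably zero. -/
lemma eq_zero_of_stableTrace_comp {U V : StableCM A} (f : U ⟶ V)
    (hf : ∀ g : V ⟶ U⟦(3 : ℤ)⟧, τ.stableTrace U (f ≫ g) = 0) : f = 0 := by
  obtain ⟨M, ⟨e⟩⟩ := isStableObject_of_isGorensteinOne U
  obtain ⟨N, ⟨e'⟩⟩ := isStableObject_of_isGorensteinOne V
  obtain ⟨L, hL, l, hl⟩ := exists_torsionless_cover M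
  let ε : U ≅ toStableCM L := e ≪≫ (asIso ((toStableCMFunctor A).map l)).symm
  obtain ⟨φ, hφ⟩ := toStableCM_map_surjective hL N (ε.inv ≫ f ≫ e'.hom)
  have h₀ := toStableCM_map_eq_zero (τ.factorsThroughProjective hL φ fun ξ => by
    rw [← τ.stalkTrace_extEquiv, extEquiv_mk₀_comp, hφ]
    have := hf (e'.hom ≫ extEquiv k N L ξ ≫ ε.inv⟦(3 : ℤ)⟧')
    have h₂ : ε.inv⟦(3 : ℤ)⟧' ≫ ε.hom⟦(3 : ℤ)⟧' = 𝟙 _ := by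
      rw [← Functor.map_comp, ε.inv_hom_id, CategoryTheory.Functor.map_id]
    rw [τ.stableTrace_eq ε, Category.assoc, Category.assoc, Category.assoc, h₂] at this
    rw [Category.assoc, Category.assoc]
    refine Eq.trans (congrArg (fun y => τ.stalkTrace L (ε.inv ≫ f ≫ e'.hom ≫ y)) ?_) this
    exact (Category.comp_id _).symm)
  rw [h₀] at hφ
  have h₁ := congr(ε.hom ≫ $hφ ≫ e'.inv)
  simpa using h₁.symm

/-- Represent U⟦1⟧ by M and U by a syzygy N of M. Then g corresponds to a product of an Ext² class
with the syzygy class, and its suspension to the product in the other order. -/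
lemma stableTrace_shift {U : StableCM A} (g : U ⟶ U⟦(3 : ℤ)⟧) :
    τ.stableTrace (U⟦(1 : ℤ)⟧) (g⟦(1 : ℤ)⟧' ≫ (shiftComm U (1 : ℤ) 3).inv) = τ.stableTrace U g := by
  obtain ⟨M, ⟨e⟩⟩ := isStableObject_of_isGorensteinOne (U⟦(1 : ℤ)⟧)
  obtain ⟨N, P, _, i, p, w, hS, H⟩ := τ.exists_syzygy M
  have : Projective (ShortComplex.mk i p w).X₂ := by assumption
  have := isIso_extClass_toStableCM hS
  let δ : toStableCM M ≅ (toStableCM N)⟦(1 : ℤ)⟧ :=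
    asIso (C := StableCM A) (X := toStableCM M) (Y := (toStableCM N)⟦(1 : ℤ)⟧)
      (extToStableCM hS.extClass)
  let ε : U ≅ toStableCM N := (shiftFunctor (StableCM A) (1 : ℤ)).preimageIso (e ≪≫ δ)
  have hε : ε.hom⟦(1 : ℤ)⟧' = e.hom ≫ δ.hom := (shiftFunctor (StableCM A) (1 : ℤ)).map_preimage _
  let x : toStableCM N ⟶ (toStableCM M)⟦(2 : ℤ)⟧ := (ε.inv ≫ g ≫ ε.hom⟦(3 : ℤ)⟧') ≫
    (shiftFunctorAdd' (StableCM A) (1 : ℤ) 2 3 rfl).hom.app (toStableCM N) ≫ δ.inv⟦(2 : ℤ)⟧'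
  have hx : ε.inv ≫ g ≫ ε.hom⟦(3 : ℤ)⟧' = x ≫ δ.hom⟦(2 : ℤ)⟧' ≫
      (shiftFunctorAdd' (StableCM A) (1 : ℤ) 2 3 rfl).inv.app (toStableCM N) := by
    have h₂ : δ.inv⟦(2 : ℤ)⟧' ≫ δ.hom⟦(2 : ℤ)⟧' = 𝟙 _ := by
      rw [← Functor.map_comp, δ.inv_hom_id, CategoryTheory.Functor.map_id]
    simp only [x, Category.assoc]
    rw [reassoc_of% h₂, Iso.hom_inv_id_app]
    exact congrArg (fun y => ε.inv ≫ g ≫ y) (Category.comp_id _).symm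
  obtain ⟨h, hh⟩ := (extToStableCM_bijective N M 2 le_rfl).2 x
  have h₁ := τ.stalkTrace_extEquiv (h.comp hS.extClass (by rfl : 2 + 1 = 3))
  have h₂ := τ.stalkTrace_extEquiv (hS.extClass.comp h (by rfl : 1 + 2 = 3))
  have h₃ : extEquiv k N N (h.comp hS.extClass (by rfl : 2 + 1 = 3)) =
      x ≫ δ.hom⟦(2 : ℤ)⟧' ≫
      (shiftFunctorAdd' (StableCM A) (1 : ℤ) 2 3 rfl).inv.app (toStableCM N) := by
    refine (extToStableCM_comp h hS.extClass rfl).trans ?_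
    rw [hh]
    rfl
  have h₄ : extEquiv k M M (hS.extClass.comp h (by rfl : 1 + 2 = 3)) =
      δ.hom ≫ x⟦(1 : ℤ)⟧' ≫
      (shiftFunctorAdd' (StableCM A) (2 : ℤ) 1 3 rfl).inv.app (toStableCM M) := by
    refine (extToStableCM_comp hS.extClass h rfl).trans ?_
    rw [hh]
    rfl
  rw [τ.stableTrace_eq e, τ.stableTrace_eq ε, shift_conj_eq e δ ε hε g x hx, hx, ← h₃, ← h₄, h₁,
    h₂, H]

/-- The trace forms on the stable category. -/
noncomputable def traceFamily : TraceFamily k (StableCM A) 3 where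
  trace := τ.stableTrace
  trace_comp_map := τ.stableTrace_comp_map
  eq_zero_of_trace_comp := τ.eq_zero_of_stableTrace_comp
  trace_shift g := by
    rw [τ.stableTrace_shift, Int.negOnePow_odd 3 (by decide)]
    simp

end ExtTrace

end StableTrace

section

variable {k : Type w} [Field k] {D : Type u} [Category.{v} D] [Preadditive D] [Linear k D]
  [HasShift D ℤ] [∀ n : ℤ, (shiftFunctor D n).Additive] [∀ n : ℤ, (shiftFunctor D n).Linear k]
  [∀ X Y : D, Module.Finite k (X ⟶ Y)]

lemma TraceFamily.pairing_flip_surjective {d : ℤ} (t : TraceFamily k D d) (X Y : D) :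
    Function.Surjective (t.pairing X Y).flip := by
  refine (LinearMap.injective_iff_surjective_of_finrank_eq_finrank ?_).1
    (t.pairing_flip_injective X Y)
  refine le_antisymm (LinearMap.finrank_le_finrank_of_injective (t.pairing_flip_injective X Y)) ?_
  rw [Subspace.dual_finrank_eq]
  refine (LinearMap.finrank_le_finrank_of_injective (t.pairing_injective X Y)).trans ?_
  rw [Subspace.dual_finrank_eq]

end

/-! ### The pairing of first and second extensions -/

namespace ExtTrace

open Abelian

variable {A : Type u₁} [Category.{v₁} A] [Abelian A] {k : Type w} [Field k] [Linear k A]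
  [HasExt.{w₁} A] (τ : ExtTrace A k)

/-- The map from `Ext¹(X, Y)` to the dual of `Ext²(Y, X)` given by the Yoneda product and the
trace form. -/
noncomputable def extPairing (X Y : A) : Ext X Y 1 →ₗ[k] Module.Dual k (Ext Y X 2) :=
  (Ext.bilinearCompOfLinear k X Y X 1 2 3 rfl).compr₂ (τ.trace X)

lemma extPairing_apply {X Y : A} (e : Ext X Y 1) (f : Ext Y X 2) :
    τ.extPairing X Y e f = τ.trace X (e.comp f (by rfl : 1 + 2 = 3)) := rfl

/-- By symmetry the trace moves `i` to the end of the product, where it meets a class in Ext²(Y, I)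
= 0. -/
lemma extPairing_mk₀_comp {X Y I : A} [Injective I] (i : X ⟶ I) (e : Ext I Y 1) :
    τ.extPairing X Y ((Ext.mk₀ i).comp e (zero_add 1)) = 0 := by
  ext f
  rw [extPairing_apply, mk₀_comp_assoc, τ.trace_mk₀_comp, Ext.comp_assoc_of_third_deg_zero,
    Ext.eq_zero_of_injective (f.comp (Ext.mk₀ i) (add_zero 2)), Ext.comp_zero, map_zero]
  rfl

variable [HasDerivedCategory.{w₂} A] [EnoughProjectives A] [IsGorensteinOne A]

lemma traceFamily_trace {X : A} (e : Ext X X 3) :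
    τ.traceFamily.trace (toStableCM X) (extToStableCM e) = τ.trace X e :=
  (τ.stableTrace_toStableCM _).trans (τ.stalkTrace_extEquiv e)

/-- Every morphism `Y⟦1⟧ ⟶ X⟦3⟧` of the stable category comes from `Ext²(Y, X)`. -/
lemma exists_ext_two {X Y : A} (g : (toStableCM Y)⟦(1 : ℤ)⟧ ⟶ (toStableCM X)⟦(3 : ℤ)⟧) :
    ∃ f : Ext Y X 2, ∀ e : Ext X Y 1,
      extToStableCM (e.comp f (by rfl : 1 + 2 = 3)) = extToStableCM e ≫ g := by
  obtain ⟨h, hh⟩ := (shiftFunctor (StableCM A) (1 : ℤ)).map_surjective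
    (g ≫ (shiftFunctorAdd' (StableCM A) (2 : ℤ) 1 3 rfl).hom.app (toStableCM X))
  obtain ⟨f, hf⟩ := (extToStableCM_bijective Y X 2 le_rfl).2 h
  refine ⟨f, fun e => ?_⟩
  refine (extToStableCM_comp e f rfl).trans ?_
  rw [hf]
  refine congrArg (extToStableCM e ≫ ·) ?_
  refine (congrArg (· ≫ (shiftFunctorAdd' (StableCM A) (2 : ℤ) 1 3 rfl).inv.app (toStableCM X))
    hh).trans ?_
  rw [Category.assoc, Iso.hom_inv_id_app]
  exact Category.comp_id _

lemma extToStableCM_eq_zero_of_extPairing {X Y : A} (e : Ext X Y 1)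
    (he : τ.extPairing X Y e = 0) : extToStableCM e = 0 := by
  refine τ.traceFamily.eq_zero_of_trace_comp (X := toStableCM X) (Y := (toStableCM Y)⟦(1 : ℤ)⟧)
    (extToStableCM e) fun g => ?_
  obtain ⟨f, hf⟩ := exists_ext_two g
  rw [← hf, traceFamily_trace]
  exact congr($he f)

/-- A class `e` in the kernel vanishes stably, hence so does its product with the class of 0 → X → I
→ I/X → 0. That product lies in Ext², which embeds into the stable category, so it is zero and `e`
extends to `I`. -/
lemma range_precomp_eq_ker_extPairing {X Y I : A} (i : X ⟶ I) [Mono i] [Injective I] :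
    LinearMap.range ((Ext.mk₀ i).precompOfLinear k Y (zero_add 1)) =
      LinearMap.ker (τ.extPairing X Y) := by
  ext e
  constructor
  · rintro ⟨e, rfl⟩
    exact τ.extPairing_mk₀_comp i e
  · intro he
    have hS := shortExact_cokernel i
    refine Ext.contravariant_sequence_exact₁ hS Y e rfl
      ((extToStableCM_bijective _ _ 2 le_rfl).1 ?_)
    rw [extToStableCM_zero, extToStableCM_comp, τ.extToStableCM_eq_zero_of_extPairing e he]
    exact ShiftedHom.comp_zero (C := StableCM A) (M := ℤ) _ _ _

variable [∀ M N : A, Module.Finite k (M ⟶ N)]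

/-- Since Ext²(Y, X) is the group of stable morphisms Y⟦1⟧ → X⟦3⟧, a linear form on it is
represented by a stable morphism X → Y⟦1⟧, and these all come from Ext¹. -/
lemma extPairing_surjective (X Y : A) : Function.Surjective (τ.extPairing X Y) := by
  intro θ
  have (U V : StableCM A) : Module.Finite k (U ⟶ V) := finite_stableCM_hom k U V
  let E : Ext Y X 2 ≃ₗ[k] (toStableCM Y ⟶ (toStableCM X)⟦(2 : ℤ)⟧) :=
    LinearEquiv.ofBijective (extToStableCMLinear k Y X 2) (extToStableCM_bijective Y X 2 le_rfl)
  let Φ : ((toStableCM Y)⟦(1 : ℤ)⟧ ⟶ (toStableCM X)⟦(3 : ℤ)⟧) →ₗ[k]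
      ((toStableCM Y)⟦(1 : ℤ)⟧ ⟶ (toStableCM X)⟦(2 : ℤ)⟧⟦(1 : ℤ)⟧) :=
    Linear.rightComp k _
      ((shiftFunctorAdd' (StableCM A) (2 : ℤ) 1 3 rfl).hom.app (toStableCM X))
  let Ψ : (toStableCM Y ⟶ (toStableCM X)⟦(2 : ℤ)⟧) ≃ₗ[k]
      ((toStableCM Y)⟦(1 : ℤ)⟧ ⟶ (toStableCM X)⟦(2 : ℤ)⟧⟦(1 : ℤ)⟧) :=
    LinearEquiv.ofBijective ((shiftFunctor (StableCM A) (1 : ℤ)).mapLinearMap k)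
      ⟨(shiftFunctor (StableCM A) (1 : ℤ)).map_injective,
        (shiftFunctor (StableCM A) (1 : ℤ)).map_surjective⟩
  obtain ⟨x, hx⟩ := τ.traceFamily.pairing_flip_surjective (toStableCM X)
    ((toStableCM Y)⟦(1 : ℤ)⟧) (θ.comp (E.symm.toLinearMap.comp (Ψ.symm.toLinearMap.comp Φ)))
  obtain ⟨e, rfl⟩ := extToStableCM_one_surjective X Y x
  refine ⟨e, LinearMap.ext fun f => ?_⟩
  let g : (toStableCM Y)⟦(1 : ℤ)⟧ ⟶ (toStableCM X)⟦(3 : ℤ)⟧ :=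
    Ψ (E f) ≫ (shiftFunctorAdd' (StableCM A) (2 : ℤ) 1 3 rfl).inv.app (toStableCM X)
  have h₁ : Φ g = Ψ (E f) := by
    change (Ψ (E f) ≫ (shiftFunctorAdd' (StableCM A) (2 : ℤ) 1 3 rfl).inv.app (toStableCM X)) ≫
      (shiftFunctorAdd' (StableCM A) (2 : ℤ) 1 3 rfl).hom.app (toStableCM X) = _
    rw [Category.assoc, Iso.inv_hom_id_app]
    exact Category.comp_id _
  have h₂ : extToStableCM (e.comp f (by rfl : 1 + 2 = 3)) = extToStableCM e ≫ g :=
    extToStableCM_comp e f rfl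
  have h₃ : τ.traceFamily.trace (toStableCM X) (extToStableCM e ≫ g) =
      θ (E.symm (Ψ.symm (Φ g))) := congr($hx g)
  rw [h₁, LinearEquiv.symm_apply_apply, LinearEquiv.symm_apply_apply] at h₃
  rw [extPairing_apply, ← traceFamily_trace]
  exact (congrArg _ h₂).trans h₃

/-- The dual of `Ext²(Y, X)` as a cokernel. -/
noncomputable def dualExtEquiv {X Y I : A} (i : X ⟶ I) [Mono i] [Injective I] :
    Module.Dual k (Ext Y X 2) ≃ₗ[k]
      (Ext X Y 1 ⧸ LinearMap.range ((Ext.mk₀ i).precompOfLinear k Y (zero_add 1))) :=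
  ((Submodule.quotEquivOfEq _ _ (τ.range_precomp_eq_ker_extPairing i)).trans
    ((τ.extPairing X Y).quotKerEquivOfSurjective (τ.extPairing_surjective X Y))).symm

end ExtTrace

/-! ### Construction of the functor to finitely presented modules -/

section RestrictedYonedaFunctor

variable {C : Type u} [Category.{v} C] [Preadditive C] (k : Type w) [Field k] [Linear k C]

/-- The restriction of `Hom(-, X)` to `T`, as a functor in `X`. -/
def restrictedHom (T : ObjectProperty C) : C ⥤ T.FullSubcategoryᵒᵖ ⥤ ModuleCat.{v} k :=
  linearYoneda k C ⋙ (Functor.whiskeringLeft _ _ _).obj T.ι.op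

variable {k} {T : ObjectProperty C}

variable (k) in
/-- The map from a representable functor to `Hom(-, X)` given by a morphism to `X`. -/
def ofHom {T₀ : T.FullSubcategory} {X : C} (g : T₀.obj ⟶ X) :
    (linearYoneda k T.FullSubcategory).obj T₀ ⟶ (restrictedHom k T).obj X where
  app U := ModuleCat.ofHom
    { toFun x := (InducedCategory.Hom.hom x : U.unop.obj ⟶ T₀.obj) ≫ g
      map_add' _ _ := Preadditive.add_comp _ _ _ _ _ _
      map_smul' _ _ := Linear.smul_comp _ _ _ _ _ _ }
  naturality U V f := by
    ext x
    exact Category.assoc _ _ _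

lemma restrictedHom_map_app {U X : C} {V : T.FullSubcategoryᵒᵖ} (f : U ⟶ X) (x : V.unop.obj ⟶ U) :
    (((restrictedHom k T).map f).app V).hom x = x ≫ f := rfl

lemma restrictedHom_hom_ext {U : C} (hU : T U) {G : T.FullSubcategoryᵒᵖ ⥤ ModuleCat.{v} k}
    {φ ψ : (restrictedHom k T).obj U ⟶ G}
    (h : (φ.app (.op ⟨U, hU⟩)).hom (𝟙 U) = (ψ.app (.op ⟨U, hU⟩)).hom (𝟙 U)) : φ = ψ := by
  have key (χ : (restrictedHom k T).obj U ⟶ G) (V : T.FullSubcategoryᵒᵖ) (x : V.unop.obj ⟶ U) :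
      (χ.app V).hom x =
        (G.map (Quiver.Hom.op (ObjectProperty.homMk x : V.unop ⟶ ⟨U, hU⟩))).hom
          ((χ.app (.op ⟨U, hU⟩)).hom (𝟙 U)) :=
    (congrArg (χ.app V).hom (Category.comp_id x).symm).trans congr($(χ.naturality
      (Quiver.Hom.op (ObjectProperty.homMk x : V.unop ⟶ (⟨U, hU⟩ : T.FullSubcategory)))).hom (𝟙 U))
  ext V x
  exact (key φ V x).trans ((congrArg _ h).trans (key ψ V x).symm)

lemma restrictedHom_map_bijective {U : C} (hU : T U) (X : C) :
    Function.Bijective ((restrictedHom k T).map : (U ⟶ X) → _) := by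
  constructor
  · intro f g h
    have := congr((NatTrans.app $h (.op ⟨U, hU⟩)).hom (𝟙 U))
    rwa [restrictedHom_map_app, restrictedHom_map_app, Category.id_comp, Category.id_comp] at this
  · intro φ
    exact ⟨(φ.app (.op ⟨U, hU⟩)).hom (𝟙 U), restrictedHom_hom_ext hU (Category.id_comp _)⟩

instance : (restrictedHom k T).Additive where
  map_add {X Y f g} := by
    ext V x
    exact Preadditive.comp_add _ _ _ _ _ _

instance : (restrictedHom k T).Linear k where
  map_smul {X Y} f r := by
    ext V x
    exact Linear.comp_smul _ _ _ _ _ _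

variable [HasZeroObject C] [HasShift C ℤ] [∀ n : ℤ, (shiftFunctor C n).Additive]
  [Pretriangulated C] [IsClusterTilting T]

lemma isFinitelyPresented_restrictedHom (X : C) :
    IsFinitelyPresented k ((restrictedHom k T).obj X) := by
  obtain ⟨T₁, T₀, h₁, h₀, a, b, c, h⟩ := exists_isDist T X
  rw [isFinitelyPresented_iff]
  refine ⟨⟨T₁, h₁⟩, ⟨T₀, h₀⟩, ObjectProperty.homMk a, ofHom k b, fun U y => ?_, fun U x => ?_⟩
  · obtain ⟨x, hx⟩ := h.exists_lift_of_mem T h₁ U.unop.property y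
    exact ⟨ObjectProperty.homMk x, hx⟩
  · constructor
    · intro hx
      obtain ⟨z, hz⟩ := h.lift₁ x.hom hx
      exact ⟨ObjectProperty.homMk z, ObjectProperty.hom_ext _ hz⟩
    · rintro ⟨z, rfl⟩
      change (z.hom ≫ a) ≫ b = 0
      rw [Category.assoc, h.zero₁₂, comp_zero]

variable (k T) in
/-- The functor from `C` to `mod T` which sends `X` to the restriction of `Hom(-, X)` to `T`. -/
def restrictedYoneda : C ⥤ ModT k T :=
  ObjectProperty.lift _ (restrictedHom k T) isFinitelyPresented_restrictedHom

instance : (restrictedYoneda k T).Additive where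
  map_add := ObjectProperty.hom_ext _ (restrictedHom k T).map_add

instance : (restrictedYoneda k T).Linear k where
  map_smul f r := ObjectProperty.hom_ext _ ((restrictedHom k T).map_smul r f)

lemma restrictedYoneda_map_bijective {U : C} (hU : T U) (X : C) :
    Function.Bijective ((restrictedYoneda k T).map : (U ⟶ X) → _) := by
  constructor
  · intro f g h
    exact (restrictedHom_map_bijective hU X).1 congr(($h).hom)
  · intro φ
    obtain ⟨f, hf⟩ := (restrictedHom_map_bijective hU X).2 φ.hom
    exact ⟨f, ObjectProperty.hom_ext _ hf⟩

lemma epi_of_surjective {M N : ModT k T} (f : M ⟶ N)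
    (hf : ∀ U, Function.Surjective (f.hom.app U).hom) : Epi f := by
  have : Epi f.hom := by
    rw [NatTrans.epi_iff_epi_app]
    exact fun U => (ModuleCat.epi_iff_surjective _).2 (hf U)
  exact (ObjectProperty.ι _).epi_of_epi_map this

/-- An epimorphism of `mod T` is pointwise surjective because cokernels in `mod T` are computed in
the functor category. -/
lemma surjective_of_epi {M N : ModT k T} (f : M ⟶ N) [Epi f] (U) :
    Function.Surjective (f.hom.app U).hom := by
  have := isClosedUnderCokernels (k := k) (A := T.FullSubcategory)
  have := containsZero (k := k) (A := T.FullSubcategory)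
  have := ObjectProperty.preservesEpimorphisms_ι_of_isNormalMonoCategory
    (IsFinitelyPresented k (A := T.FullSubcategory))
  have h : Epi ((IsFinitelyPresented k (A := T.FullSubcategory)).ι.map f) := inferInstance
  have h' : Epi f.hom := h
  rw [NatTrans.epi_iff_epi_app] at h'
  exact (ModuleCat.epi_iff_surjective _).1 (h' U)

lemma isIso_of_bijective {M N : ModT k T} (f : M ⟶ N)
    (hf : ∀ U, Function.Bijective (f.hom.app U).hom) : IsIso f := by
  have : ∀ U, IsIso (f.hom.app U) := fun U =>
    (ConcreteCategory.isIso_iff_bijective (f.hom.app U)).2 (hf U)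
  have h : IsIso f.hom := NatIso.isIso_of_isIso_app _
  have : IsIso ((IsFinitelyPresented k (A := T.FullSubcategory)).ι.map f) := h
  exact isIso_of_reflects_iso f (IsFinitelyPresented k (A := T.FullSubcategory)).ι

/-- A module presented by f : T₁ → T₀ is the image of the cone of f, because Hom(U, T₁⟦1⟧) = 0 for U
in `T`. -/
instance : (restrictedYoneda k T).EssSurj where
  mem_essImage M := by
    obtain ⟨T₁, T₀, f, p, w, ⟨hp⟩⟩ := M.property
    obtain ⟨X, b, c, h⟩ := IsDist.exists₃ f.hom
    have hepi : Epi p := epi_of_isColimit_cofork hp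
    obtain ⟨d, hd⟩ := CokernelCofork.IsColimit.desc' hp (ofHom k b) (by
      ext U x
      change (x.hom ≫ f.hom) ≫ b = 0
      rw [Category.assoc, h.zero₁₂, comp_zero])
    have hd' (U : T.FullSubcategoryᵒᵖ) (x : U.unop ⟶ T₀) :
        (d.app U).hom ((p.app U).hom x) = x.hom ≫ b :=
      congr((NatTrans.app $hd U).hom x)
    have : IsIso (ObjectProperty.homMk d : M ⟶ (restrictedYoneda k T).obj X) := by
      refine isIso_of_bijective _ fun U => ⟨?_, fun y => ?_⟩
      · change Function.Injective (d.app U).hom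
        rw [injective_iff_map_eq_zero]
        intro y hy
        rw [NatTrans.epi_iff_epi_app] at hepi
        obtain ⟨x, rfl⟩ := (ModuleCat.epi_iff_surjective _).1 (hepi U) y
        obtain ⟨z, hz⟩ := h.lift₁ x.hom ((hd' U x).symm.trans hy)
        have hx : (ObjectProperty.homMk z : U.unop ⟶ T₁) ≫ f = x := ObjectProperty.hom_ext _ hz
        have := congr((NatTrans.app $w U).hom (ObjectProperty.homMk z : U.unop ⟶ T₁))
        exact (congrArg (p.app U).hom hx.symm).trans this
      · obtain ⟨x, hx⟩ := h.exists_lift_of_mem T T₁.property U.unop.property y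
        exact ⟨(p.app U).hom (ObjectProperty.homMk x : U.unop ⟶ T₀), (hd' U _).trans hx⟩
    exact ⟨X, ⟨(asIso (ObjectProperty.homMk d : M ⟶ (restrictedYoneda k T).obj X)).symm⟩⟩

lemma exists_epi_restrictedYoneda (M : ModT k T) :
    ∃ (U : C) (_ : T U) (p : (restrictedYoneda k T).obj U ⟶ M), Epi p := by
  obtain ⟨T₁, T₀, h₁, h₀, a, b, c, h⟩ := exists_isDist T ((restrictedYoneda k T).objPreimage M)
  have : Epi ((restrictedYoneda k T).map b) := epi_of_surjective _ fun U y =>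
    h.exists_lift_of_mem T h₁ U.unop.property y
  exact ⟨T₀, h₀, (restrictedYoneda k T).map b ≫ ((restrictedYoneda k T).objObjPreimageIso M).hom,
    inferInstance⟩

/-- Exactness may be tested after covering the source by the image of some U in `T`. Maps from there
come from `C`, where the triangle is exact. -/
instance : (restrictedYoneda k T).IsHomological where
  exact S hS := by
    rw [ShortComplex.exact_iff_exact_up_to_refinements]
    intro M (x : M ⟶ (restrictedYoneda k T).obj S.obj₂)
      (hx : x ≫ (restrictedYoneda k T).map S.mor₂ = 0)
    obtain ⟨U, hU, p, hp⟩ := exists_epi_restrictedYoneda M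
    obtain ⟨y, hy⟩ := (restrictedYoneda_map_bijective hU S.obj₂).2 (p ≫ x)
    obtain ⟨z, hz⟩ := Triangle.coyoneda_exact₂ _ hS y
      ((restrictedYoneda_map_bijective (k := k) hU S.obj₃).1 (by
        rw [Functor.map_comp, hy, Category.assoc, hx, comp_zero, Functor.map_zero]))
    exact ⟨_, p, hp, (restrictedYoneda k T).map z,
      hy.symm.trans ((congrArg _ hz).trans (Functor.map_comp _ _ _))⟩

variable (k T) in
lemma isRestrictedYoneda_restrictedYoneda : IsRestrictedYoneda T (restrictedYoneda k T) where
  map_bijective := restrictedYoneda_map_bijective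
  projective {U} hU :=
    { factors := by
        intro M N f e he
        obtain ⟨y, hy⟩ := surjective_of_epi e (.op ⟨U, hU⟩)
          ((f.hom.app (.op ⟨U, hU⟩)).hom (𝟙 U))
        let g := (restrictedYoneda k T).objObjPreimageIso M
        obtain ⟨u, hu⟩ : ∃ u : U ⟶ (restrictedYoneda k T).objPreimage M,
            (g.hom.hom.app (.op ⟨U, hU⟩)).hom u = y := surjective_of_epi g.hom (.op ⟨U, hU⟩) y
        refine ⟨(restrictedYoneda k T).map u ≫ g.hom, ?_⟩
        refine ObjectProperty.hom_ext _ (restrictedHom_hom_ext hU ?_)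
        refine Eq.trans ?_ hy
        refine congrArg (e.hom.app (.op ⟨U, hU⟩)).hom (Eq.trans ?_ hu)
        exact congrArg (g.hom.hom.app (.op ⟨U, hU⟩)).hom (Category.id_comp u) }
  map_eq_zero f hf := by
    refine ObjectProperty.hom_ext _ ?_
    ext V x
    exact hf V.unop.property x

end RestrictedYonedaFunctor

end ClusterTilting

open ClusterTilting
theorem theorem3p3 {k : Type w} [Field k] {C : Type u} [Category.{v} C] [Preadditive C]
    [Linear k C] [HasZeroObject C] [HasShift C ℤ] [∀ n : ℤ, (shiftFunctor C n).Additive]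
    [∀ n : ℤ, (shiftFunctor C n).Linear k] [Pretriangulated C] [IsTriangulated C]
    [IsIdempotentComplete C] [∀ X Y : C, Module.Finite k (X ⟶ Y)]
    (_cy : CalabiYauStructure k C 2) (T : ObjectProperty C) [IsClusterTilting T]
    [HasDerivedCategory.{w₁} (ModT k T)] [HasExt.{w₂} (ModT k T)] :
    EnoughInjectives (ModT k T) ∧
    (∀ X Y : StableCM (ModT k T), Module.Finite k (X ⟶ Y)) ∧
    ∃ cy : CalabiYauStructure k (StableCM (ModT k T)) 3,
      ∀ (X Y I : ModT k T) (i : X ⟶ I) [Mono i] [Injective I],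
        ∃ φ : Module.Dual k (Abelian.Ext Y X 2) ≃ₗ[k]
            (Abelian.Ext X Y 1 ⧸
              LinearMap.range ((Abelian.Ext.mk₀ i).precompOfLinear k Y (zero_add 1))),
          ∀ (e : Abelian.Ext X Y 1) (f : Abelian.Ext Y X 2),
            φ.symm (Submodule.Quotient.mk e) f =
              cy.trace (toStableCM X) (extToStableCM (e.comp f (by rfl : 1 + 2 = 3))) := by
  have hF := isRestrictedYoneda_restrictedYoneda k T
  have := hF.enoughProjectives
  have := hF.isGorensteinOne _cy
  have := hF.finite_hom k
  have hfin (X Y : StableCM (ModT k T)) : Module.Finite k (X ⟶ Y) := finite_stableCM_hom k X Y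
  let τ := hF.extTrace _cy
  refine ⟨hF.enoughInjectives _cy, hfin, τ.traceFamily.calabiYauStructure,
    fun X Y I i _ _ => ⟨τ.dualExtEquiv i, fun e f => ?_⟩⟩
  exact (τ.traceFamily_trace _).symm.trans (τ.traceFamily.calabiYauStructure_trace _).symm
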